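/- \textbf{Definitions.} A permutation class is a set of permutations closed under containment of permutations. A monotone gridding matrix $\mathcal M$ of size $k\times\ell$ has $k$ columns and $\ell$ rows, and each entry is $\emptyset$, $\mathrm{Av}(21)$ (increasing permutations) or $\mathrm{Av}(12)$ (decreasing permutations). $\mathrm{Grid}(\mathcal M)$ is the set of all permutations $\pi$, say of length $m$, for which there are sequences $1=c_1\le\dots\le c_{k+1}=m+1$ and $1=r_1\le\dots\le r_{\ell+1}=m+1$ such that, for all $i,j$, the points $(x,\pi_x)$ with $c_i\le x<c_{i+1}$ and $r_j\le\pi_x<r_{j+1}$ form a permutation in $\mathcal M_{i,j}$ (there are no such points if $\mathcal M_{i,j}=\emptyset$). The cell graph of $\mathcal M$ has the non-empty entries as vertices, two of them being adjacent if they lie in the same row or column with no non-empty entry between them. A class $\mathcal C$ has the \emph{poly-time computable long path property} if some algorithm, given an integer $k\ge 1$, outputs in time polynomial in $k$ a monotone gridding matrix $\mathcal M$ such that $\mathrm{Grid}(\mathcal M)\subseteq\mathcal C$ and the cell graph of $\mathcal M$ is a path on $k$ vertices in which no three consecutive cells share the same row or the same column. MSO sentences in $\mathsf{TOG}$ are monadic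 second-order sentences over one binary relation symbol $E$; for a simple graph $G$, $G\models\varphi$ refers to the structure whose domain is the vertex set of $G$, with $E$ interpreted as adjacency. MSO sentences in $\mathsf{TOTO}$ are monadic second-order sentences over two binary relation symbols $<_1,<_2$; for a permutation $\pi$, $\pi\models\psi$ refers to the structure whose domain is the set of points $(x,\pi_x)$, ordered by first coordinate ($<_1$) and by second coordinate ($<_2$). Variables of both sorts (elements and sets) are quantified, and $x=y$ and $x\in X$ are atomic formulas. $|\varphi|$ is the number of symbols of $\varphi$, each occurrence of a variable counting as one. \textbf{Proposition.} There are a map $\varphi\mapsto\psi_\varphi$ from MSO sentences in $\mathsf{TOG}$ to MSO sentences in $\mathsf{TOTO}$, and constants $a,b$, such that $|\psi_\varphi|\le a|\varphi|$ for every $\varphi$, and the following holds for every permutation class $\mathcal C$ with the poly-time computable long path property. There is an algorithm that, given a graph $G$ on the vertex set $[n]$ ($n\ge 0$, given by its adjacency matrix) and an MSO sentence $\varphi$ in $\mathsf{TOG}$, computes, in time polynomial in the size of the input, a permutation $\pi\in\mathcal C$ of length at most $b(n^2+1)$ and the sentence $\psi_\varphi$, such that \[ G\models\varphi\iff\pi\models\psi_\varphi.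 \] In particular $\psi_\varphi$ depends only on $\varphi$, and not on $G$ or on $\mathcal C$. -/

import Mathlib

namespace PermMSO

/-! ### Monadic second-order logic over a signature of binary relation symbols -/

/-- MSO formulas over a signature whose relation symbols are the elements of `R`, all binary.
Element variables and set variables are named by natural numbers, separately. -/
inductive MSOFormula (R : Type) : Type
  | eq (x y : ℕ) : MSOFormula R
  | rel (r : R) (x y : ℕ) : MSOFormula R
  | mem (x X : ℕ) : MSOFormula R
  | not (φ : MSOFormula R) : MSOFormula R
  | and (φ χ : MSOFormula R) : MSOFormula R
  | or (φ χ : MSOFormula R) : MSOFormula R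
  | imp (φ χ : MSOFormula R) : MSOFormula R
  | iff (φ χ : MSOFormula R) : MSOFormula R
  | existsElem (x : ℕ) (φ : MSOFormula R) : MSOFormula R
  | forallElem (x : ℕ) (φ : MSOFormula R) : MSOFormula R
  | existsSet (X : ℕ) (φ : MSOFormula R) : MSOFormula R
  | forallSet (X : ℕ) (φ : MSOFormula R) : MSOFormula R

namespace MSOFormula

variable {R A : Type}

/-- The length of a formula: the number of occurrences of symbols and variables. -/
def length : MSOFormula R → ℕ
  | eq _ _ => 3
  | rel _ _ _ => 3
  | mem _ _ => 3
  | not φ => 1 + φ.length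
  | and φ χ => 1 + φ.length + χ.length
  | or φ χ => 1 + φ.length + χ.length
  | imp φ χ => 1 + φ.length + χ.length
  | iff φ χ => 1 + φ.length + χ.length
  | existsElem _ φ => 2 + φ.length
  | forallElem _ φ => 2 + φ.length
  | existsSet _ φ => 2 + φ.length
  | forallSet _ φ => 2 + φ.length

/-- The free element variables. -/
def freeElem : MSOFormula R → Set ℕ
  | eq x y => {x, y}
  | rel _ x y => {x, y}
  | mem x _ => {x}
  | not φ => φ.freeElem
  | and φ χ => φ.freeElem ∪ χ.freeElem
  | or φ χ => φ.freeElem ∪ χ.freeElem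
  | imp φ χ => φ.freeElem ∪ χ.freeElem
  | iff φ χ => φ.freeElem ∪ χ.freeElem
  | existsElem x φ => φ.freeElem \ {x}
  | forallElem x φ => φ.freeElem \ {x}
  | existsSet _ φ => φ.freeElem
  | forallSet _ φ => φ.freeElem

/-- The free set variables. -/
def freeSet : MSOFormula R → Set ℕ
  | eq _ _ => ∅
  | rel _ _ _ => ∅
  | mem _ X => {X}
  | not φ => φ.freeSet
  | and φ χ => φ.freeSet ∪ χ.freeSet
  | or φ χ => φ.freeSet ∪ χ.freeSet
  | imp φ χ => φ.freeSet ∪ χ.freeSet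
  | iff φ χ => φ.freeSet ∪ χ.freeSet
  | existsElem _ φ => φ.freeSet
  | forallElem _ φ => φ.freeSet
  | existsSet X φ => φ.freeSet \ {X}
  | forallSet X φ => φ.freeSet \ {X}

/-- Truth of a formula in the structure with domain `A` and relations `I`, under an assignment of
the variables. Element variables may be unassigned (`none`), so that sentences can be evaluated
in the empty structure as well; the value at an unassigned variable is never used by a sentence. -/
def Sat (I : R → A → A → Prop) : (ℕ → Option A) → (ℕ → Set A) → MSOFormula R → Prop
  | v, _, eq x y => ∃ a, v x = some a ∧ v y = some a
  | v, _, rel r x y => ∃ a b, v x = some a ∧ v y = some b ∧ I r a b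
  | v, V, mem x X => ∃ a, v x = some a ∧ a ∈ V X
  | v, V, not φ => ¬ Sat I v V φ
  | v, V, and φ χ => Sat I v V φ ∧ Sat I v V χ
  | v, V, or φ χ => Sat I v V φ ∨ Sat I v V χ
  | v, V, imp φ χ => Sat I v V φ → Sat I v V χ
  | v, V, iff φ χ => (Sat I v V φ ↔ Sat I v V χ)
  | v, V, existsElem x φ => ∃ a : A, Sat I (Function.update v x (some a)) V φ
  | v, V, forallElem x φ => ∀ a : A, Sat I (Function.update v x (some a)) V φ
  | v, V, existsSet X φ => ∃ S : Set A, Sat I v (Function.update V X S) φ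
  | v, V, forallSet X φ => ∀ S : Set A, Sat I v (Function.update V X S) φ

end MSOFormula

/-- MSO sentences: formulas without free variables. -/
def MSOSentence (R : Type) : Type :=
  {φ : MSOFormula R // φ.freeElem = ∅ ∧ φ.freeSet = ∅}

/-- The sentence `φ` holds in the structure with domain `A` and relations `I`. -/
def MSOSentence.Holds {R A : Type} (I : R → A → A → Prop) (φ : MSOSentence R) : Prop :=
  φ.1.Sat I (fun _ => none) (fun _ => ∅)

/-- The signature of graphs: the edge relation. -/
inductive GraphSymbol : Type
  | edge

/-- The signature of two orders. -/
inductive OrderSymbol : Type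
  | lt₁
  | lt₂

/-- `G ⊨ φ`: the domain is the vertex set and the only relation is adjacency. -/
def GraphModels {n : ℕ} (G : SimpleGraph (Fin n)) (φ : MSOSentence GraphSymbol) : Prop :=
  φ.Holds (A := Fin n) fun
    | .edge => fun u w => G.Adj u w

/-! ### Permutations and grid classes -/

/-- A permutation together with its length. Positions and values are counted from `0`. -/
abbrev Permutation : Type := Σ n : ℕ, Equiv.Perm (Fin n)

/-- `π ⊨ ψ`: a point `(i, π i)` of the diagram is identified with its position `i`; the first order
compares positions and the second one compares values. -/
def PermModels (π : Permutation) (ψ : MSOSentence OrderSymbol) : Prop :=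
  ψ.Holds (A := Fin π.1) fun
    | .lt₁ => fun i j => i < j
    | .lt₂ => fun i j => π.2 i < π.2 j

/-- `τ` contains `σ`: some points of `τ` are in the same relative order as those of `σ`. -/
def Contains (τ σ : Permutation) : Prop :=
  ∃ f : Fin σ.1 → Fin τ.1, StrictMono f ∧ ∀ i j, σ.2 i < σ.2 j ↔ τ.2 (f i) < τ.2 (f j)

/-- A permutation class: a hereditary set of permutations. -/
def IsPermClass (C : Set Permutation) : Prop :=
  ∀ τ ∈ C, ∀ σ, Contains τ σ → σ ∈ C

/-- The entries of a monotone gridding matrix: the empty class, the class of increasing and the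
class of decreasing permutations. -/
inductive CellType : Type
  | empty
  | increasing
  | decreasing

/-- A monotone gridding matrix; `entry i j` is the entry in column `i` and row `j`, rows being
counted from bottom to top. -/
structure GriddingMatrix : Type where
  cols : ℕ
  rows : ℕ
  entry : Fin cols → Fin rows → CellType

namespace GriddingMatrix

variable (M : GriddingMatrix)

/-- The `(i, j)`-cell of the gridding `(c, r)` of `π`, as a set of positions. -/
def cell (π : Permutation) (c : Fin (M.cols + 1) → ℕ) (r : Fin (M.rows + 1) → ℕ)
    (i : Fin M.cols) (j : Fin M.rows) : Set (Fin π.1) :=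
  {a | c i.castSucc ≤ (a : ℕ) ∧ (a : ℕ) < c i.succ ∧
    r j.castSucc ≤ (π.2 a : ℕ) ∧ (π.2 a : ℕ) < r j.succ}

/-- The points of `π` at the positions in `S` form a permutation of the given class. -/
def _root_.PermMSO.CellType.Allows (t : CellType) (π : Permutation) (S : Set (Fin π.1)) : Prop :=
  match t with
  | .empty => S = ∅
  | .increasing => StrictMonoOn π.2 S
  | .decreasing => StrictAntiOn π.2 S

/-- `(c, r)` is an `M`-gridding of `π`. -/
def IsGridding (π : Permutation) (c : Fin (M.cols + 1) → ℕ) (r : Fin (M.rows + 1) → ℕ) : Prop :=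
  Monotone c ∧ c 0 = 0 ∧ c (Fin.last _) = π.1 ∧
  Monotone r ∧ r 0 = 0 ∧ r (Fin.last _) = π.1 ∧
  ∀ i j, (M.entry i j).Allows π (M.cell π c r i j)

/-- The permutations that admit an `M`-gridding. -/
def Grid : Set Permutation :=
  {π | ∃ c r, M.IsGridding π c r}

/-- The non-empty entries of `M`. -/
abbrev NonemptyCell : Type :=
  {p : Fin M.cols × Fin M.rows // M.entry p.1 p.2 ≠ CellType.empty}

/-- The cell graph: two non-empty entries are adjacent if they are in the same column or in the
same row and all entries strictly between them are empty. -/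
def cellGraph : SimpleGraph M.NonemptyCell where
  Adj p q := p ≠ q ∧
    ((p.1.1 = q.1.1 ∧
        ∀ j, min p.1.2 q.1.2 < j → j < max p.1.2 q.1.2 → M.entry p.1.1 j = CellType.empty) ∨
      (p.1.2 = q.1.2 ∧
        ∀ i, min p.1.1 q.1.1 < i → i < max p.1.1 q.1.1 → M.entry i p.1.2 = CellType.empty))
  symm := ⟨by
    rintro p q ⟨hne, h | h⟩
    · refine ⟨hne.symm, Or.inl ⟨h.1.symm, fun j h₁ h₂ => ?_⟩⟩
      rw [← h.1]
      exact h.2 j (by rwa [min_comm]) (by rwa [max_comm])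
    · refine ⟨hne.symm, Or.inr ⟨h.1.symm, fun i h₁ h₂ => ?_⟩⟩
      rw [← h.1]
      exact h.2 i (by rwa [min_comm]) (by rwa [max_comm])⟩
  loopless := ⟨fun _ h => h.1 rfl⟩

/-- The cell graph of `M` is a path on `k` vertices, and no three consecutive cells of the path
share the same column or the same row. -/
def IsTurningPath (k : ℕ) : Prop :=
  ∃ e : SimpleGraph.pathGraph k ≃g M.cellGraph,
    ∀ a b c : Fin k, (a : ℕ) + 1 = b → (b : ℕ) + 1 = c →
      ¬ ((e a).1.1 = (e b).1.1 ∧ (e b).1.1 = (e c).1.1) ∧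
      ¬ ((e a).1.2 = (e b).1.2 ∧ (e b).1.2 = (e c).1.2)

end GriddingMatrix

/-! ### Computation

The model of computation is the WHILE language on binary trees. Every evaluation of a
subexpression is charged the full size of its value, as if the value were copied node by node.
So the total size of the memory grows by at most the time spent, and the model and Turing machines
simulate each other with polynomial overhead. -/

/-- The data: finite binary trees. -/
inductive Data : Type
  | nil
  | cons (a b : Data)
  deriving DecidableEq

namespace Data

/-- The number of nodes, leaves included. -/
def size : Data → ℕ
  | nil => 1
  | cons a b => 1 + a.size + b.size

def head : Data → Data
  | nil => nil
  | cons a _ => a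

def tail : Data → Data
  | nil => nil
  | cons _ b => b

def ofBool : Bool → Data
  | false => nil
  | true => cons nil nil

def ofList : List Data → Data
  | [] => nil
  | a :: l => cons a (ofList l)

/-- A number in unary. -/
def unary (n : ℕ) : Data := ofList (List.replicate n nil)

/-- A number in binary, least significant bit first. -/
def binary (n : ℕ) : Data := ofList (n.bits.map ofBool)

end Data

/-- A memory state: the values of the program variables. -/
abbrev Store : Type := ℕ → Data

/-- Expressions of the WHILE language. -/
inductive Expr : Type
  | var (x : ℕ)
  | nil
  | cons (e f : Expr)
  | head (e : Expr)
  | tail (e : Expr)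
  | eq (e f : Expr)

namespace Expr

def eval (s : Store) : Expr → Data
  | var x => s x
  | nil => Data.nil
  | cons e f => Data.cons (e.eval s) (f.eval s)
  | head e => (e.eval s).head
  | tail e => (e.eval s).tail
  | eq e f => Data.ofBool (decide (e.eval s = f.eval s))

/-- The time to evaluate an expression: the sum of the sizes of the values of all its
subexpressions. -/
def cost (s : Store) : Expr → ℕ
  | var x => (s x).size
  | nil => 1
  | cons e f => e.cost s + f.cost s + ((cons e f).eval s).size
  | head e => e.cost s + ((head e).eval s).size
  | tail e => e.cost s + ((tail e).eval s).size
  | eq e f => e.cost s + f.cost s + ((eq e f).eval s).size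

end Expr

/-- Programs of the WHILE language; in tests, `nil` is false and all other values are true. -/
inductive Program : Type
  | skip
  | assign (x : ℕ) (e : Expr)
  | seq (c d : Program)
  | cond (e : Expr) (c d : Program)
  | while (e : Expr) (c : Program)

/-- `Exec c s t s'`: started in the store `s`, the program `c` halts after time exactly `t` in the
store `s'`. -/
inductive Exec : Program → Store → ℕ → Store → Prop
  | skip (s : Store) : Exec .skip s 1 s
  | assign (x : ℕ) (e : Expr) (s : Store) :
      Exec (.assign x e) s (1 + e.cost s) (Function.update s x (e.eval s))
  | seq {c d : Program} {s₁ s₂ s₃ : Store} {t₁ t₂ : ℕ} :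
      Exec c s₁ t₁ s₂ → Exec d s₂ t₂ s₃ → Exec (.seq c d) s₁ (1 + t₁ + t₂) s₃
  | condTrue {e : Expr} {c d : Program} {s s' : Store} {t : ℕ} :
      e.eval s ≠ Data.nil → Exec c s t s' → Exec (.cond e c d) s (1 + e.cost s + t) s'
  | condFalse {e : Expr} {c d : Program} {s s' : Store} {t : ℕ} :
      e.eval s = Data.nil → Exec d s t s' → Exec (.cond e c d) s (1 + e.cost s + t) s'
  | whileTrue {e : Expr} {c : Program} {s₁ s₂ s₃ : Store} {t₁ t₂ : ℕ} :
      e.eval s₁ ≠ Data.nil → Exec c s₁ t₁ s₂ → Exec (.while e c) s₂ t₂ s₃ →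
      Exec (.while e c) s₁ (1 + e.cost s₁ + t₁ + t₂) s₃
  | whileFalse {e : Expr} {c : Program} {s : Store} :
      e.eval s = Data.nil → Exec (.while e c) s (1 + e.cost s) s

/-- On `input` (in variable `0`, all other variables being `nil`), the program `c` halts within
time `T`, and then variable `0` holds `output`. -/
def Program.Computes (c : Program) (input : Data) (T : ℕ) (output : Data) : Prop :=
  ∃ t ≤ T, ∃ s, Exec c (Function.update (fun _ => Data.nil) 0 input) t s ∧ s 0 = output

/-! ### Encodings of the inputs and outputs -/

/-- Formulas: a tag for the outermost symbol, followed by the encodings of its components.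
Names of variables are written in binary. -/
def MSOFormula.encode {R : Type} (symb : R → Data) : MSOFormula R → Data
  | eq x y => .cons (.unary 0) (.cons (.binary x) (.binary y))
  | rel r x y => .cons (.unary 1) (.cons (symb r) (.cons (.binary x) (.binary y)))
  | mem x X => .cons (.unary 2) (.cons (.binary x) (.binary X))
  | not φ => .cons (.unary 3) (φ.encode symb)
  | and φ χ => .cons (.unary 4) (.cons (φ.encode symb) (χ.encode symb))
  | or φ χ => .cons (.unary 5) (.cons (φ.encode symb) (χ.encode symb))
  | imp φ χ => .cons (.unary 6) (.cons (φ.encode symb) (χ.encode symb))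
  | iff φ χ => .cons (.unary 7) (.cons (φ.encode symb) (χ.encode symb))
  | existsElem x φ => .cons (.unary 8) (.cons (.binary x) (φ.encode symb))
  | forallElem x φ => .cons (.unary 9) (.cons (.binary x) (φ.encode symb))
  | existsSet X φ => .cons (.unary 10) (.cons (.binary X) (φ.encode symb))
  | forallSet X φ => .cons (.unary 11) (.cons (.binary X) (φ.encode symb))

def GraphSymbol.encode : GraphSymbol → Data
  | .edge => .unary 0

def OrderSymbol.encode : OrderSymbol → Data
  | .lt₁ => .unary 1
  | .lt₂ => .unary 2

def CellType.encode : CellType → Data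
  | .empty => .unary 0
  | .increasing => .unary 1
  | .decreasing => .unary 2

/-- A gridding matrix is encoded as the list of its columns. -/
def GriddingMatrix.encode (M : GriddingMatrix) : Data :=
  .ofList (List.ofFn fun i => .ofList (List.ofFn fun j => (M.entry i j).encode))

/-- A permutation is encoded as the list of its values, in unary. -/
def Permutation.encode (π : Permutation) : Data :=
  .ofList (List.ofFn fun i => .unary (π.2 i : ℕ))

open Classical in
/-- A graph on the vertex set `{0, …, n - 1}` is encoded by its adjacency matrix. -/
noncomputable def encodeGraph {n : ℕ} (G : SimpleGraph (Fin n)) : Data :=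
  .ofList (List.ofFn fun u => .ofList (List.ofFn fun w => .ofBool (decide (G.Adj u w))))

/-! ### The long path property -/

/-- The poly-time computable long path property: some algorithm, given `k ≥ 1`, outputs in time
polynomial in `k` a monotone gridding matrix `M` with `Grid(M) ⊆ C` whose cell graph is a path on
`k` vertices without three consecutive cells in the same row or column. -/
def HasPolyTimeLPP (C : Set Permutation) : Prop :=
  ∃ (c : Program) (p : Polynomial ℕ), ∀ k : ℕ, 1 ≤ k →
    ∃ M : GriddingMatrix, M.Grid ⊆ C ∧ M.IsTurningPath k ∧
      c.Computes (.unary k) (p.eval k) M.encode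

end PermMSO

open PermMSO

namespace PermMSO

/-! ### Programs: locality and cleaning -/

/-! The translation of sentences is an MSO interpretation of graphs in permutations. A fixed formula
`decodesVertex` picks out the points that stand for vertices, and a fixed formula `decodesEdge`
picks out the adjacent pairs. Quantifiers over elements are relativised to vertex points
(`translate`, `sat_translate`), so the length grows only by a constant factor. It remains to build,
inside the grid class of an arbitrary long path, a permutation of quadratic length from which these
two formulas recover `G`.

Take a path of `k = 3n + 2` cells. Rows and columns can be directed one after the other along the
path so that a cell is increasing exactly if the directions of its row and its column agree. Every
cell is filled with slots `0, …, 2n`. Along each row and each column, read in its direction, points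
are ordered by slot, then by position of the cell on the path, then by index. A line meets at most
two cells, and these are neighbours on the path. The points of one slot in one cell form a block:
they are consecutive in both orders. The points of a neighbouring cell interleave with the slots, so
away from the border slots `0` and `2n` the blocks are exactly the components of the relation
"consecutive in both orders", and a formula can count their points up to five.

The size of a block is the letter written there (`blockSize`). Border blocks have 5 points, inner
even slots have blocks of 4 points, which serve as walls, and the odd slot `2w + 1` is the track of
the vertex `w`, with blocks of at most 3 points. On this track, the single point in cell `3w + 1` is
the vertex `w`, a block of 2 points in cell `3u + 1` records that `u` and `w` are adjacent, and all
other blocks have 3 points. Links between points of small blocks that are consecutive in one of the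
orders connect all points of a track (`sameTrack`), and the walls stop them from leaving it
(`slot_eq_of_sameTrack`). Two points off the border lie in the same row if and only if no border
point lies between them in value (`separated_iff`). Cells of one row are at distance at most 1 on
the path, while letters 1 and 2 occur only in cells congruent to 1 modulo 3, so among these the same
row means the same cell. This gives `not_blockGT_one_iff` and `decodesEdge_iff`.

For the running time, `PolyTime` is a notion of polynomial-time function that is closed under
composition, pairing, case distinction and bounded iteration: programs return all auxiliary
variables unchanged, so they can be chained freely. The path is recovered from the matrix by
starting at an end cell and following shared lines, which alternate between rows and columns because
no three consecutive cells share a line. The permutation is obtained by sorting and ranking the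
points, and the sentence by recursion on its code with an explicit stack (`treeRec`). -/

/-- A strict upper bound for the variables of an expression. -/
def Expr.bound : Expr → ℕ
  | .var x => x + 1
  | .nil => 0
  | .cons e f => max e.bound f.bound
  | .head e => e.bound
  | .tail e => e.bound
  | .eq e f => max e.bound f.bound

/-- A strict upper bound for the variables of a program. -/
def Program.bound : Program → ℕ
  | .skip => 0
  | .assign x e => max (x + 1) e.bound
  | .seq c d => max c.bound d.bound
  | .cond e c d => max e.bound (max c.bound d.bound)
  | .while e c => max e.bound c.bound

theorem Expr.eval_congr {s r : Store} (e : Expr) (h : ∀ i < e.bound, r i = s i) :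
    e.eval r = e.eval s := by
  induction e with
  | var x => exact h x (by simp [Expr.bound])
  | nil => rfl
  | cons e f he hf | eq e f he hf =>
    simp only [Expr.bound, lt_sup_iff] at h
    simp [Expr.eval, he fun i hi => h i (.inl hi), hf fun i hi => h i (.inr hi)]
  | head e he | tail e he => simp [Expr.eval, he h]

theorem Expr.cost_congr {s r : Store} (e : Expr) (h : ∀ i < e.bound, r i = s i) :
    e.cost r = e.cost s := by
  induction e with
  | var x => simp [Expr.cost, h x (by simp [Expr.bound])]
  | nil => rfl
  | cons e f he hf | eq e f he hf =>
    have hev := Expr.eval_congr _ h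
    simp only [Expr.bound, lt_sup_iff] at h
    simp only [Expr.cost, he fun i hi => h i (.inl hi), hf fun i hi => h i (.inr hi), hev]
  | head e he | tail e he =>
    have hev := Expr.eval_congr _ h
    simp only [Expr.bound] at h
    simp only [Expr.cost, he h, hev]

theorem Data.size_pos (d : Data) : 1 ≤ d.size := by
  cases d <;> simp only [Data.size] <;> omega

theorem Expr.size_eval_le_cost (s : Store) (e : Expr) : (e.eval s).size ≤ e.cost s := by
  cases e <;> simp [Expr.cost, Expr.eval, Data.size]

/-- A program only reads and writes the variables below its bound. -/
theorem Exec.frame {c : Program} {s s' : Store} {t : ℕ} (h : Exec c s t s') :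
    ∀ {N : ℕ}, c.bound ≤ N → ∀ r : Store, (∀ i < N, r i = s i) →
      Exec c r t (fun i => if i < N then s' i else r i) := by
  induction h with
  | skip s =>
    intro N _ r hr
    have : (fun i => if i < N then s i else r i) = r := by
      funext i; split_ifs with hi
      · exact (hr i hi).symm
      · rfl
    rw [this]; exact .skip r
  | assign x e s =>
    intro N hN r hr
    simp only [Program.bound, sup_le_iff] at hN
    have hr' : ∀ i < e.bound, r i = s i := fun i hi => hr i (by omega)
    have : (fun i => if i < N then Function.update s x (e.eval s) i else r i)
        = Function.update r x (e.eval r) := by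
      funext i
      rw [Expr.eval_congr e hr']
      by_cases hx : i = x
      · subst hx; rw [if_pos (by omega)]; simp
      · simp only [Function.update_of_ne hx]
        split_ifs with hi
        · exact (hr i hi).symm
        · rfl
    rw [this, ← Expr.cost_congr e hr']
    exact .assign x e r
  | @seq c d s₁ s₂ s₃ t₁ t₂ _ _ ih₁ ih₂ =>
    intro N hN r hr
    simp only [Program.bound, sup_le_iff] at hN
    refine .seq (ih₁ hN.1 r hr) ?_
    have := ih₂ hN.2 (fun i => if i < N then s₂ i else r i) (fun i hi => by simp [hi])
    convert this using 2 with i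
    split_ifs <;> rfl
  | @condTrue e c d s s' t he _ ih =>
    intro N hN r hr
    simp only [Program.bound, sup_le_iff] at hN
    have hr' : ∀ i < e.bound, r i = s i := fun i hi => hr i (by omega)
    rw [← Expr.cost_congr e hr']
    exact .condTrue (by rwa [Expr.eval_congr e hr']) (ih hN.2.1 r hr)
  | @condFalse e c d s s' t he _ ih =>
    intro N hN r hr
    simp only [Program.bound, sup_le_iff] at hN
    have hr' : ∀ i < e.bound, r i = s i := fun i hi => hr i (by omega)
    rw [← Expr.cost_congr e hr']
    exact .condFalse (by rwa [Expr.eval_congr e hr']) (ih hN.2.2 r hr)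
  | @whileTrue e c s₁ s₂ s₃ t₁ t₂ he _ _ ih₁ ih₂ =>
    intro N hN r hr
    have hN' := hN
    simp only [Program.bound, sup_le_iff] at hN
    have hr' : ∀ i < e.bound, r i = s₁ i := fun i hi => hr i (by omega)
    rw [← Expr.cost_congr e hr']
    refine .whileTrue (by rwa [Expr.eval_congr e hr']) (ih₁ hN.2 r hr) ?_
    have := ih₂ hN' (fun i => if i < N then s₂ i else r i) (fun i hi => by simp [hi])
    convert this using 2 with i
    split_ifs <;> rfl
  | @whileFalse e c s he =>
    intro N hN r hr
    simp only [Program.bound, sup_le_iff] at hN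
    have hr' : ∀ i < e.bound, r i = s i := fun i hi => hr i (by omega)
    rw [← Expr.cost_congr e hr']
    have : (fun i => if i < N then s i else r i) = r := by
      funext i; split_ifs with hi
      · exact (hr i hi).symm
      · rfl
    rw [this]
    exact .whileFalse (by rwa [Expr.eval_congr e hr'])

/-- The values of the variables grow at most by the time spent. -/
theorem Exec.size_le {c : Program} {s s' : Store} {t : ℕ} (h : Exec c s t s') (x : ℕ) :
    (s' x).size ≤ (s x).size + t := by
  induction h with
  | skip s => omega
  | assign y e s =>
    by_cases hx : x = y
    · subst hx
      have := Expr.size_eval_le_cost s e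
      simp; omega
    · simp [Function.update_of_ne hx]
  | seq _ _ ih₁ ih₂ => omega
  | condTrue _ _ ih => omega
  | condFalse _ _ ih => omega
  | whileTrue _ _ _ ih₁ ih₂ => omega
  | whileFalse _ => omega

/-- Set the variables `1, …, n` to `nil`. -/
def clearVars : ℕ → Program
  | 0 => .skip
  | n + 1 => .seq (clearVars n) (.assign (n + 1) .nil)

theorem exec_clearVars (n : ℕ) (s : Store) :
    Exec (clearVars n) s (3 * n + 1) (fun i => if 0 < i ∧ i ≤ n then Data.nil else s i) := by
  induction n with
  | zero =>
    have : (fun i => if 0 < i ∧ i ≤ 0 then Data.nil else s i) = s := by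
      funext i; rw [if_neg (by omega)]
    rw [this]; exact .skip s
  | succ n ih =>
    have h := ih.seq (.assign (n + 1) .nil _)
    have ht : 1 + (3 * n + 1) + (1 + 1) = 3 * (n + 1) + 1 := by ring
    simp only [Expr.cost, ht] at h
    rw [clearVars]
    convert h using 1
    funext i
    by_cases hi : i = n + 1
    · subst hi; simp [Expr.eval]
    · rw [Function.update_of_ne hi]
      by_cases h : 0 < i ∧ i ≤ n
      · rw [if_pos h, if_pos (by omega)]
      · rw [if_neg h, if_neg (by omega)]

/-- The coefficients are natural numbers. Time bounds may therefore be evaluated at any upper bound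
for the size. -/
theorem eval_mono (p : Polynomial ℕ) {a b : ℕ} (h : a ≤ b) : p.eval a ≤ p.eval b := by
  induction p using Polynomial.induction_on' with
  | add p q hp hq => simp only [Polynomial.eval_add]; omega
  | monomial n c =>
    simp only [Polynomial.eval_monomial]
    exact Nat.mul_le_mul_left _ (Nat.pow_le_pow_left h n)

theorem exec_assign_of_eq {x : ℕ} {e : Expr} {s : Store} {d : Data} {k : ℕ}
    (h : e.eval s = d) (hk : e.cost s ≤ k) :
    ∃ t ≤ 1 + k, Exec (.assign x e) s t (Function.update s x d) :=
  ⟨1 + e.cost s, by omega, h ▸ .assign x e s⟩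

theorem Exec.exists_le {c : Program} {s s' s'' : Store} {t T : ℕ} (h : Exec c s t s')
    (hs : s'' = s') (ht : t ≤ T) : ∃ t ≤ T, Exec c s t s'' :=
  ⟨t, ht, hs ▸ h⟩

/-! ### Polynomial-time functions -/

/-- Encodings of the elements of a type as data. -/
class Enc (α : Type) where
  toData : α → Data

/-- The encoding of an element. -/
def enc {α : Type} [Enc α] (a : α) : Data := Enc.toData a

/-- The size of the encoding. -/
def esize {α : Type} [Enc α] (a : α) : ℕ := (enc a).size

/-- Functions that are computed in polynomial time by a program which leaves all variables except
`0` as they were, and which needs some variables to be `nil` at the start. -/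
def PolyTime {α β : Type} [Enc α] [Enc β] (f : α → β) : Prop :=
  ∃ (c : Program) (N : ℕ) (p : Polynomial ℕ), 0 < N ∧ ∀ (a : α) (s : Store), s 0 = enc a →
    (∀ i, 0 < i → i < N → s i = Data.nil) →
    ∃ t ≤ p.eval (esize a), Exec c s t (Function.update s 0 (enc (f a)))

section

variable {α β γ σ : Type} [Enc α] [Enc β] [Enc γ] [Enc σ]

/-- By `Exec.frame` the program touches only variables below its bound, so clearing these afterwards
restores everything except variable `0`. -/
theorem PolyTime.of_computes {f : α → β} (c : Program) (p : Polynomial ℕ)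
    (h : ∀ a, c.Computes (enc a) (p.eval (esize a)) (enc (f a))) : PolyTime f := by
  refine ⟨.seq c (clearVars c.bound), c.bound + 1, p + Polynomial.C (3 * c.bound + 2),
    by omega, fun a s hs hnil => ?_⟩
  obtain ⟨t, ht, s', hex, hs'⟩ := h a
  have h1 := hex.frame (N := c.bound + 1) (by omega) s (fun i hi => by
    rcases Nat.eq_zero_or_pos i with rfl | hi0
    · simpa using hs
    · rw [Function.update_of_ne (by omega)]; exact hnil i hi0 hi)
  have h2 := h1.seq (exec_clearVars c.bound _)
  refine h2.exists_le ?_ ?_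
  · funext i
    rcases Nat.eq_zero_or_pos i with rfl | hi0
    · simp [hs']
    · rw [Function.update_of_ne (by omega)]
      by_cases hi : i ≤ c.bound
      · rw [if_pos ⟨hi0, hi⟩]; exact hnil i hi0 (by omega)
      · rw [if_neg (by omega), if_neg (by omega)]
  · simp only [Polynomial.eval_add, Polynomial.eval_C]; omega

theorem PolyTime.computes {f : α → β} (h : PolyTime f) : ∃ (c : Program) (p : Polynomial ℕ),
    ∀ a, c.Computes (enc a) (p.eval (esize a)) (enc (f a)) := by
  obtain ⟨c, N, p, -, h⟩ := h
  refine ⟨c, p, fun a => ?_⟩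
  obtain ⟨t, ht, hex⟩ := h a (Function.update (fun _ => Data.nil) 0 (enc a)) (by simp)
    (fun i hi _ => by rw [Function.update_of_ne (by omega)])
  exact ⟨t, ht, _, hex, by simp⟩

/-- Values grow by at most the time spent (`Exec.size_le`). This is what keeps the time of a
composition polynomial. -/
theorem PolyTime.esize_le {f : α → β} (h : PolyTime f) :
    ∃ p : Polynomial ℕ, ∀ a, esize (f a) ≤ p.eval (esize a) := by
  obtain ⟨c, p, h⟩ := h.computes
  refine ⟨Polynomial.X + p, fun a => ?_⟩
  obtain ⟨t, ht, s, hex, hs⟩ := h a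
  have := hex.size_le 0
  rw [hs] at this
  simp only [Function.update_self] at this
  simp only [Polynomial.eval_add, Polynomial.eval_X]
  unfold esize at *
  omega

/-- Expressions in variable `0` are evaluated in polynomial time. -/
theorem PolyTime.of_expr {f : α → β} (e : Expr) (p : Polynomial ℕ)
    (he : ∀ (a : α) (s : Store), s 0 = enc a → e.eval s = enc (f a) ∧ e.cost s ≤ p.eval (esize a)) :
    PolyTime f := by
  refine ⟨.assign 0 e, 1, p + 1, by omega, fun a s hs _ => ?_⟩
  obtain ⟨h1, h2⟩ := he a s hs
  refine (Exec.assign 0 e s).exists_le (by rw [h1]) ?_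
  simp only [Polynomial.eval_add, Polynomial.eval_one]; omega

/-- Reinterpreting the same data as an element of another type only requires copying variable `0`.
Thus unary numbers serve as lists of units, and a pair of an element and a list as a longer list. -/
theorem PolyTime.of_enc_eq {f : α → β} (h : ∀ a, enc (f a) = enc a) : PolyTime f :=
  .of_expr (.var 0) .X fun a s hs => by
    simp [Expr.eval, Expr.cost, hs, h, esize]

theorem PolyTime.id : PolyTime (fun a : α => a) := .of_enc_eq fun _ => rfl

theorem exists_expr_const (d : Data) : ∃ (e : Expr) (k : ℕ), ∀ s, e.eval s = d ∧ e.cost s = k := by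
  induction d with
  | nil => exact ⟨.nil, 1, fun s => ⟨rfl, rfl⟩⟩
  | cons a b iha ihb =>
    obtain ⟨e, k, he⟩ := iha
    obtain ⟨f, l, hf⟩ := ihb
    exact ⟨.cons e f, k + l + (Data.cons a b).size, fun s => by
      simp [Expr.eval, Expr.cost, he s, hf s]⟩

theorem PolyTime.const (b : β) : PolyTime (fun _ : α => b) := by
  obtain ⟨e, k, he⟩ := exists_expr_const (enc b)
  exact .of_expr e (.C k) fun a s _ => by simp [he s]

theorem PolyTime.comp {g : β → γ} {f : α → β} (hg : PolyTime g) (hf : PolyTime f) :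
    PolyTime (fun a => g (f a)) := by
  obtain ⟨q, hq⟩ := hf.esize_le
  obtain ⟨c, N, p, hN, hc⟩ := hf
  obtain ⟨c', N', p', hN', hc'⟩ := hg
  refine ⟨.seq c c', max N N', p + p'.comp q + 1, by omega, fun a s hs hnil => ?_⟩
  obtain ⟨t, ht, hex⟩ := hc a s hs (fun i h0 hi => hnil i h0 (by omega))
  obtain ⟨t', ht', hex'⟩ := hc' (f a) (Function.update s 0 (enc (f a))) (by simp)
    (fun i h0 hi => by rw [Function.update_of_ne (by omega)]; exact hnil i h0 (by omega))
  rw [Function.update_idem] at hex'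
  refine ⟨_, ?_, hex.seq hex'⟩
  have := eval_mono p' (hq a)
  simp only [Polynomial.eval_add, Polynomial.eval_one, Polynomial.eval_comp]
  omega

instance : Enc Data := ⟨fun d => d⟩
instance : Enc ℕ := ⟨Data.unary⟩
instance : Enc Bool := ⟨Data.ofBool⟩
instance : Enc Unit := ⟨fun _ => Data.nil⟩
instance : Enc (α × β) := ⟨fun x => .cons (enc x.1) (enc x.2)⟩
instance : Enc (List α) := ⟨fun l => .ofList (l.map enc)⟩

theorem enc_data (d : Data) : enc d = d := rfl
theorem enc_nat (n : ℕ) : enc n = Data.unary n := rfl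
theorem enc_bool (b : Bool) : enc b = Data.ofBool b := rfl
theorem enc_pair (a : α) (b : β) : enc (a, b) = .cons (enc a) (enc b) := rfl
theorem enc_list_nil : enc ([] : List α) = Data.nil := rfl
theorem enc_list_cons (a : α) (l : List α) : enc (a :: l) = Data.cons (enc a) (enc l) := rfl
theorem esize_pair (a : α) (b : β) : esize (a, b) = 1 + esize a + esize b := rfl
theorem esize_list_nil : esize ([] : List α) = 1 := rfl
theorem esize_list_cons (a : α) (l : List α) : esize (a :: l) = 1 + esize a + esize l := rfl

theorem PolyTime.fst : PolyTime (fun x : α × β => x.1) :=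
  .of_expr (.head (.var 0)) (2 * .X) fun a s hs => by
    have h : enc a = .cons (enc a.1) (enc a.2) := rfl
    simp only [Expr.eval, Expr.cost, hs, esize, h, Data.head, true_and, Data.size,
      Polynomial.eval_mul, Polynomial.eval_ofNat, Polynomial.eval_X]
    omega

theorem PolyTime.snd : PolyTime (fun x : α × β => x.2) :=
  .of_expr (.tail (.var 0)) (2 * .X) fun a s hs => by
    have h : enc a = .cons (enc a.1) (enc a.2) := rfl
    simp only [Expr.eval, Expr.cost, hs, esize, h, Data.tail, true_and, Data.size,
      Polynomial.eval_mul, Polynomial.eval_ofNat, Polynomial.eval_X]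
    omega

/-- Two fresh variables above the scratch space of both programs hold a copy of the input and the
first result. They are reset to `nil` at the end. -/
theorem PolyTime.pair {f : α → β} {g : α → γ} (hf : PolyTime f) (hg : PolyTime g) :
    PolyTime (fun a => (f a, g a)) := by
  obtain ⟨q, hq⟩ := hf.esize_le
  obtain ⟨q', hq'⟩ := hg.esize_le
  obtain ⟨c, N₁, p, hN, hc⟩ := hf
  obtain ⟨c', N₂, p', hN', hc'⟩ := hg
  obtain ⟨N, rfl⟩ : ∃ N, N = max N₁ N₂ := ⟨_, rfl⟩
  refine ⟨.seq (.assign (max N₁ N₂) (.var 0)) (.seq c (.seq (.assign (max N₁ N₂ + 1) (.var 0))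
    (.seq (.assign 0 (.var (max N₁ N₂))) (.seq c' (.seq
      (.assign 0 (.cons (.var (max N₁ N₂ + 1)) (.var 0))) (.seq (.assign (max N₁ N₂) .nil)
        (.assign (max N₁ N₂ + 1) .nil))))))), max N₁ N₂ + 2,
    p + p' + 3 * q + 2 * q' + 2 * .X + 100, by omega, fun a s hs hnil => ?_⟩
  generalize hN : max N₁ N₂ = N at *
  have hN0 : 0 < N := by omega
  let s₁ := Function.update s N (enc a)
  obtain ⟨t₁, ht₁, h₁⟩ : ∃ t ≤ 1 + esize a, Exec (.assign N (.var 0)) s t s₁ :=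
    exec_assign_of_eq hs (by simp [Expr.cost, hs, esize])
  let s₂ := Function.update s₁ 0 (enc (f a))
  obtain ⟨t₂, ht₂, h₂⟩ : ∃ t ≤ p.eval (esize a), Exec c s₁ t s₂ :=
    hc a s₁ (by simp [s₁, Function.update_of_ne hN0.ne, hs]) (fun i h0 hi => by
      simp only [s₁]; rw [Function.update_of_ne (by omega)]; exact hnil i h0 (by omega))
  let s₃ := Function.update s₂ (N + 1) (enc (f a))
  obtain ⟨t₃, ht₃, h₃⟩ : ∃ t ≤ 1 + esize (f a), Exec (.assign (N + 1) (.var 0)) s₂ t s₃ :=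
    exec_assign_of_eq (by simp [Expr.eval, s₂]) (by simp [Expr.cost, s₂, esize])
  let s₄ := Function.update s₃ 0 (enc a)
  have e₃ : s₃ N = enc a := by
    simp [s₃, s₂, s₁, hN0.ne']
  obtain ⟨t₄, ht₄, h₄⟩ : ∃ t ≤ 1 + esize a, Exec (.assign 0 (.var N)) s₃ t s₄ :=
    exec_assign_of_eq e₃ (by simp [Expr.cost, e₃, esize])
  let s₅ := Function.update s₄ 0 (enc (g a))
  obtain ⟨t₅, ht₅, h₅⟩ : ∃ t ≤ p'.eval (esize a), Exec c' s₄ t s₅ :=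
    hc' a s₄ (by simp [s₄]) (fun i h0 hi => by
      simp only [s₄, s₃, s₂, s₁]
      rw [Function.update_of_ne (by omega), Function.update_of_ne (by omega),
        Function.update_of_ne (by omega), Function.update_of_ne (by omega)]
      exact hnil i h0 (by omega))
  let s₆ := Function.update s₅ 0 (enc (f a, g a))
  have e₅ : s₅ (N + 1) = enc (f a) := by simp [s₅, s₄, s₃]
  have e₅' : s₅ 0 = enc (g a) := by simp [s₅]
  obtain ⟨t₆, ht₆, h₆⟩ : ∃ t ≤ 1 + (2 * esize (f a) + 2 * esize (g a) + 1),
      Exec (.assign 0 (.cons (.var (N + 1)) (.var 0))) s₅ t s₆ :=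
    exec_assign_of_eq (by simp [Expr.eval, e₅, e₅', enc_pair]) (by
      simp only [Expr.cost, Expr.eval, e₅, e₅', Data.size, esize]; omega)
  obtain ⟨t₇, ht₇, h₇⟩ : ∃ t ≤ 1 + 1, Exec (.assign N .nil) s₆ t (Function.update s₆ N .nil) :=
    exec_assign_of_eq rfl le_rfl
  obtain ⟨t₈, ht₈, h₈⟩ : ∃ t ≤ 1 + 1, Exec (.assign (N + 1) .nil) (Function.update s₆ N .nil) t
      (Function.update (Function.update s₆ N .nil) (N + 1) .nil) :=
    exec_assign_of_eq rfl le_rfl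
  refine (h₁.seq (h₂.seq (h₃.seq (h₄.seq (h₅.seq (h₆.seq (h₇.seq h₈))))))).exists_le ?_ ?_
  · funext i
    simp only [s₆, s₅, s₄, s₃, s₂, s₁, Function.update_apply]
    split_ifs <;> first | rfl | omega | (subst i; exact hnil _ (by omega) (by omega))
  · have := hq a
    have := hq' a
    simp only [Polynomial.eval_add, Polynomial.eval_mul, Polynomial.eval_X, Polynomial.eval_ofNat]
    omega

/-- The test would overwrite the input, so it is first paired with it. The branches then read the
second component. -/
theorem PolyTime.cond {b : α → Bool} {f g : α → β} (hb : PolyTime b) (hf : PolyTime f)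
    (hg : PolyTime g) : PolyTime (fun a => if b a then f a else g a) := by
  suffices h : PolyTime (fun x : Bool × α => if x.1 then f x.2 else g x.2) from
    h.comp (hb.pair .id)
  obtain ⟨c, N, p, hN, hc⟩ := hf.comp (PolyTime.snd (α := Bool) (β := α))
  obtain ⟨c', N', p', hN', hc'⟩ := hg.comp (PolyTime.snd (α := Bool) (β := α))
  refine ⟨.cond (.head (.var 0)) c c', max N N', p + p' + 2 * .X + 1, by omega,
    fun a s hs hnil => ?_⟩
  obtain ⟨t, ht, h⟩ := hc a s hs (fun i h0 hi => hnil i h0 (by omega))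
  obtain ⟨t', ht', h'⟩ := hc' a s hs (fun i h0 hi => hnil i h0 (by omega))
  obtain ⟨b, a⟩ := a
  have hcost : (Expr.head (.var 0)).cost s ≤ 2 * esize (b, a) := by
    simp only [Expr.cost, Expr.eval, hs, enc_pair, Data.head, esize, Data.size]
    omega
  cases b with
  | true =>
    refine ⟨_, ?_, .condTrue (by simp [Expr.eval, hs, enc_pair, Data.head, enc_bool, Data.ofBool])
      (by simpa using h)⟩
    simp only [Polynomial.eval_add, Polynomial.eval_mul, Polynomial.eval_X, Polynomial.eval_ofNat,
      Polynomial.eval_one]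
    omega
  | false =>
    refine ⟨_, ?_, .condFalse (by simp [Expr.eval, hs, enc_pair, Data.head, enc_bool, Data.ofBool])
      (by simpa using h')⟩
    simp only [Polynomial.eval_add, Polynomial.eval_mul, Polynomial.eval_X, Polynomial.eval_ofNat,
      Polynomial.eval_one]
    omega

/-- Iterating a polynomial-time step over a list, as long as the states remain small. -/
theorem PolyTime.foldl {l : γ → List α} {init : γ → σ} {f : γ → σ → α → σ}
    (hf : PolyTime (fun x : γ × (σ × α) => f x.1 x.2.1 x.2.2)) (hl : PolyTime l)
    (hinit : PolyTime init) (q : Polynomial ℕ)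
    (hbound : ∀ c l', l' <+: l c → esize (l'.foldl (f c) (init c)) ≤ q.eval (esize c)) :
    PolyTime (fun c => (l c).foldl (f c) (init c)) := by
  -- The loop is analysed with one number `m` that bounds the input and all intermediate states, so
  -- that every pass has the same cost bound.
  suffices h : ∃ (c : Program) (N : ℕ) (p : Polynomial ℕ), 0 < N ∧
      ∀ (x : γ × (List α × σ)) (m : ℕ) (s : Store), s 0 = enc x → esize x ≤ m →
      (∀ l', l' <+: x.2.1 → esize (l'.foldl (f x.1) x.2.2) ≤ m) →
      (∀ i, 0 < i → i < N → s i = Data.nil) →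
      ∃ t ≤ p.eval m, Exec c s t (Function.update s 0 (enc (x.2.1.foldl (f x.1) x.2.2))) by
    obtain ⟨c₀, N₀, p₀, hN₀, h₀⟩ := PolyTime.id.pair (hl.pair hinit)
    obtain ⟨r, hr⟩ := (PolyTime.id.pair (hl.pair hinit)).esize_le
    obtain ⟨c, N, p, hN, h⟩ := h
    refine ⟨.seq c₀ c, max N₀ N, p₀ + p.comp (r + q) + 1, by omega, fun a s hs hnil => ?_⟩
    obtain ⟨t₀, ht₀, hex₀⟩ := h₀ a s hs (fun i h0 hi => hnil i h0 (by omega))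
    obtain ⟨t, ht, hex⟩ := h (a, (l a, init a)) ((r + q).eval (esize a))
      (Function.update s 0 (enc (a, (l a, init a)))) (by simp)
      (by have := hr a; simp only [Polynomial.eval_add]; omega)
      (fun l' hl' => by have := hbound a l' hl'; simp only [Polynomial.eval_add]; omega)
      (fun i h0 hi => by rw [Function.update_of_ne (by omega)]; exact hnil i h0 (by omega))
    rw [Function.update_idem] at hex
    refine ⟨_, ?_, hex₀.seq hex⟩
    simp only [Polynomial.eval_add, Polynomial.eval_comp, Polynomial.eval_one] at ht ⊢
    omega
  obtain ⟨c, N, p, hN, hc⟩ := hf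
  -- Variables `N`, `N + 1` and `N + 2` hold the parameter, the remaining list and the current
  -- state.
  let body : Program := .seq (.assign 0 (.cons (.var N) (.cons (.var (N + 2)) (.head (.var (N + 1))))))
    (.seq c (.seq (.assign (N + 2) (.var 0)) (.assign (N + 1) (.tail (.var (N + 1))))))
  -- The step is applied to a triple of values of size at most `m` each, whence `3 * .X + 2`; the
  -- other terms pay for the assignments and the test.
  let R : Polynomial ℕ := p.comp (3 * .X + 2) + 30 * .X + 100
  have loop : ∀ (m : ℕ) (g : γ) (l : List α) (st : σ) (s : Store), s N = enc g →
      s (N + 1) = enc l → s (N + 2) = enc st → esize g ≤ m → esize l ≤ m →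
      (∀ l', l' <+: l → esize (l'.foldl (f g) st) ≤ m) →
      (∀ i, 0 < i → i < N → s i = Data.nil) →
      ∃ t ≤ (l.length + 1) * R.eval m, ∃ s' : Store,
        Exec (.while (.var (N + 1)) body) s t s' ∧ s' (N + 1) = Data.nil ∧
        s' (N + 2) = enc (l.foldl (f g) st) ∧
        ∀ i, i ≠ 0 → i ≠ N + 1 → i ≠ N + 2 → s' i = s i := by
    intro m g l
    induction l with
    | nil =>
      intro st s h1 h2 h3 h4 h5 _ _
      refine ⟨_, ?_, s, .whileFalse (by simp [Expr.eval, h2, enc_list_nil]), h2, h3, by simp⟩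
      simp only [Expr.cost, h2, enc_list_nil, Data.size, R, Polynomial.eval_add,
        Polynomial.eval_ofNat]
      simp
    | cons a l ih =>
      intro st s h1 h2 h3 h4 h5 h6 h7
      rw [esize_list_cons] at h5
      have hst : esize st ≤ m := h6 [] (List.nil_prefix)
      let s₁ := Function.update s 0 (enc (g, (st, a)))
      obtain ⟨t₁, ht₁, e₁⟩ : ∃ t ≤ 1 + (20 * m + 20), Exec (.assign 0
          (.cons (.var N) (.cons (.var (N + 2)) (.head (.var (N + 1)))))) s t s₁ :=
        exec_assign_of_eq (by simp [Expr.eval, h1, h2, h3, enc_list_cons, Data.head, enc_pair]) (by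
          simp only [Expr.cost, Expr.eval, h1, h2, h3, enc_list_cons, Data.head, Data.size]
          simp only [esize] at *
          omega)
      obtain ⟨t₂, ht₂, e₂⟩ := hc (g, (st, a)) s₁ (by simp [s₁]) (fun i h0 hi => by
        simp only [s₁]; rw [Function.update_of_ne (by omega)]; exact h7 i h0 hi)
      simp only [s₁, Function.update_idem] at e₂
      have ht₂' : t₂ ≤ p.eval (3 * m + 2) := ht₂.trans (eval_mono p (by
        simp only [esize_pair]; omega))
      obtain ⟨s₂, hs₂⟩ : ∃ s₂, s₂ = Function.update s 0 (enc (f g st a)) := ⟨_, rfl⟩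
      rw [← hs₂] at e₂
      have hb := h6 [a] (by simp)
      simp only [List.foldl_cons, List.foldl_nil] at hb
      let s₃ := Function.update s₂ (N + 2) (enc (f g st a))
      obtain ⟨t₃, ht₃, e₃⟩ : ∃ t ≤ 1 + m, Exec (.assign (N + 2) (.var 0)) s₂ t s₃ :=
        exec_assign_of_eq (by simp [Expr.eval, hs₂]) (by simpa [Expr.cost, hs₂, esize] using hb)
      have h3n : s₃ (N + 1) = enc (a :: l) := by
        simp [s₃, hs₂, h2]
      let s₄ := Function.update s₃ (N + 1) (enc l)
      obtain ⟨t₄, ht₄, e₄⟩ : ∃ t ≤ 1 + 2 * m, Exec (.assign (N + 1) (.tail (.var (N + 1)))) s₃ t s₄ :=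
        exec_assign_of_eq (by simp [Expr.eval, h3n, enc_list_cons, Data.tail]) (by
          simp only [Expr.cost, Expr.eval, h3n, enc_list_cons, Data.tail, Data.size]
          simp only [esize] at *
          omega)
      obtain ⟨t, ht, s', hex, ha, hb', hc'⟩ := ih (f g st a) s₄
        (by simp [s₄, s₃, hs₂, h1, hN.ne']) (by simp [s₄]) (by simp [s₄, s₃]) h4 (by omega)
        (fun l' hl' => h6 (a :: l') (by simpa using hl'))
        (fun i h0 hi => by
          simp only [s₄, s₃, hs₂]
          rw [Function.update_of_ne (by omega), Function.update_of_ne (by omega),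
            Function.update_of_ne (by omega)]
          exact h7 i h0 hi)
      refine ⟨_, ?_, s', .whileTrue (by simp [Expr.eval, h2, enc_list_cons])
        (e₁.seq (e₂.seq (e₃.seq e₄))) hex, ha, hb', fun i i0 i1 i2 => ?_⟩
      · rw [List.length_cons]
        have : (Expr.var (N + 1)).cost s ≤ m := by
          simp only [Expr.cost, h2]; exact h5
        have hR : R.eval m = p.eval (3 * m + 2) + 30 * m + 100 := by
          simp [R, Polynomial.eval_comp]
        rw [add_mul _ 1, one_mul]
        omega
      · rw [hc' i i0 i1 i2]
        simp only [s₄, s₃, hs₂]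
        rw [Function.update_of_ne i1, Function.update_of_ne i2, Function.update_of_ne i0]
  refine ⟨.seq (.assign N (.head (.var 0))) (.seq (.assign (N + 1) (.head (.tail (.var 0))))
    (.seq (.assign (N + 2) (.tail (.tail (.var 0)))) (.seq (.while (.var (N + 1)) body)
      (.seq (.assign 0 (.var (N + 2))) (.seq (.assign N .nil) (.assign (N + 2) .nil)))))), N + 3,
      (.X + 1) * R + 20 * .X + 100, by omega, ?_⟩
  rintro ⟨g, l, st⟩ m s hs hm hpre hnil
  have hm' := hm
  simp only [esize_pair] at hm'
  simp only at hpre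
  simp only [enc_pair] at hs
  let s₁ := Function.update s N (enc g)
  have hs₁ : s₁ 0 = s 0 := by simp [s₁, hN.ne]
  obtain ⟨t₁, ht₁, e₁⟩ : ∃ t ≤ 1 + 4 * m, Exec (.assign N (.head (.var 0))) s t s₁ :=
    exec_assign_of_eq (by simp [Expr.eval, hs, Data.head]) (by
      simp only [Expr.cost, Expr.eval, hs, Data.head, Data.size]; simp only [esize] at *; omega)
  let s₂ := Function.update s₁ (N + 1) (enc l)
  have hs₂ : s₂ 0 = s 0 := by simp [s₂, hs₁]
  obtain ⟨t₂, ht₂, e₂⟩ : ∃ t ≤ 1 + 4 * m,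
      Exec (.assign (N + 1) (.head (.tail (.var 0)))) s₁ t s₂ :=
    exec_assign_of_eq (by simp [Expr.eval, hs₁, hs, Data.head, Data.tail]) (by
      simp only [Expr.cost, Expr.eval, hs₁, hs, Data.head, Data.tail, Data.size]
      simp only [esize] at *; omega)
  let s₃ := Function.update s₂ (N + 2) (enc st)
  obtain ⟨t₃, ht₃, e₃⟩ : ∃ t ≤ 1 + 4 * m,
      Exec (.assign (N + 2) (.tail (.tail (.var 0)))) s₂ t s₃ :=
    exec_assign_of_eq (by simp [Expr.eval, hs₂, hs, Data.tail]) (by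
      simp only [Expr.cost, Expr.eval, hs₂, hs, Data.tail, Data.size]
      simp only [esize] at *; omega)
  obtain ⟨t₄, ht₄, s₄, e₄, ha, hb, hother⟩ := loop m g l st s₃ (by simp [s₃, s₂, s₁])
    (by simp [s₃, s₂]) (by simp [s₃]) (by omega) (by omega) hpre (fun i h0 hi => by
      simp only [s₃, s₂, s₁]
      rw [Function.update_of_ne (by omega), Function.update_of_ne (by omega),
        Function.update_of_ne (by omega)]
      exact hnil i h0 (by omega))
  have hfin : esize (l.foldl (f g) st) ≤ m := hpre l List.prefix_rfl
  obtain ⟨t₅, ht₅, e₅⟩ : ∃ t ≤ 1 + m, Exec (.assign 0 (.var (N + 2))) s₄ t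
      (Function.update s₄ 0 (enc (l.foldl (f g) st))) :=
    exec_assign_of_eq (by simp [Expr.eval, hb]) (by simpa [Expr.cost, hb, esize] using hfin)
  obtain ⟨t₆, ht₆, e₆⟩ : ∃ t ≤ 1 + 1, Exec (.assign N .nil)
      (Function.update s₄ 0 (enc (l.foldl (f g) st))) t (Function.update
        (Function.update s₄ 0 (enc (l.foldl (f g) st))) N .nil) := exec_assign_of_eq rfl le_rfl
  obtain ⟨t₇, ht₇, e₇⟩ : ∃ t ≤ 1 + 1, Exec (.assign (N + 2) .nil) (Function.update
        (Function.update s₄ 0 (enc (l.foldl (f g) st))) N .nil) t (Function.update (Function.update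
        (Function.update s₄ 0 (enc (l.foldl (f g) st))) N .nil) (N + 2) .nil) :=
    exec_assign_of_eq rfl le_rfl
  refine (e₁.seq (e₂.seq (e₃.seq (e₄.seq (e₅.seq (e₆.seq e₇)))))).exists_le ?_ ?_
  · funext i
    simp only [Function.update_apply]
    split_ifs with c1 c2 c3 c4 c5
    · omega
    · omega
    · rfl
    · subst c4; exact hnil _ (by omega) (by omega)
    · subst c5; exact hnil _ (by omega) (by omega)
    · by_cases i1 : i = N + 1
      · subst i1; rw [ha]; exact hnil _ (by omega) (by omega)
      · rw [hother i c1 i1 c4]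
        simp [s₃, s₂, s₁, c4, c5, i1]
  · have hlen : l.length + 1 ≤ m + 1 := by
      have : l.length + 1 ≤ esize l := by
        clear * -
        induction l with
        | nil => simp [esize_list_nil]
        | cons a l ih => simp only [List.length_cons, esize_list_cons]; omega
      omega
    have := Nat.mul_le_mul_right (R.eval m) hlen
    simp only [Polynomial.eval_add, Polynomial.eval_mul, Polynomial.eval_X, Polynomial.eval_ofNat,
      Polynomial.eval_one]
    omega

end

/-! ### A library of polynomial-time functions -/

section

variable {α β γ σ : Type} [Enc α] [Enc β] [Enc γ] [Enc σ]

/-! ### Lists -/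

theorem esize_le_of_mem {a : α} {l : List α} (h : a ∈ l) : esize a ≤ esize l := by
  induction l with
  | nil => simp at h
  | cons b l ih =>
    rw [esize_list_cons]
    rcases List.mem_cons.1 h with rfl | h
    · omega
    · have := ih h; omega

theorem length_le_esize (l : List α) : l.length ≤ esize l := by
  induction l with
  | nil => simp
  | cons b l ih => rw [esize_list_cons, List.length_cons]; omega

theorem PolyTime.cons {f : γ → α} {g : γ → List α} (hf : PolyTime f) (hg : PolyTime g) :
    PolyTime (fun c => f c :: g c) :=
  (PolyTime.of_enc_eq (f := fun x : α × List α => x.1 :: x.2) fun _ => rfl).comp (hf.pair hg)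

/-- Iterating a step that adds a bounded amount to the state. -/
theorem PolyTime.foldl_of_growth {l : γ → List α} {init : γ → σ} {f : γ → σ → α → σ}
    (hf : PolyTime (fun x : γ × (σ × α) => f x.1 x.2.1 x.2.2)) (hl : PolyTime l)
    (hinit : PolyTime init)
    (hgrow : ∃ r : Polynomial ℕ, ∀ c a st, esize (f c st a) ≤ esize st + r.eval (esize (c, a))) :
    PolyTime (fun c => (l c).foldl (f c) (init c)) := by
  obtain ⟨r, hr⟩ := hgrow
  obtain ⟨p, hp⟩ := hl.esize_le
  obtain ⟨q, hq⟩ := hinit.esize_le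
  refine .foldl hf hl hinit (q + p * r.comp (.X + p + 1)) fun c l' hl' => ?_
  have key : ∀ (B : ℕ) (l' : List α) (st : σ), (∀ a ∈ l', esize (c, a) ≤ B) →
      esize (l'.foldl (f c) st) ≤ esize st + l'.length * r.eval B := by
    intro B l'
    induction l' with
    | nil => intro st _; simp
    | cons a l' ih =>
      intro st hB
      have h1 := ih (f c st a) fun b hb => hB b (by simp [hb])
      have h2 := hr c a st
      have h3 := eval_mono r (hB a (by simp))
      rw [List.foldl_cons, List.length_cons, add_mul, one_mul]
      omega
  have h1 := key (esize c + p.eval (esize c) + 1) l' (init c) fun a ha => by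
    have h1 := esize_le_of_mem (hl'.subset ha)
    have h2 := hp c
    rw [esize_pair]; omega
  have h2 : l'.length ≤ p.eval (esize c) :=
    hl'.length_le.trans ((length_le_esize _).trans (hp c))
  have h3 := Nat.mul_le_mul_right (r.eval (esize c + p.eval (esize c) + 1)) h2
  have h4 := hq c
  simp only [Polynomial.eval_add, Polynomial.eval_mul, Polynomial.eval_comp, Polynomial.eval_X,
    Polynomial.eval_one]
  omega

theorem PolyTime.reverse {f : γ → List α} (hf : PolyTime f) : PolyTime (fun c => (f c).reverse) := by
  have : PolyTime (fun c => (f c).foldl (fun l a => a :: l) []) :=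
    .foldl_of_growth (.cons (.comp .snd .snd) (.comp .fst .snd)) hf (.const [])
      ⟨.X, fun c a st => by
        rw [esize_list_cons, esize_pair, Polynomial.eval_X]; omega⟩
  simpa using this

theorem PolyTime.map {l : γ → List α} {f : γ → α → β} (hf : PolyTime (fun x : γ × α => f x.1 x.2))
    (hl : PolyTime l) : PolyTime (fun c => (l c).map (f c)) := by
  obtain ⟨p, hp⟩ := hf.esize_le
  have : PolyTime (fun c => ((l c).foldl (fun l' a => f c a :: l') []).reverse) :=
    .reverse (.foldl_of_growth
      (.cons (hf.comp (.pair .fst (.comp .snd .snd))) (.comp .fst .snd)) hl (.const [])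
      ⟨1 + p, fun c a st => by
        have : esize (f c a) ≤ _ := hp (c, a)
        rw [esize_list_cons]; simp only [Polynomial.eval_add, Polynomial.eval_one]; omega⟩)
  have h : ∀ (c : γ) (l : List α) (l' : List β),
      (l.foldl (fun l' a => f c a :: l') l').reverse = l'.reverse ++ l.map (f c) := by
    intro c l
    induction l with
    | nil => simp
    | cons a l _ => intro l'; simp
  simpa [h] using this

theorem PolyTime.filter {l : γ → List α} {f : γ → α → Bool}
    (hf : PolyTime (fun x : γ × α => f x.1 x.2))
    (hl : PolyTime l) : PolyTime (fun c => (l c).filter (f c)) := by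
  have : PolyTime (fun c => ((l c).foldl (fun l' a => if f c a then a :: l' else l') []).reverse) :=
    .reverse (.foldl_of_growth
      (.cond (hf.comp (.pair .fst (.comp .snd .snd))) (.cons (.comp .snd .snd) (.comp .fst .snd))
        (.comp .fst .snd)) hl (.const [])
      ⟨.X, fun c a st => by
        split_ifs
        · rw [esize_list_cons, esize_pair, Polynomial.eval_X]; omega
        · omega⟩)
  have h : ∀ (c : γ) (l : List α) (l' : List α),
      (l.foldl (fun l' a => if f c a then a :: l' else l') l').reverse
        = l'.reverse ++ l.filter (f c) := by
    intro c l
    induction l with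
    | nil => simp
    | cons a l ih =>
      intro l'
      rw [List.foldl_cons, ih, List.filter_cons]
      split_ifs <;> simp
  simpa [h] using this

theorem PolyTime.append {f g : γ → List α} (hf : PolyTime f) (hg : PolyTime g) :
    PolyTime (fun c => f c ++ g c) := by
  have : PolyTime (fun c => (f c).reverse.foldl (fun l a => a :: l) (g c)) :=
    .foldl_of_growth (.cons (.comp .snd .snd) (.comp .fst .snd)) hf.reverse hg
      ⟨.X, fun c a st => by
        rw [esize_list_cons, esize_pair, Polynomial.eval_X]; omega⟩
  have h : ∀ l l' : List α, l.reverse.foldl (fun l a => a :: l) l' = l ++ l' := by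
    intro l l'; simp
  simpa only [h] using this

theorem esize_append (l l' : List α) : esize (l ++ l') + 1 = esize l + esize l' := by
  induction l with
  | nil => simp [esize_list_nil]; omega
  | cons a l ih => simp only [List.cons_append, esize_list_cons]; omega

theorem PolyTime.flatten {f : γ → List (List α)} (hf : PolyTime f) :
    PolyTime (fun c => (f c).flatten) := by
  have : PolyTime (fun c => (f c).foldl (fun l a => l ++ a) []) :=
    .foldl_of_growth (.append (.comp .fst .snd) (.comp .snd .snd)) hf (.const [])
      ⟨.X, fun c a st => by
        have := esize_append st a
        rw [esize_pair, Polynomial.eval_X]; omega⟩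
  have h : ∀ (l : List (List α)) (l' : List α),
      l.foldl (fun l a => l ++ a) l' = l' ++ l.flatten := by
    intro l
    induction l with
    | nil => simp
    | cons a l ih => intro l'; simp [ih]
  simpa [h] using this

theorem PolyTime.flatMap {l : γ → List α} {f : γ → α → List β}
    (hf : PolyTime (fun x : γ × α => f x.1 x.2)) (hl : PolyTime l) :
    PolyTime (fun c => (l c).flatMap (f c)) := by
  simpa only [List.flatMap_def] using (PolyTime.map hf hl).flatten

theorem PolyTime.tail {f : γ → List α} (hf : PolyTime f) : PolyTime (fun c => (f c).tail) := by
  refine PolyTime.comp (g := fun l : List α => l.tail) (.of_expr (.tail (.var 0)) (2 * .X) ?_) hf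
  intro l s hs
  cases l with
  | nil =>
    simp [Expr.eval, Expr.cost, hs, enc_list_nil, Data.tail, esize_list_nil, Data.size]
  | cons a l =>
    simp only [Expr.eval, Expr.cost, hs, enc_list_cons, Data.tail, esize, Data.size,
      Polynomial.eval_mul, Polynomial.eval_ofNat, Polynomial.eval_X, List.tail_cons, true_and]
    omega

/-- Overwriting the state with each element of the reversed list leaves the original head, or the
default value if there is none. -/
theorem PolyTime.headD {f : γ → List α} {d : γ → α} (hf : PolyTime f) (hd : PolyTime d) :
    PolyTime (fun c => (f c).headD (d c)) := by
  have : PolyTime (fun c => (f c).reverse.foldl (fun _ a => a) (d c)) :=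
    .foldl_of_growth (.comp .snd .snd) hf.reverse hd
      ⟨.X, fun c a st => by rw [esize_pair, Polynomial.eval_X]; omega⟩
  have h : ∀ (l : List α) (d : α), l.reverse.foldl (fun _ a => a) d = l.headD d := by
    intro l d
    cases l <;> simp
  simpa only [h] using this

/-! ### Unary arithmetic and tests -/

theorem unary_succ (n : ℕ) : Data.unary (n + 1) = .cons .nil (.unary n) := rfl

/-- Arithmetic reduces to list operations: a number and a list of that many units have the same
code. -/
theorem enc_list_unit (l : List Unit) : enc l = Data.unary l.length := by
  induction l with
  | nil => rfl
  | cons a l ih => rw [enc_list_cons, ih]; rfl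

theorem unary_injective : Function.Injective Data.unary := by
  intro m
  induction m with
  | zero => intro n h; cases n with
    | zero => rfl
    | succ n => rw [unary_succ] at h; cases h
  | succ m ih => intro n h; cases n with
    | zero => rw [unary_succ] at h; cases h
    | succ n => rw [unary_succ, unary_succ] at h; injection h with _ h; rw [ih h]

theorem esize_nat (n : ℕ) : esize n = 2 * n + 1 := by
  induction n with
  | zero => rfl
  | succ n ih =>
    change (Data.unary (n + 1)).size = _
    rw [unary_succ, Data.size, Data.size]
    change 1 + 1 + esize n = _
    omega

theorem PolyTime.succ {f : γ → ℕ} (hf : PolyTime f) : PolyTime (fun c => f c + 1) :=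
  (PolyTime.of_enc_eq (f := fun x : Unit × ℕ => x.2 + 1) fun _ => rfl).comp (.pair (.const ()) hf)

theorem PolyTime.replicate {f : γ → ℕ} (hf : PolyTime f) :
    PolyTime (fun c => List.replicate (f c) ()) :=
  (PolyTime.of_enc_eq (f := fun n : ℕ => List.replicate n ()) fun n => by
    rw [enc_list_unit, List.length_replicate, enc_nat]).comp hf

theorem PolyTime.length {f : γ → List α} (hf : PolyTime f) : PolyTime (fun c => (f c).length) := by
  have : PolyTime (fun c => (f c).foldl (fun n _ => n + 1) 0) :=
    .foldl_of_growth (.succ (.comp .fst .snd)) hf (.const 0)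
      ⟨2, fun c a st => by rw [esize_nat, esize_nat, Polynomial.eval_ofNat]; omega⟩
  simpa using this

theorem foldl_replicate_unit {τ : Type} (f : τ → τ) (n : ℕ) (x : τ) :
    (List.replicate n ()).foldl (fun x _ => f x) x = f^[n] x := by
  induction n generalizing x with
  | zero => rfl
  | succ n ih => rw [List.replicate_succ, List.foldl_cons, ih, Function.iterate_succ_apply]

theorem PolyTime.iterate {n : γ → ℕ} {init : γ → σ} {f : γ → σ → σ}
    (hf : PolyTime (fun x : γ × σ => f x.1 x.2)) (hn : PolyTime n) (hinit : PolyTime init)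
    (hgrow : ∃ r : Polynomial ℕ, ∀ c st, esize (f c st) ≤ esize st + r.eval (esize c)) :
    PolyTime (fun c => (f c)^[n c] (init c)) := by
  obtain ⟨r, hr⟩ := hgrow
  have : PolyTime (fun c => (List.replicate (n c) ()).foldl (fun x _ => f c x) (init c)) :=
    .foldl_of_growth (hf.comp (.pair .fst (.comp .fst .snd))) hn.replicate hinit
      ⟨r, fun c a st => (hr c st).trans (by
        have := eval_mono r (a := esize c) (b := esize (c, a)) (by rw [esize_pair]; omega)
        omega)⟩
  simpa only [foldl_replicate_unit] using this

theorem PolyTime.range {f : γ → ℕ} (hf : PolyTime f) : PolyTime (fun c => List.range (f c)) := by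
  obtain ⟨q, hq⟩ := hf.esize_le
  have : PolyTime (fun c => ((List.replicate (f c) ()).foldl (fun l _ => l.length :: l) []).reverse) := by
    -- Each pass adds a number as large as the current length of the state, so `foldl_of_growth`
    -- does not apply. Instead, the length is bounded by the number of passes.
    refine .reverse (.foldl (.cons (.length (.comp .fst .snd)) (.comp .fst .snd))
      hf.replicate (.const []) (1 + q * (2 + 2 * q)) fun c l' hl' => ?_)
    have key : ∀ (B : ℕ) (l' : List Unit) (st : List ℕ), st.length + l'.length ≤ B →
        esize (l'.foldl (fun l _ => l.length :: l) st) ≤ esize st + l'.length * (2 + 2 * B) := by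
      intro B l'
      induction l' with
      | nil => intro st _; simp
      | cons a l' ih =>
        intro st hB
        rw [List.length_cons] at hB
        have h1 := ih (st.length :: st) (by rw [List.length_cons]; omega)
        rw [esize_list_cons, esize_nat] at h1
        rw [List.foldl_cons, List.length_cons, add_mul, one_mul]
        omega
    have h2 : l'.length ≤ q.eval (esize c) := by
      refine hl'.length_le.trans ?_
      rw [List.length_replicate]
      have := hq c
      rw [esize_nat] at this
      omega
    have h1 := key (q.eval (esize c)) l' [] (by simpa using h2)
    have h3 := Nat.mul_le_mul_right (2 + 2 * q.eval (esize c)) h2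
    rw [esize_list_nil] at h1
    simp only [Polynomial.eval_add, Polynomial.eval_mul, Polynomial.eval_ofNat,
      Polynomial.eval_one]
    omega
  have h : ∀ n : ℕ, ((List.replicate n ()).foldl (fun l _ => l.length :: l) ([] : List ℕ))
      = (List.range n).reverse := by
    intro n
    induction n with
    | zero => rfl
    | succ n ih => rw [List.replicate_succ', List.foldl_append, ih, List.range_succ]; simp
  simpa [h] using this

theorem PolyTime.add {f g : γ → ℕ} (hf : PolyTime f) (hg : PolyTime g) :
    PolyTime (fun c => f c + g c) := by
  simpa using (hf.replicate.append hg.replicate).length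

theorem PolyTime.mul {f g : γ → ℕ} (hf : PolyTime f) (hg : PolyTime g) :
    PolyTime (fun c => f c * g c) := by
  simpa using (PolyTime.flatMap (f := fun c _ => List.replicate (g c) ()) (.replicate (hg.comp .fst))
    hf.replicate).length

theorem PolyTime.sub {f g : γ → ℕ} (hf : PolyTime f) (hg : PolyTime g) :
    PolyTime (fun c => f c - g c) := by
  have : PolyTime (fun c => (fun l : List Unit => l.tail)^[g c] (List.replicate (f c) ())) :=
    .iterate (f := fun _ l => l.tail) (.tail .snd) hg hf.replicate ⟨0, fun c st => by
      cases st with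
      | nil => simp
      | cons a l => simp [esize_list_cons]⟩
  have h : ∀ m n : ℕ, (fun l : List Unit => l.tail)^[n] (List.replicate m ())
      = List.replicate (m - n) () := by
    intro m n
    induction n generalizing m with
    | zero => rfl
    | succ n ih => rw [Function.iterate_succ_apply, List.tail_replicate, ih]; congr 1; omega
  simpa [h] using this.length

theorem PolyTime.decideEncEq {f g : γ → α} (hf : PolyTime f) (hg : PolyTime g) :
    PolyTime (fun c => decide (enc (f c) = enc (g c))) := by
  refine PolyTime.comp (g := fun x : α × α => decide (enc x.1 = enc x.2))
    (.of_expr (.eq (.head (.var 0)) (.tail (.var 0))) (10 * .X + 10) ?_) (hf.pair hg)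
  rintro ⟨a, b⟩ s hs
  simp only [Expr.eval, hs, enc_pair, Data.head, Data.tail, Expr.cost]
  refine ⟨rfl, ?_⟩
  have : (Data.ofBool (decide (enc a = enc b))).size ≤ 3 := by
    cases decide (enc a = enc b) <;> simp [Data.ofBool, Data.size]
  simp only [esize, enc_pair, Data.size, Polynomial.eval_add, Polynomial.eval_mul,
    Polynomial.eval_ofNat, Polynomial.eval_X]
  omega

theorem PolyTime.natEq {f g : γ → ℕ} (hf : PolyTime f) (hg : PolyTime g) :
    PolyTime (fun c => decide (f c = g c)) := by
  simpa only [enc_nat, unary_injective.eq_iff] using hf.decideEncEq hg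

theorem PolyTime.not {f : γ → Bool} (hf : PolyTime f) : PolyTime (fun c => !f c) := by
  have : PolyTime (fun c => if f c then false else true) := hf.cond (.const _) (.const _)
  refine cast (congrArg _ (funext fun c => ?_)) this
  cases f c <;> rfl

theorem PolyTime.and {f g : γ → Bool} (hf : PolyTime f) (hg : PolyTime g) :
    PolyTime (fun c => f c && g c) := by
  have : PolyTime (fun c => if f c then g c else false) := hf.cond hg (.const _)
  refine cast (congrArg _ (funext fun c => ?_)) this
  cases f c <;> rfl

theorem PolyTime.or {f g : γ → Bool} (hf : PolyTime f) (hg : PolyTime g) :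
    PolyTime (fun c => f c || g c) := by
  have : PolyTime (fun c => if f c then true else g c) := hf.cond (.const _) hg
  refine cast (congrArg _ (funext fun c => ?_)) this
  cases f c <;> rfl

theorem PolyTime.natLt {f g : γ → ℕ} (hf : PolyTime f) (hg : PolyTime g) :
    PolyTime (fun c => decide (f c < g c)) := by
  have : PolyTime (fun c => !decide (g c - f c = 0)) := (PolyTime.natEq (hg.sub hf) (.const 0)).not
  refine cast (congrArg _ (funext fun c => ?_)) this
  rw [← decide_not, decide_eq_decide]
  omega

theorem PolyTime.any {l : γ → List α} {f : γ → α → Bool}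
    (hf : PolyTime (fun x : γ × α => f x.1 x.2)) (hl : PolyTime l) :
    PolyTime (fun c => (l c).any (f c)) := by
  have : PolyTime (fun c => decide (0 < ((l c).filter (f c)).length)) :=
    (PolyTime.const 0).natLt (PolyTime.filter hf hl).length
  refine cast (congrArg _ (funext fun c => ?_)) this
  rw [Bool.eq_iff_iff]
  simp [List.length_pos_iff_exists_mem]

theorem PolyTime.getD {l : γ → List α} {n : γ → ℕ} {d : γ → α} (hl : PolyTime l) (hn : PolyTime n)
    (hd : PolyTime d) : PolyTime (fun c => (l c).getD (n c) (d c)) := by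
  have : PolyTime (fun c => (fun l : List α => l.tail)^[n c] (l c)) :=
    .iterate (f := fun _ l => l.tail) (.tail .snd) hn hl ⟨0, fun c st => by
      cases st with
      | nil => simp
      | cons a l => simp [esize_list_cons]⟩
  refine cast (congrArg _ (funext fun c => ?_)) (this.headD hd)
  have h : ∀ (n : ℕ) (l : List α), (fun l : List α => l.tail)^[n] l = l.drop n := by
    intro n
    induction n with
    | zero => simp
    | succ n ih => intro l; rw [Function.iterate_succ_apply, ih]; simp
  rw [h]
  simp [List.headD_eq_head?_getD, List.getD_eq_getElem?_getD]

end

/-! ### Recursion on trees -/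

section

variable {α β γ σ : Type} [Enc α] [Enc β] [Enc γ] [Enc σ]

/-- Iterating a polynomial-time step as long as a test succeeds, if the number of steps and the
states remain small. -/
theorem PolyTime.iterate_while {n : γ → ℕ} {init : γ → σ} {f : σ → σ} {b : σ → Bool}
    (hf : PolyTime f) (hb : PolyTime b) (hinit : PolyTime init) (q : Polynomial ℕ)
    (hn : ∀ c, n c ≤ q.eval (esize c)) (hlt : ∀ c m, m < n c → b (f^[m] (init c)) = true)
    (hend : ∀ c, b (f^[n c] (init c)) = false)
    (hbound : ∀ c m, m ≤ n c → esize (f^[m] (init c)) ≤ q.eval (esize c)) :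
    PolyTime (fun c => f^[n c] (init c)) := by
  -- Variable `0` holds the state together with the outcome of its test, so the loop condition is
  -- just the head of variable `0`. The body strips the flag, applies `f` and attaches the new flag.
  obtain ⟨c₀, N₀, p₀, hN₀, h₀⟩ := (hb.comp hinit).pair hinit
  obtain ⟨c₁, N₁, p₁, hN₁, h₁⟩ := (hb.comp hf).pair hf
  let body : Program := .seq (.assign 0 (.tail (.var 0))) c₁
  let R : Polynomial ℕ := p₁ + 4 * .X + 20
  have loop : ∀ (m k : ℕ) (x : σ) (s : Store), s 0 = enc (b x, x) →
      (∀ i, 0 < i → i < N₁ → s i = Data.nil) → (∀ j < k, b (f^[j] x) = true) →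
      b (f^[k] x) = false → (∀ j ≤ k, esize (f^[j] x) ≤ m) →
      ∃ t ≤ (k + 1) * R.eval m, Exec (.while (.head (.var 0)) body) s t
        (Function.update s 0 (enc (false, f^[k] x))) := by
    intro m k
    induction k with
    | zero =>
      intro x s hs hnil _ hend hm
      have hx : esize x ≤ m := hm 0 le_rfl
      have hbx : b x = false := hend
      rw [hbx] at hs
      refine (Exec.whileFalse (by rw [Expr.eval, Expr.eval, hs]; rfl)).exists_le (by
        rw [Function.iterate_zero, id_eq, ← hs, Function.update_eq_self]) ?_
      simp only [Expr.cost, Expr.eval, hs, enc_pair, Data.head, enc_bool, Data.ofBool, Data.size, R,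
        Polynomial.eval_add, Polynomial.eval_mul, Polynomial.eval_ofNat, Polynomial.eval_X]
      unfold esize at hx
      omega
    | succ k ih =>
      intro x s hs hnil hlt hend hm
      have hx : esize x ≤ m := hm 0 (by omega)
      have hbx : b x = true := hlt 0 (by omega)
      rw [hbx] at hs
      obtain ⟨t₁, ht₁, e₁⟩ : ∃ t ≤ 1 + (2 * m + 4), Exec (.assign 0 (.tail (.var 0))) s t
          (Function.update s 0 (enc x)) :=
        exec_assign_of_eq (by rw [Expr.eval, Expr.eval, hs]; rfl) (by
          simp only [Expr.cost, Expr.eval, hs, enc_pair, Data.tail, enc_bool, Data.ofBool,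
            Data.size]
          unfold esize at hx
          omega)
      obtain ⟨t₂, ht₂, e₂⟩ := h₁ x (Function.update s 0 (enc x)) (by simp) (fun i h0 hi => by
        rw [Function.update_of_ne (by omega)]; exact hnil i h0 hi)
      rw [Function.update_idem] at e₂
      obtain ⟨t₃, ht₃, e₃⟩ := ih (f x) (Function.update s 0 (enc (b (f x), f x))) (by simp)
        (fun i h0 hi => by rw [Function.update_of_ne (by omega)]; exact hnil i h0 hi)
        (fun j hj => hlt (j + 1) (by omega)) hend (fun j hj => hm (j + 1) (by omega))
      rw [Function.update_idem] at e₃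
      refine (Exec.whileTrue (by rw [Expr.eval, Expr.eval, hs]; simp [enc_pair, Data.head, enc_bool,
        Data.ofBool]) (e₁.seq e₂) e₃).exists_le rfl ?_
      have h3 := eval_mono p₁ hx
      have hcost : (Expr.head (.var 0)).cost s ≤ m + 7 := by
        simp only [Expr.cost, Expr.eval, hs, enc_pair, Data.head, enc_bool, Data.ofBool, Data.size]
        unfold esize at hx
        omega
      have hR : R.eval m = p₁.eval m + 4 * m + 20 := by simp [R]
      rw [add_mul _ 1, one_mul]
      omega
  refine ⟨.seq c₀ (.seq (.while (.head (.var 0)) body) (.assign 0 (.tail (.var 0)))), max N₀ N₁,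
    p₀ + (q + 1) * R.comp q + 2 * q + 10, by omega, fun c s hs hnil => ?_⟩
  obtain ⟨t₀, ht₀, e₀⟩ := h₀ c s hs (fun i h0 hi => hnil i h0 (by omega))
  obtain ⟨t₁, ht₁, e₁⟩ := loop (q.eval (esize c)) (n c) (init c)
    (Function.update s 0 (enc (b (init c), init c))) (by simp)
    (fun i h0 hi => by rw [Function.update_of_ne (by omega)]; exact hnil i h0 (by omega))
    (hlt c) (hend c) (hbound c)
  rw [Function.update_idem] at e₁
  have hfin := hbound c (n c) le_rfl
  obtain ⟨t₂, ht₂, e₂⟩ : ∃ t ≤ 1 + (2 * q.eval (esize c) + 2), Exec (.assign 0 (.tail (.var 0)))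
      (Function.update s 0 (enc (false, f^[n c] (init c)))) t
      (Function.update (Function.update s 0 (enc (false, f^[n c] (init c)))) 0
        (enc (f^[n c] (init c)))) :=
    exec_assign_of_eq (by rw [Expr.eval, Expr.eval, Function.update_self]; rfl) (by
      simp only [Expr.cost, Expr.eval, Function.update_self, enc_pair, Data.tail, enc_bool,
        Data.ofBool, Data.size]
      unfold esize at hfin ⊢
      omega)
  rw [Function.update_idem] at e₂
  refine (e₀.seq (e₁.seq e₂)).exists_le rfl ?_
  have h3 := Nat.mul_le_mul_right (R.eval (q.eval (esize c))) (Nat.add_le_add_right (hn c) 1)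
  simp only [Polynomial.eval_add, Polynomial.eval_mul, Polynomial.eval_comp, Polynomial.eval_one,
    Polynomial.eval_ofNat]
  omega

/-! ### Elementary operations on trees -/

theorem PolyTime.dcons {f g : γ → Data} (hf : PolyTime f) (hg : PolyTime g) :
    PolyTime (fun c => Data.cons (f c) (g c)) :=
  (PolyTime.of_enc_eq (f := fun x : Data × Data => Data.cons x.1 x.2) fun _ => rfl).comp
    (hf.pair hg)

theorem Data.size_head_le (d : Data) : d.head.size ≤ d.size := by
  cases d <;> simp only [Data.head, Data.size] <;> omega

theorem Data.size_tail_le (d : Data) : d.tail.size ≤ d.size := by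
  cases d <;> simp only [Data.tail, Data.size] <;> omega

theorem PolyTime.dhead {f : γ → Data} (hf : PolyTime f) : PolyTime (fun c => (f c).head) := by
  refine PolyTime.comp (g := Data.head) (.of_expr (.head (.var 0)) (2 * .X) fun d s hs => ?_) hf
  have := d.size_head_le
  simp only [Expr.eval, Expr.cost, hs, enc_data, esize, Polynomial.eval_mul, Polynomial.eval_ofNat,
    Polynomial.eval_X, true_and]
  omega

theorem PolyTime.dtail {f : γ → Data} (hf : PolyTime f) : PolyTime (fun c => (f c).tail) := by
  refine PolyTime.comp (g := Data.tail) (.of_expr (.tail (.var 0)) (2 * .X) fun d s hs => ?_) hf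
  have := d.size_tail_le
  simp only [Expr.eval, Expr.cost, hs, enc_data, esize, Polynomial.eval_mul, Polynomial.eval_ofNat,
    Polynomial.eval_X, true_and]
  omega

theorem PolyTime.dataEq {f g : γ → Data} (hf : PolyTime f) (hg : PolyTime g) :
    PolyTime (fun c => decide (f c = g c)) :=
  hf.decideEncEq hg

/-- Allows a function to be computed on codes when its values belong to a type without programmed
operations, such as formulas. -/
theorem PolyTime.of_eq_enc {f : α → β} {g : α → Data} (hg : PolyTime g)
    (h : ∀ a, g a = enc (f a)) : PolyTime f := by
  obtain ⟨c, N, p, hN, hc⟩ := hg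
  refine ⟨c, N, p, hN, fun a s hs hnil => ?_⟩
  rw [← h a]
  exact hc a s hs hnil

/-! ### The stack machine -/

/-- The number of steps of the stack machine for recursion on trees. -/
def Data.stackSteps : Data → ℕ
  | .nil => 1
  | .cons a b => 2 + a.stackSteps + b.stackSteps

theorem Data.stackSteps_le (d : Data) : d.stackSteps ≤ 2 * d.size := by
  induction d with
  | nil => simp [stackSteps, size]
  | cons a b iha ihb => simp only [stackSteps, size]; omega

/-- The stack machine for recursion on trees: `(true, d)` asks for the value at `d`, and
`(false, d)` for combining the values at the two subtrees of `d`. -/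
def stackStep (z : β) (g : Data → β → β → β) (x : List (Bool × Data) × List β) :
    List (Bool × Data) × List β :=
  if (x.1.headD (true, .nil)).1 then
    if decide ((x.1.headD (true, .nil)).2 = .nil) then (x.1.tail, z :: x.2)
    else ((true, (x.1.headD (true, .nil)).2.head) :: (true, (x.1.headD (true, .nil)).2.tail) ::
      (false, (x.1.headD (true, .nil)).2) :: x.1.tail, x.2)
  else (x.1.tail,
    g (x.1.headD (true, .nil)).2 (x.2.tail.headD z) (x.2.headD z) :: x.2.tail.tail)

theorem polyTime_stackStep (z : β) {g : Data → β → β → β}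
    (hg : PolyTime (fun x : Data × β × β => g x.1 x.2.1 x.2.2)) : PolyTime (stackStep z g) := by
  have hh : PolyTime (fun x : List (Bool × Data) × List β => x.1.headD (true, .nil)) :=
    .headD .fst (.const _)
  have hh2 := PolyTime.snd.comp hh
  have ht : PolyTime (fun x : List (Bool × Data) × List β => x.1.tail) := .tail .fst
  exact .cond (.comp .fst hh) (.cond (.dataEq hh2 (.const _)) (.pair ht (.cons (.const _) .snd))
    (.pair (.cons (.pair (.const _) hh2.dhead) (.cons (.pair (.const _) hh2.dtail)
      (.cons (.pair (.const _) hh2) ht))) .snd))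
    (.pair ht (.cons (hg.comp (.pair hh2 (.pair (.headD (.tail .snd) (.const _))
      (.headD .snd (.const _))))) (.tail (.tail .snd))))

section

variable {z : β} {g : Data → β → β → β} {F : Data → β}

/-- A request is served without touching what lies below it on the stack. The value at the right
subtree ends up on top of the value at the left one, which is the order expected by the combining
step. -/
theorem stackStep_iterate {τ : Type} {z : τ} {g : Data → τ → τ → τ}
    {F : Data → τ} (hz : F .nil = z)
    (hF : ∀ a b, F (.cons a b) = g (.cons a b) (F a) (F b))
    (d : Data) (w : List (Bool × Data)) (v : List τ) :
    (stackStep z g)^[d.stackSteps] ((true, d) :: w, v) = (w, F d :: v) := by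
  induction d generalizing w v with
  | nil => simp [Data.stackSteps, stackStep, hz]
  | cons a b iha ihb =>
    have : (Data.cons a b).stackSteps = 1 + (b.stackSteps + (a.stackSteps + 1)) := by
      rw [Data.stackSteps]; omega
    rw [this, Function.iterate_add_apply, Function.iterate_add_apply, Function.iterate_succ_apply,
      Function.iterate_zero, id_eq, Function.iterate_succ_apply]
    have h1 : stackStep z g ((true, Data.cons a b) :: w, v)
        = ((true, a) :: (true, b) :: (false, Data.cons a b) :: w, v) := by
      simp [stackStep, Data.head, Data.tail]
    rw [h1, iha, ihb]
    simp [stackStep, hF]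

/-- Until a request has been served, something remains above the old stack. Hence the test for an
empty stack stops the machine at the right moment. -/
theorem length_stackStep_iterate {τ : Type} {z : τ} {g : Data → τ → τ → τ}
    {F : Data → τ} (hz : F .nil = z)
    (hF : ∀ a b, F (.cons a b) = g (.cons a b) (F a) (F b))
    (d : Data) (w : List (Bool × Data)) (v : List τ) (m : ℕ) (hm : m < d.stackSteps) :
    w.length < ((stackStep z g)^[m] ((true, d) :: w, v)).1.length := by
  induction d generalizing w v m with
  | nil =>
    have : m = 0 := by rw [Data.stackSteps] at hm; omega
    subst this
    simp
  | cons a b iha ihb =>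
    rw [Data.stackSteps] at hm
    have h1 : stackStep z g ((true, Data.cons a b) :: w, v)
        = ((true, a) :: (true, b) :: (false, Data.cons a b) :: w, v) := by
      simp [stackStep, Data.head, Data.tail]
    rcases m with _ | m
    · simp
    rw [Function.iterate_succ_apply, h1]
    rcases lt_or_ge m a.stackSteps with hma | hma
    · have := iha ((true, b) :: (false, Data.cons a b) :: w) v m hma
      simp only [List.length_cons] at this
      omega
    obtain ⟨m, rfl⟩ := Nat.exists_eq_add_of_le' hma
    rw [Function.iterate_add_apply, stackStep_iterate hz hF]
    rcases lt_or_ge m b.stackSteps with hmb | hmb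
    · have := ihb ((false, Data.cons a b) :: w) (F a :: v) m hmb
      simp only [List.length_cons] at this
      omega
    obtain ⟨m, rfl⟩ := Nat.exists_eq_add_of_le' hmb
    have : m = 0 := by omega
    subst this
    rw [Function.iterate_add_apply, stackStep_iterate hz hF]
    simp

/-- Each node of the tree is charged for the few stack entries and values that it can contribute, of
size at most `S` and `Q`; the factor per node is generous. -/
theorem esize_stackStep_iterate (hz : F .nil = z)
    (hF : ∀ a b, F (.cons a b) = g (.cons a b) (F a) (F b))
    {S Q : ℕ} (hQ : ∀ d : Data, d.size ≤ S → esize (F d) ≤ Q)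
    (d : Data) (hd : d.size ≤ S) (w : List (Bool × Data)) (v : List β) (m : ℕ)
    (hm : m ≤ d.stackSteps) : esize ((stackStep z g)^[m] ((true, d) :: w, v)) ≤
      esize w + esize v + d.size * (5 * S + 3 * Q + 30) := by
  induction d generalizing w v m with
  | nil =>
    have h0 := hQ .nil (by have := (Data.nil).size_pos; simp only [Data.size] at *; omega)
    rw [hz] at h0
    simp only [Data.stackSteps, Data.size] at *
    rcases m with _ | _ | m
    · simp only [Function.iterate_zero, id, esize_pair, esize_list_cons, one_mul]
      have : esize true = 3 := rfl
      have : esize Data.nil = 1 := rfl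
      omega
    · have h1 : (stackStep z g)^[0 + 1] ((true, Data.nil) :: w, v) = (w, z :: v) := by
        simp [stackStep]
      rw [h1, esize_pair, esize_list_cons, one_mul]
      omega
    · omega
  | cons a b iha ihb =>
    have hd' := hd
    simp only [Data.size] at hd
    have ea : esize a = a.size := rfl
    have eb : esize b = b.size := rfl
    have eab : esize (Data.cons a b) = 1 + a.size + b.size := rfl
    have et : esize true = 3 := rfl
    have ef : esize false = 1 := rfl
    have h1 : stackStep z g ((true, Data.cons a b) :: w, v)
        = ((true, a) :: (true, b) :: (false, Data.cons a b) :: w, v) := by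
      simp [stackStep, Data.head, Data.tail]
    have hsz : (Data.cons a b).size * (5 * S + 3 * Q + 30) = (5 * S + 3 * Q + 30) +
        a.size * (5 * S + 3 * Q + 30) + b.size * (5 * S + 3 * Q + 30) := by
      rw [Data.size]; ring
    rw [hsz]
    rw [Data.stackSteps] at hm
    rcases m with _ | m
    · simp only [Function.iterate_zero, id, esize_pair, esize_list_cons, eab, et]
      omega
    rw [Function.iterate_succ_apply, h1]
    rcases le_total m a.stackSteps with hma | hma
    · have := iha (by omega) ((true, b) :: (false, Data.cons a b) :: w) v m hma
      refine this.trans ?_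
      simp only [esize_pair, esize_list_cons, eb, eab, et, ef]
      omega
    obtain ⟨m, rfl⟩ := Nat.exists_eq_add_of_le' hma
    rw [Function.iterate_add_apply, stackStep_iterate hz hF]
    have hFa := hQ a (by omega)
    have hFb := hQ b (by omega)
    rcases le_total m b.stackSteps with hmb | hmb
    · have := ihb (by omega) ((false, Data.cons a b) :: w) (F a :: v) m hmb
      refine this.trans ?_
      simp only [esize_pair, esize_list_cons, eab, ef]
      omega
    obtain ⟨m, rfl⟩ := Nat.exists_eq_add_of_le' hmb
    rw [Function.iterate_add_apply, stackStep_iterate hz hF]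
    rcases m with _ | _ | m
    · simp only [Function.iterate_zero, id, esize_pair, esize_list_cons, eab, ef]
      omega
    · have h2 : (stackStep z g)^[0 + 1] ((false, Data.cons a b) :: w, F b :: F a :: v)
          = (w, F (.cons a b) :: v) := by
        simp [stackStep, hF]
      have := hQ _ hd'
      rw [h2, esize_pair, esize_list_cons]
      omega
    · omega

/-- Recursion on trees with small values is polynomial. -/
theorem PolyTime.treeRec (hz : F .nil = z)
    (hF : ∀ a b, F (.cons a b) = g (.cons a b) (F a) (F b))
    (hg : PolyTime (fun x : Data × β × β => g x.1 x.2.1 x.2.2))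
    (q : Polynomial ℕ) (hq : ∀ d, esize (F d) ≤ q.eval d.size) : PolyTime F := by
  -- The number of steps need not be computed, since the machine runs until its stack is empty.
  have h : PolyTime (fun d : Data => (stackStep z g)^[d.stackSteps] ([(true, d)], [])) := by
    refine .iterate_while (b := fun x => decide (0 < x.1.length)) (polyTime_stackStep z hg)
      (.natLt (.const 0) (.length .fst)) (.pair (.cons (.pair (.const _) .id) (.const _))
      (.const _)) (2 * .X + 2 + .X * (5 * .X + 3 * q + 30)) ?_ ?_ ?_ ?_
    · intro d
      have := d.stackSteps_le
      simp only [Polynomial.eval_add, Polynomial.eval_mul, Polynomial.eval_ofNat, Polynomial.eval_X]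
      change d.stackSteps ≤ 2 * d.size + _ + _
      omega
    · intro d m hm
      have := length_stackStep_iterate hz hF d [] [] m hm
      simpa using this
    · intro d
      rw [stackStep_iterate hz hF]
      rfl
    · intro d m hm
      refine (esize_stackStep_iterate hz hF (S := d.size) (Q := q.eval d.size)
        (fun d' hd' => (hq d').trans (eval_mono q hd')) d le_rfl [] [] m hm).trans ?_
      simp only [Polynomial.eval_add, Polynomial.eval_mul, Polynomial.eval_ofNat, Polynomial.eval_X]
      change 1 + 1 + _ ≤ 2 * d.size + 2 + d.size * (5 * d.size + 3 * q.eval d.size + 30)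
      omega
  refine cast (congrArg _ (funext fun d => ?_)) (PolyTime.headD (.comp .snd h) (.const z))
  rw [stackStep_iterate hz hF]
  rfl

end

end

/-! ### The translation of sentences -/

namespace MSOFormula

/-- The formula `D` with free variable `0`, at the variable `x`. -/
def guard (D : MSOFormula OrderSymbol) (x : ℕ) : MSOFormula OrderSymbol :=
  existsElem 0 (and (eq 0 x) D)

/-- The formula `A` with free variables `0` and `2`, at the variables `x` and `y`. -/
def guard₂ (A : MSOFormula OrderSymbol) (x y : ℕ) : MSOFormula OrderSymbol :=
  existsElem 0 (existsElem 2 (and (eq 0 x) (and (eq 2 y) A)))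

/-- The interpretation of graphs in permutations in which `D` defines the vertices and `A` defines
adjacency. The variables are renamed to odd numbers. -/
def translate (D A : MSOFormula OrderSymbol) : MSOFormula GraphSymbol → MSOFormula OrderSymbol
  | eq x y => eq (2 * x + 1) (2 * y + 1)
  | rel _ x y => guard₂ A (2 * x + 1) (2 * y + 1)
  | mem x X => mem (2 * x + 1) (2 * X + 1)
  | not φ => not (translate D A φ)
  | and φ χ => and (translate D A φ) (translate D A χ)
  | or φ χ => or (translate D A φ) (translate D A χ)
  | imp φ χ => imp (translate D A φ) (translate D A χ)
  | iff φ χ => iff (translate D A φ) (translate D A χ)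
  | existsElem x φ => existsElem (2 * x + 1) (and (guard D (2 * x + 1)) (translate D A φ))
  | forallElem x φ => forallElem (2 * x + 1) (imp (guard D (2 * x + 1)) (translate D A φ))
  | existsSet X φ => existsSet (2 * X + 1) (translate D A φ)
  | forallSet X φ => forallSet (2 * X + 1) (translate D A φ)

theorem length_translate_le (D A : MSOFormula OrderSymbol) (φ : MSOFormula GraphSymbol) :
    (translate D A φ).length ≤ (D.length + A.length + 12) * φ.length := by
  induction φ with
  | eq | rel | mem => simp only [translate, guard₂, length]; omega
  | not φ ih | existsSet X φ ih | forallSet X φ ih =>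
    simp only [translate, length, mul_add]; omega
  | existsElem x φ ih | forallElem x φ ih =>
    simp only [translate, guard, length, mul_add]; omega
  | and φ χ ih₁ ih₂ | or φ χ ih₁ ih₂ | imp φ χ ih₁ ih₂ | iff φ χ ih₁ ih₂ =>
    simp only [translate, length, mul_add]; omega

/-- The free variables `0` and `2` of `D` and `A` are bound by `guard` and `guard₂`. Names coming
from the graph sentence are odd, so they never clash with these. -/
theorem freeElem_translate_subset {D A : MSOFormula OrderSymbol} (hD : D.freeElem ⊆ {0})
    (hA : A.freeElem ⊆ {0, 2}) (φ : MSOFormula GraphSymbol) :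
    (translate D A φ).freeElem ⊆ (fun x => 2 * x + 1) '' φ.freeElem := by
  have hg : ∀ x, (guard D x).freeElem ⊆ {x} := by
    intro x y
    simp only [guard, freeElem, Set.mem_sdiff, Set.mem_union, Set.mem_insert_iff,
      Set.mem_singleton_iff]
    rintro ⟨(h | h) | h, h0⟩
    · exact absurd h h0
    · exact h
    · exact absurd (hD h) h0
  induction φ with
  | eq x y | mem x y =>
    intro z
    simp [translate, freeElem]
    try rintro (rfl | rfl) <;> simp
  | rel r x y =>
    intro z
    simp only [translate, guard₂, freeElem, Set.mem_sdiff, Set.mem_union, Set.mem_insert_iff,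
      Set.mem_singleton_iff, Set.image_insert_eq, Set.image_singleton]
    rintro ⟨⟨(h | h) | (h | h) | h, h2⟩, h0⟩
    · exact absurd h h0
    · exact .inl h
    · exact absurd h h2
    · exact .inr h
    · rcases hA h with h | h
      · exact absurd h h0
      · exact absurd h h2
  | not φ ih | existsSet X φ ih | forallSet X φ ih => exact ih
  | existsElem x φ ih | forallElem x φ ih =>
    rintro y ⟨h | h, hy⟩
    · exact absurd (hg _ h) hy
    · obtain ⟨z, hz, rfl⟩ := ih h
      exact ⟨z, ⟨hz, fun hzx => hy (by rw [hzx]; rfl)⟩, rfl⟩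
  | and φ χ ih₁ ih₂ | or φ χ ih₁ ih₂ | imp φ χ ih₁ ih₂ | iff φ χ ih₁ ih₂ =>
    rw [freeElem, Set.image_union]
    exact Set.union_subset_union ih₁ ih₂

theorem freeSet_translate_subset {D A : MSOFormula OrderSymbol} (hD : D.freeSet = ∅)
    (hA : A.freeSet = ∅) (φ : MSOFormula GraphSymbol) :
    (translate D A φ).freeSet ⊆ (fun x => 2 * x + 1) '' φ.freeSet := by
  induction φ with
  | eq x y | mem x X | rel r x y => simp [translate, freeSet, guard₂, hA]
  | not φ ih => exact ih
  | existsElem x φ ih | forallElem x φ ih =>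
    simpa only [translate, guard, freeSet, hD, Set.empty_union] using ih
  | existsSet x φ ih | forallSet x φ ih =>
    rintro y ⟨h, hy⟩
    obtain ⟨z, hz, rfl⟩ := ih h
    exact ⟨z, ⟨hz, fun hzx => hy (by rw [hzx]; rfl)⟩, rfl⟩
  | and φ χ ih₁ ih₂ | or φ χ ih₁ ih₂ | imp φ χ ih₁ ih₂ | iff φ χ ih₁ ih₂ =>
    rw [freeSet, Set.image_union]
    exact Set.union_subset_union ih₁ ih₂

/-- The translation is correct if `D` defines a copy of the vertex set and `A` defines adjacency
on it. -/
theorem sat_translate {B V : Type} {I : OrderSymbol → B → B → Prop} {J : GraphSymbol → V → V → Prop}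
    {D A : MSOFormula OrderSymbol} (ι : V → B) (hι : Function.Injective ι)
    (hD : ∀ v W a, v 0 = some a → (D.Sat I v W ↔ ∃ u, ι u = a))
    (hA : ∀ v W u w, v 0 = some (ι u) → v 2 = some (ι w) → (A.Sat I v W ↔ J .edge u w))
    (φ : MSOFormula GraphSymbol) :
    ∀ (v : ℕ → Option V) (W : ℕ → Set V) (v' : ℕ → Option B) (W' : ℕ → Set B),
      (∀ x, v' (2 * x + 1) = (v x).map ι) → (∀ X u, ι u ∈ W' (2 * X + 1) ↔ u ∈ W X) →
      ((translate D A φ).Sat I v' W' ↔ φ.Sat J v W) := by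
  have hg : ∀ (v' : ℕ → Option B) W' x, (guard D (2 * x + 1)).Sat I v' W' ↔
      ∃ u, v' (2 * x + 1) = some (ι u) := by
    intro v' W' x
    simp only [guard, Sat]
    constructor
    · rintro ⟨a, ⟨b, h1, h2⟩, h3⟩
      rw [Function.update_self] at h1
      rw [Function.update_of_ne (by omega)] at h2
      cases h1
      obtain ⟨u, rfl⟩ := (hD _ _ a (by simp)).1 h3
      exact ⟨u, h2⟩
    · rintro ⟨u, hu⟩
      refine ⟨ι u, ⟨ι u, by simp, ?_⟩, (hD _ _ (ι u) (by simp)).2 ⟨u, rfl⟩⟩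
      rwa [Function.update_of_ne (by omega)]
  have hupd : ∀ (v : ℕ → Option V) (v' : ℕ → Option B) (x : ℕ) (u : V),
      (∀ x, v' (2 * x + 1) = (v x).map ι) → ∀ y,
      Function.update v' (2 * x + 1) (some (ι u)) (2 * y + 1)
        = (Function.update v x (some u) y).map ι := by
    intro v v' x u h y
    by_cases hy : y = x
    · subst hy; simp
    · rw [Function.update_of_ne (by omega), Function.update_of_ne hy, h]
  induction φ with
  | eq x y =>
    intro v W v' W' hv hW
    simp only [translate, Sat, hv, Option.map_eq_some_iff]
    constructor
    · rintro ⟨a, ⟨u, hu, rfl⟩, w, hw, h⟩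
      exact ⟨u, hu, by rw [hw, hι h]⟩
    · rintro ⟨u, hu, hw⟩
      exact ⟨ι u, ⟨u, hu, rfl⟩, u, hw, rfl⟩
  | rel r x y =>
    intro v W v' W' hv hW
    cases r
    simp only [translate, guard₂, Sat]
    constructor
    · rintro ⟨a, b, ⟨a', h1, h2⟩, ⟨b', h3, h4⟩, h5⟩
      rw [Function.update_of_ne (by omega), Function.update_self] at h1
      rw [Function.update_of_ne (by omega), Function.update_of_ne (by omega), hv,
        Option.map_eq_some_iff] at h2
      rw [Function.update_self] at h3
      rw [Function.update_of_ne (by omega), Function.update_of_ne (by omega), hv,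
        Option.map_eq_some_iff] at h4
      cases h1; cases h3
      obtain ⟨u, hu, rfl⟩ := h2
      obtain ⟨w, hw, rfl⟩ := h4
      exact ⟨u, w, hu, hw, (hA _ _ u w (by
        rw [Function.update_of_ne (by omega), Function.update_self]) (by simp)).1 h5⟩
    · rintro ⟨u, w, hu, hw, h⟩
      refine ⟨ι u, ι w, ⟨ι u, ?_, ?_⟩, ⟨ι w, by simp, ?_⟩, (hA _ _ u w (by
        rw [Function.update_of_ne (by omega), Function.update_self]) (by simp)).2 h⟩
      · rw [Function.update_of_ne (by omega), Function.update_self]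
      · rw [Function.update_of_ne (by omega), Function.update_of_ne (by omega), hv, hu]; rfl
      · rw [Function.update_of_ne (by omega), Function.update_of_ne (by omega), hv, hw]; rfl
  | mem x X =>
    intro v W v' W' hv hW
    simp only [translate, Sat, hv, Option.map_eq_some_iff]
    constructor
    · rintro ⟨a, ⟨u, hu, rfl⟩, h⟩
      exact ⟨u, hu, (hW _ _).1 h⟩
    · rintro ⟨u, hu, h⟩
      exact ⟨ι u, ⟨u, hu, rfl⟩, (hW _ _).2 h⟩
  | not φ ih =>
    intro v W v' W' hv hW
    simp only [translate, Sat, ih v W v' W' hv hW]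
  | and φ χ ih₁ ih₂ | or φ χ ih₁ ih₂ | imp φ χ ih₁ ih₂ | iff φ χ ih₁ ih₂ =>
    intro v W v' W' hv hW
    simp only [translate, Sat, ih₁ v W v' W' hv hW, ih₂ v W v' W' hv hW]
  | existsElem x φ ih =>
    intro v W v' W' hv hW
    simp only [translate, Sat, hg, Function.update_self]
    constructor
    · rintro ⟨a, ⟨u, hu⟩, h⟩
      cases hu
      exact ⟨u, (ih _ W _ W' (hupd v v' x u hv) hW).1 h⟩
    · rintro ⟨u, h⟩
      exact ⟨ι u, ⟨u, rfl⟩, (ih _ W _ W' (hupd v v' x u hv) hW).2 h⟩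
  | forallElem x φ ih =>
    intro v W v' W' hv hW
    simp only [translate, Sat, hg, Function.update_self]
    constructor
    · intro h u
      exact (ih _ W _ W' (hupd v v' x u hv) hW).1 (h (ι u) ⟨u, rfl⟩)
    · rintro h a ⟨u, hu⟩
      cases hu
      exact (ih _ W _ W' (hupd v v' x u hv) hW).2 (h u)
  | existsSet X φ ih =>
    intro v W v' W' hv hW
    simp only [translate, Sat]
    constructor
    · rintro ⟨S, h⟩
      -- Set quantifiers are not relativised: only the trace of a set on the vertex points matters,
      -- so sets are transported by preimage and image under `ι`.
      refine ⟨ι ⁻¹' S, (ih v _ v' _ hv fun Y u => ?_).1 h⟩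
      by_cases hY : Y = X
      · subst hY; simp
      · rw [Function.update_of_ne (by omega), Function.update_of_ne hY, hW]
    · rintro ⟨S, h⟩
      refine ⟨ι '' S, (ih v _ v' _ hv fun Y u => ?_).2 h⟩
      by_cases hY : Y = X
      · subst hY; simp [hι.mem_set_image]
      · rw [Function.update_of_ne (by omega), Function.update_of_ne hY, hW]
  | forallSet X φ ih =>
    intro v W v' W' hv hW
    simp only [translate, Sat]
    constructor
    · intro h S
      refine (ih v _ v' _ hv fun Y u => ?_).1 (h (ι '' S))
      by_cases hY : Y = X
      · subst hY; simp [hι.mem_set_image]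
      · rw [Function.update_of_ne (by omega), Function.update_of_ne hY, hW]
    · intro h S
      refine (ih v _ v' _ hv fun Y u => ?_).2 (h (ι ⁻¹' S))
      by_cases hY : Y = X
      · subst hY; simp
      · rw [Function.update_of_ne (by omega), Function.update_of_ne hY, hW]

end MSOFormula

/-! ### The translation takes polynomial time -/

instance : Enc (MSOFormula GraphSymbol) := ⟨fun φ => φ.encode GraphSymbol.encode⟩
instance : Enc (MSOFormula OrderSymbol) := ⟨fun φ => φ.encode OrderSymbol.encode⟩

/-- The name `2 * x + 1`, from the name `x`. -/
def renameData (x : Data) : Data := .cons (.cons .nil .nil) x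

/-- Bits are listed from the least significant one, so passing to `2 * x + 1` puts a bit 1 in front.
-/
theorem binary_two_mul_add_one (x : ℕ) : Data.binary (2 * x + 1) = renameData (.binary x) := by
  rw [Data.binary, Nat.bit1_bits]; rfl

/-- The code of `MSOFormula.guard`. -/
def guardData (d x : Data) : Data :=
  .cons (.unary 8) (.cons (.binary 0) (.cons (.unary 4)
    (.cons (.cons (.unary 0) (.cons (.binary 0) x)) d)))

/-- The code of `MSOFormula.guard₂`. -/
def guard₂Data (a x y : Data) : Data :=
  .cons (.unary 8) (.cons (.binary 0) (.cons (.unary 8) (.cons (.binary 2) (.cons (.unary 4)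
    (.cons (.cons (.unary 0) (.cons (.binary 0) x)) (.cons (.unary 4)
      (.cons (.cons (.unary 0) (.cons (.binary 2) y)) a)))))))

/-- The code of the translation of a formula with the given tag and the given arguments, from the
codes `x`, `y` and `z` of the translations of the argument, of its head and of its tail. -/
def translateStep (d a tag arg x y z : Data) : Data :=
  if decide (tag = .unary 0) then .cons tag (.cons (renameData arg.head) (renameData arg.tail))
  else if decide (tag = .unary 1) then
    guard₂Data a (renameData arg.tail.head) (renameData arg.tail.tail)
  else if decide (tag = .unary 2) then .cons tag (.cons (renameData arg.head) (renameData arg.tail))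
  else if decide (tag = .unary 3) then .cons tag x
  else if decide (tag = .unary 4) then .cons tag (.cons y z)
  else if decide (tag = .unary 5) then .cons tag (.cons y z)
  else if decide (tag = .unary 6) then .cons tag (.cons y z)
  else if decide (tag = .unary 7) then .cons tag (.cons y z)
  else if decide (tag = .unary 8) then .cons tag (.cons (renameData arg.head)
    (.cons (.unary 4) (.cons (guardData d (renameData arg.head)) z)))
  else if decide (tag = .unary 9) then .cons tag (.cons (renameData arg.head)
    (.cons (.unary 6) (.cons (guardData d (renameData arg.head)) z)))
  else .cons tag (.cons (renameData arg.head) z)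

/-- The codes of the translations of a formula and, if it consists of two parts, of its parts. -/
def translateData (d a : Data) : Data → Data × Data × Data
  | .nil => (.nil, .nil, .nil)
  | .cons tag arg => (translateStep d a tag arg (translateData d a arg).1
      (translateData d a arg).2.1 (translateData d a arg).2.2,
      (translateData d a tag).1, (translateData d a arg).1)

/-- In the code of a binary connective or a quantifier the subformulas sit two levels below the
root. This is why the recursion also hands on the translations of the two parts of its argument,
whereas a negation uses the translation of the argument itself. -/
theorem enc_translate (D A : MSOFormula OrderSymbol) (φ : MSOFormula GraphSymbol) :
    (translateData (enc D) (enc A) (enc φ)).1 = enc (MSOFormula.translate D A φ) := by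
  have hd : ∀ m n : ℕ, decide (Data.unary m = Data.unary n) = decide (m = n) := fun m n => by
    simp only [unary_injective.eq_iff]
  have e₁ : ∀ φ : MSOFormula GraphSymbol, enc φ = φ.encode GraphSymbol.encode := fun _ => rfl
  have e₂ : ∀ φ : MSOFormula OrderSymbol, enc φ = φ.encode OrderSymbol.encode := fun _ => rfl
  rw [e₁]
  induction φ with
  | eq x y | mem x y | rel r x y =>
    simp only [MSOFormula.translate, MSOFormula.guard₂, e₂, MSOFormula.encode,
      binary_two_mul_add_one, translateData, translateStep, hd, Data.head, Data.tail, guard₂Data]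
    simp
  | not φ ih =>
    simp only [MSOFormula.translate, e₂, MSOFormula.encode, translateData, translateStep, hd]
    simp only [e₂] at ih
    simp [ih]
  | existsSet x φ ih | forallSet x φ ih =>
    simp only [MSOFormula.translate, e₂, MSOFormula.encode, translateData, translateStep, hd,
      binary_two_mul_add_one, Data.head]
    simp only [e₂] at ih
    simp [ih]
  | existsElem x φ ih | forallElem x φ ih =>
    simp only [MSOFormula.translate, e₂, MSOFormula.encode, translateData, translateStep, hd,
      binary_two_mul_add_one, Data.head, MSOFormula.guard, guardData]
    simp only [e₂] at ih
    simp [ih]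
  | and φ χ ih₁ ih₂ | or φ χ ih₁ ih₂ | imp φ χ ih₁ ih₂ | iff φ χ ih₁ ih₂ =>
    simp only [MSOFormula.translate, e₂, MSOFormula.encode, translateData, translateStep, hd]
    simp only [e₂] at ih₁ ih₂
    simp [ih₁, ih₂]

/-- Each case uses either the translation of the whole argument or those of its parts, and each at
most once. Hence a maximum rather than a sum, which keeps the recursion polynomial. -/
theorem size_translateStep_le (d a tag arg x y z : Data) :
    (translateStep d a tag arg x y z).size ≤
      tag.size + 2 * arg.size + d.size + a.size + 100 + max x.size (y.size + z.size) := by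
  have h1 := arg.size_head_le
  have h2 := arg.size_tail_le
  have h3 : arg.head.size + arg.tail.size ≤ arg.size + 1 := by
    cases arg <;> simp only [Data.head, Data.tail, Data.size] <;> omega
  have h4 : arg.tail.head.size + arg.tail.tail.size ≤ arg.tail.size + 1 := by
    cases arg.tail <;> simp only [Data.head, Data.tail, Data.size] <;> omega
  have b0 : (Data.binary 0).size = 1 := by decide +kernel
  have b2 : (Data.binary 2).size = 7 := by decide +kernel
  have u : ∀ n, (Data.unary n).size = 2 * n + 1 := esize_nat
  unfold translateStep guard₂Data guardData renameData
  split_ifs <;> simp only [Data.size, u, b0, b2] <;> omega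

/-- The recursion visits all subtrees, including those that are not codes of formulas, so the bound
must hold for arbitrary trees. A quadratic bound works: the cross terms of the square absorb the
linear cost of each node. -/
theorem size_translateData_le (d a t : Data) :
    (translateData d a t).1.size ≤ (d.size + a.size + 110) * t.size ^ 2 ∧
      (translateData d a t).2.1.size + (translateData d a t).2.2.size ≤
        (d.size + a.size + 110) * t.size ^ 2 := by
  obtain ⟨K, hK⟩ : ∃ K, K = d.size + a.size + 110 := ⟨_, rfl⟩
  rw [← hK]
  induction t with
  | nil => simp only [translateData, Data.size]; omega
  | cons tag arg ih₁ ih₂ =>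
    obtain ⟨h1, h2⟩ := ih₂
    have h3 := size_translateStep_le d a tag arg (translateData d a arg).1
      (translateData d a arg).2.1 (translateData d a arg).2.2
    simp only [translateData, Data.size]
    have h4 : max (translateData d a arg).1.size
        ((translateData d a arg).2.1.size + (translateData d a arg).2.2.size) ≤
        K * arg.size ^ 2 := max_le h1 h2
    have h5 : K * (1 + tag.size + arg.size) ^ 2 = K * tag.size ^ 2 + K * arg.size ^ 2 + K +
      K * (2 * tag.size + 2 * arg.size + 2 * tag.size * arg.size) := by ring
    have h6 : 2 * tag.size + 2 * arg.size + 2 * tag.size * arg.size ≤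
      K * (2 * tag.size + 2 * arg.size + 2 * tag.size * arg.size) :=
        Nat.le_mul_of_pos_left _ (by omega)
    constructor
    · linarith [Nat.zero_le (K * tag.size ^ 2), Nat.zero_le (2 * tag.size * arg.size)]
    · linarith [ih₁.1, Nat.zero_le (K * (2 * tag.size + 2 * arg.size + 2 * tag.size * arg.size))]

theorem PolyTime.translate (D A : MSOFormula OrderSymbol) :
    PolyTime (MSOFormula.translate D A) := by
  have h : PolyTime (translateData (enc D) (enc A)) := by
    refine .treeRec (z := (.nil, .nil, .nil)) (g := fun t u v =>
      (translateStep (enc D) (enc A) t.head t.tail v.1 v.2.1 v.2.2, u.1, v.1)) rfl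
      (fun a b => rfl) (.pair ?_ (.pair (.comp .fst (.comp .fst .snd))
        (.comp .fst (.comp .snd .snd))))
      (2 + 3 * .C ((enc D).size + (enc A).size + 110) * .X ^ 2) fun t => ?_
    · have ht : PolyTime (fun x : Data × (Data × Data × Data) × Data × Data × Data => x.1.head) :=
        .dhead .fst
      have ha : PolyTime (fun x : Data × (Data × Data × Data) × Data × Data × Data => x.1.tail) :=
        .dtail .fst
      have hx : PolyTime (fun x : Data × (Data × Data × Data) × Data × Data × Data => x.2.2.1) :=
        .comp .fst (.comp .snd .snd)
      have hy : PolyTime (fun x : Data × (Data × Data × Data) × Data × Data × Data => x.2.2.2.1) :=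
        .comp .fst (.comp .snd (.comp .snd .snd))
      have hz : PolyTime (fun x : Data × (Data × Data × Data) × Data × Data × Data => x.2.2.2.2) :=
        .comp .snd (.comp .snd (.comp .snd .snd))
      have hr {f : Data × (Data × Data × Data) × Data × Data × Data → Data} (hf : PolyTime f) :
          PolyTime (fun x => renameData (f x)) := .dcons (.const _) hf
      have hc (n : ℕ) := ht.dataEq (.const (Data.unary n))
      have hyz := ht.dcons (hy.dcons hz)
      have heq := ht.dcons ((hr ha.dhead).dcons (hr ha.dtail))
      have hg : PolyTime (fun x : Data × (Data × Data × Data) × Data × Data × Data =>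
          guardData (enc D) (renameData x.1.tail.head)) :=
        .dcons (.const _) (.dcons (.const _) (.dcons (.const _) (.dcons (.dcons (.const _)
          (.dcons (.const _) (hr ha.dhead))) (.const _))))
      have hg₂ : PolyTime (fun x : Data × (Data × Data × Data) × Data × Data × Data =>
          guard₂Data (enc A) (renameData x.1.tail.tail.head) (renameData x.1.tail.tail.tail)) :=
        .dcons (.const _) (.dcons (.const _) (.dcons (.const _) (.dcons (.const _)
          (.dcons (.const _) (.dcons (.dcons (.const _) (.dcons (.const _) (hr ha.dtail.dhead)))
            (.dcons (.const _) (.dcons (.dcons (.const _) (.dcons (.const _) (hr ha.dtail.dtail)))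
              (.const _))))))))
      have hq := fun n => ht.dcons ((hr ha.dhead).dcons
        (PolyTime.dcons (.const (Data.unary n)) (hg.dcons hz)))
      exact .cond (hc 0) heq <| .cond (hc 1) hg₂ <| .cond (hc 2) heq <|
        .cond (hc 3) (ht.dcons hx) <| .cond (hc 4) hyz <| .cond (hc 5) hyz <| .cond (hc 6) hyz <|
        .cond (hc 7) hyz <| .cond (hc 8) (hq 4) <| .cond (hc 9) (hq 6) <|
        ht.dcons ((hr ha.dhead).dcons hz)
    · obtain ⟨h1, h2⟩ := size_translateData_le (enc D) (enc A) t
      have e : esize (translateData (enc D) (enc A) t) = 1 + (translateData (enc D) (enc A) t).1.size +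
        (1 + (translateData (enc D) (enc A) t).2.1.size +
          (translateData (enc D) (enc A) t).2.2.size) := rfl
      rw [e]
      simp only [Polynomial.eval_add, Polynomial.eval_mul, Polynomial.eval_ofNat, Polynomial.eval_X,
        Polynomial.eval_pow, Polynomial.eval_C, mul_assoc]
      omega
  exact .of_eq_enc (PolyTime.comp .fst (h.comp (.of_enc_eq (f := fun φ : MSOFormula GraphSymbol =>
    enc φ) fun _ => rfl))) (enc_translate D A)

/-! ### Formulas that decode a graph from a permutation -/

section

variable {B : Type} (I : OrderSymbol → B → B → Prop)

/-- `b` is the successor of `a`. -/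
def IsSucc (r : OrderSymbol) (a b : B) : Prop := I r a b ∧ ¬ ∃ c, I r a c ∧ I r c b

/-- `a` and `b` are consecutive. -/
def IsConsec (r : OrderSymbol) (a b : B) : Prop := IsSucc I r a b ∨ IsSucc I r b a

/-- `a` and `b` are consecutive in both orders. -/
def IsTwin (a b : B) : Prop := IsConsec I .lt₁ a b ∧ IsConsec I .lt₂ a b

/-- `a` and `b` are connected by a chain of twins. -/
def SameBlock : B → B → Prop := Relation.ReflTransGen (IsTwin I)

/-- There is a chain of `k` points to the right of `b` in the block of `a`. -/
def BlockChain (a : B) : ℕ → B → Prop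
  | 0, _ => True
  | k + 1, b => ∃ c, SameBlock I a c ∧ I .lt₁ b c ∧ BlockChain a k c

/-- The block of `a` has more than `k` points. -/
def BlockGT (k : ℕ) (a : B) : Prop := ∃ b, SameBlock I a b ∧ BlockChain I a k b

/-- `a` and `b` are consecutive in one of the orders, and both belong to small blocks. -/
def IsLink (a b : B) : Prop :=
  (IsConsec I .lt₁ a b ∨ IsConsec I .lt₂ a b) ∧ ¬ BlockGT I 3 a ∧ ¬ BlockGT I 3 b

/-- `a` and `b` are connected by a chain of links. -/
def SameTrack : B → B → Prop := Relation.ReflTransGen (IsLink I)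

/-- A point of a block with more than four points lies strictly between `a` and `b`. -/
def Separated (a b : B) : Prop :=
  ∃ c, BlockGT I 4 c ∧ (I .lt₂ a c ∧ I .lt₂ c b ∨ I .lt₂ b c ∧ I .lt₂ c a)

/-- The edges of the encoded graph. -/
def DecodesEdge (a b : B) : Prop :=
  ∃ c, BlockGT I 1 c ∧ ¬ BlockGT I 2 c ∧ ¬ Separated I a c ∧ SameTrack I b c

end

namespace MSOFormula

/-- Defines `IsSucc`; `z` is a bound variable. -/
def isSucc (r : OrderSymbol) (x y z : ℕ) : MSOFormula OrderSymbol :=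
  and (rel r x y) (not (existsElem z (and (rel r x z) (rel r z y))))

/-- Defines `IsConsec`; `z` is a bound variable. -/
def isConsec (r : OrderSymbol) (x y z : ℕ) : MSOFormula OrderSymbol :=
  or (isSucc r x y z) (isSucc r y x z)

/-- Defines `IsTwin`; `z` is a bound variable. -/
def isTwin (x y z : ℕ) : MSOFormula OrderSymbol :=
  and (isConsec .lt₁ x y z) (isConsec .lt₂ x y z)

/-- Defines the reflexive transitive closure of the relation between `u` and `w` that `φ` defines;
`u`, `w` and the set variable `0` are bound variables. -/
def reflTransGen (φ : MSOFormula OrderSymbol) (u w x y : ℕ) : MSOFormula OrderSymbol :=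
  forallSet 0 (imp (and (mem x 0) (forallElem u (forallElem w (imp (and (mem u 0) φ) (mem w 0)))))
    (mem y 0))

/-- Defines `SameBlock`, with bound variables `10`, `11` and `12`. -/
def sameBlock (x y : ℕ) : MSOFormula OrderSymbol := reflTransGen (isTwin 10 11 12) 10 11 x y

/-- Defines `BlockChain`, with bound variables between `10` and `12` and above `50`. -/
def blockChain (x : ℕ) : ℕ → ℕ → MSOFormula OrderSymbol
  | 0, y => eq y y
  | k + 1, y => existsElem (50 + k)
      (and (sameBlock x (50 + k)) (and (rel .lt₁ y (50 + k)) (blockChain x k (50 + k))))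

/-- Defines `BlockGT`, with bound variables between `10` and `12` and above `50`. -/
def blockGT (k x : ℕ) : MSOFormula OrderSymbol :=
  existsElem (50 + k) (and (sameBlock x (50 + k)) (blockChain x k (50 + k)))

/-- Defines `IsLink`, with bound variables `22`, between `10` and `12` and above `50`. -/
def isLink (x y : ℕ) : MSOFormula OrderSymbol :=
  and (or (isConsec .lt₁ x y 22) (isConsec .lt₂ x y 22)) (and (not (blockGT 3 x)) (not (blockGT 3 y)))

/-- Defines `SameTrack`, with bound variables between `10` and `22` and above `50`. -/
def sameTrack (x y : ℕ) : MSOFormula OrderSymbol := reflTransGen (isLink 20 21) 20 21 x y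

/-- Defines `Separated`, with bound variables `6`, between `10` and `12` and above `50`. -/
def separated (x y : ℕ) : MSOFormula OrderSymbol :=
  existsElem 6 (and (blockGT 4 6)
    (or (and (rel .lt₂ x 6) (rel .lt₂ 6 y)) (and (rel .lt₂ y 6) (rel .lt₂ 6 x))))

/-- The element with name `0` encodes a vertex. -/
def decodesVertex : MSOFormula OrderSymbol := not (blockGT 1 0)

/-- Defines `DecodesEdge` for the elements with the names `0` and `2`. -/
def decodesEdge : MSOFormula OrderSymbol :=
  existsElem 4 (and (blockGT 1 4) (and (not (blockGT 2 4))
    (and (not (separated 0 4)) (sameTrack 2 4))))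

section

variable {B : Type} {I : OrderSymbol → B → B → Prop} {v : ℕ → Option B} {W : ℕ → Set B} {a b : B}

/-! ### Correctness of the defining formulas -/

theorem update_some_of_ne {z x : ℕ} (h : x ≠ z) (hx : v x = some a) (c : B) :
    Function.update v z (some c) x = some a := by
  rw [Function.update_of_ne h, hx]

theorem sat_isSucc {r : OrderSymbol} {x y z : ℕ} (hx : v x = some a) (hy : v y = some b)
    (hxz : x ≠ z) (hyz : y ≠ z) : (isSucc r x y z).Sat I v W ↔ IsSucc I r a b := by
  have h (c : B) : (Function.update v z (some c)) z = some c := by simp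
  simp only [isSucc, Sat, IsSucc]
  simp [hx, hy, update_some_of_ne hxz hx, update_some_of_ne hyz hy]

theorem sat_isConsec {r : OrderSymbol} {x y z : ℕ} (hx : v x = some a) (hy : v y = some b)
    (hxz : x ≠ z) (hyz : y ≠ z) : (isConsec r x y z).Sat I v W ↔ IsConsec I r a b := by
  rw [isConsec, Sat, sat_isSucc hx hy hxz hyz, sat_isSucc hy hx hyz hxz, IsConsec]

theorem sat_isTwin {x y z : ℕ} (hx : v x = some a) (hy : v y = some b)
    (hxz : x ≠ z) (hyz : y ≠ z) : (isTwin x y z).Sat I v W ↔ IsTwin I a b := by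
  rw [isTwin, Sat, sat_isConsec hx hy hxz hyz, sat_isConsec hx hy hxz hyz, IsTwin]

/-- A point is reachable if and only if it belongs to every set that contains the start and is
closed under the relation. For one direction, take the set of reachable points. -/
theorem sat_reflTransGen {φ : MSOFormula OrderSymbol} {R : B → B → Prop} {u w x y : ℕ}
    (hφ : ∀ (v : ℕ → Option B) W c d, v u = some c → v w = some d → (φ.Sat I v W ↔ R c d))
    (huw : u ≠ w) (hx : v x = some a) (hy : v y = some b) :
    (reflTransGen φ u w x y).Sat I v W ↔ Relation.ReflTransGen R a b := by
  have h1 (c d : B) : Function.update (Function.update v u (some c)) w (some d) u = some c := by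
    rw [Function.update_of_ne huw, Function.update_self]
  have h2 (c d : B) : Function.update (Function.update v u (some c)) w (some d) w = some d :=
    Function.update_self ..
  have h3 (c d : B) (W : ℕ → Set B) := hφ _ W c d (h1 c d) (h2 c d)
  simp only [reflTransGen, Sat, h1, h2, h3, hx, hy, Function.update_self, Option.some.injEq,
    exists_eq_left', and_imp]
  constructor
  · intro h
    exact h {c | Relation.ReflTransGen R a c} .refl fun c d hc hcd => hc.tail hcd
  · intro h S ha hS
    clear hy
    induction h with
    | refl => exact ha
    | tail _ hcd ih => exact hS _ _ ih hcd

theorem sat_sameBlock {x y : ℕ} (hx : v x = some a) (hy : v y = some b) :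
    (sameBlock x y).Sat I v W ↔ SameBlock I a b :=
  sat_reflTransGen (fun _ _ _ _ h1 h2 => sat_isTwin h1 h2 (by omega) (by omega)) (by omega) hx hy

/-- The condition on `y` rules out capture: the nested quantifiers bind the names `50, …, 50 + k -
1`, whereas `y` is the name introduced one level further out or a small one. -/
theorem sat_blockChain {x k : ℕ} : ∀ {v : ℕ → Option B} {b : B} {y : ℕ}, v x = some a →
    v y = some b → x < 50 → (y < 50 ∨ 50 + k ≤ y) →
    ((blockChain x k y).Sat I v W ↔ BlockChain I a k b) := by
  induction k with
  | zero => intro v b y hx hy _ _; simp [blockChain, BlockChain, Sat, hy]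
  | succ k ih =>
    intro v b y hx hy hx' hy'
    simp only [blockChain, BlockChain, Sat]
    refine exists_congr fun c => ?_
    have h1 : Function.update v (50 + k) (some c) x = some a := update_some_of_ne (by omega) hx c
    have h2 : Function.update v (50 + k) (some c) y = some b := update_some_of_ne (by omega) hy c
    have h3 : Function.update v (50 + k) (some c) (50 + k) = some c := Function.update_self ..
    rw [sat_sameBlock h1 h3, ih h1 h3 hx' (by omega)]
    simp [h2]

theorem sat_blockGT {x k : ℕ} (hx : v x = some a) (hx' : x < 50) :
    (blockGT k x).Sat I v W ↔ BlockGT I k a := by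
  simp only [blockGT, BlockGT, Sat]
  refine exists_congr fun c => ?_
  have h1 : Function.update v (50 + k) (some c) x = some a := update_some_of_ne (by omega) hx c
  have h3 : Function.update v (50 + k) (some c) (50 + k) = some c := Function.update_self ..
  rw [sat_sameBlock h1 h3, sat_blockChain h1 h3 hx' (by omega)]

theorem sat_isLink {x y : ℕ} (hx : v x = some a) (hy : v y = some b) (hx' : x < 22) (hy' : y < 22) :
    (isLink x y).Sat I v W ↔ IsLink I a b := by
  simp only [isLink, IsLink, Sat]
  rw [sat_isConsec hx hy (by omega) (by omega), sat_isConsec hx hy (by omega) (by omega),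
    sat_blockGT hx (by omega), sat_blockGT hy (by omega)]

theorem sat_sameTrack {x y : ℕ} (hx : v x = some a) (hy : v y = some b) :
    (sameTrack x y).Sat I v W ↔ SameTrack I a b :=
  sat_reflTransGen (fun _ _ _ _ h1 h2 => sat_isLink h1 h2 (by omega) (by omega)) (by omega) hx hy

theorem sat_separated {x y : ℕ} (hx : v x = some a) (hy : v y = some b) (hx' : x < 6)
    (hy' : y < 6) : (separated x y).Sat I v W ↔ Separated I a b := by
  simp only [separated, Separated, Sat]
  refine exists_congr fun c => ?_
  have h1 : Function.update v 6 (some c) x = some a := update_some_of_ne (by omega) hx c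
  have h2 : Function.update v 6 (some c) y = some b := update_some_of_ne (by omega) hy c
  have h3 : Function.update v 6 (some c) 6 = some c := Function.update_self ..
  rw [sat_blockGT h3 (by omega)]
  simp [h1, h2]

theorem sat_decodesVertex (hx : v 0 = some a) :
    decodesVertex.Sat I v W ↔ ¬ BlockGT I 1 a := by
  rw [decodesVertex, Sat, sat_blockGT hx (by omega)]

theorem sat_decodesEdge (hx : v 0 = some a) (hy : v 2 = some b) :
    decodesEdge.Sat I v W ↔ DecodesEdge I a b := by
  simp only [decodesEdge, DecodesEdge, Sat]
  refine exists_congr fun c => ?_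
  have h1 : Function.update v 4 (some c) 0 = some a := update_some_of_ne (by omega) hx c
  have h2 : Function.update v 4 (some c) 2 = some b := update_some_of_ne (by omega) hy c
  have h3 : Function.update v 4 (some c) 4 = some c := Function.update_self ..
  rw [sat_blockGT h3 (by omega), sat_blockGT h3 (by omega), sat_sameTrack h2 h3,
    sat_separated h1 h3 (by omega) (by omega)]

end

/-! ### Free variables of the defining formulas -/

theorem freeElem_sameBlock (x y : ℕ) : (sameBlock x y).freeElem = {x, y} := by
  ext z
  simp only [sameBlock, reflTransGen, isTwin, isConsec, isSucc, freeElem, Set.mem_sdiff,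
    Set.mem_union, Set.mem_insert_iff, Set.mem_singleton_iff]
  tauto

theorem freeElem_blockChain (x k : ℕ) : ∀ y, (blockChain x k y).freeElem ⊆ {x, y} := by
  induction k with
  | zero => intro y z; simp only [blockChain, freeElem]; simp +contextual
  | succ k ih =>
    intro y z
    have := @ih (50 + k) z
    simp only [blockChain, freeElem, freeElem_sameBlock, Set.mem_sdiff,
      Set.mem_union, Set.mem_insert_iff, Set.mem_singleton_iff] at this ⊢
    tauto

theorem freeElem_blockGT (k x : ℕ) : (blockGT k x).freeElem ⊆ {x} := by
  intro z
  have := @freeElem_blockChain x k (50 + k) z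
  simp only [blockGT, freeElem, freeElem_sameBlock, Set.mem_sdiff,
    Set.mem_union, Set.mem_insert_iff, Set.mem_singleton_iff] at this ⊢
  tauto

theorem freeElem_isLink (x y : ℕ) : (isLink x y).freeElem ⊆ {x, y} := by
  intro z
  have h1 := @freeElem_blockGT 3 x z
  have h2 := @freeElem_blockGT 3 y z
  simp only [isLink, isConsec, isSucc, freeElem, Set.mem_sdiff,
    Set.mem_union, Set.mem_insert_iff, Set.mem_singleton_iff] at h1 h2 ⊢
  tauto

theorem freeElem_decodesVertex : decodesVertex.freeElem ⊆ {0} := freeElem_blockGT 1 0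

theorem freeElem_decodesEdge : decodesEdge.freeElem ⊆ {0, 2} := by
  intro z
  have h1 := @freeElem_blockGT 1 4 z
  have h2 := @freeElem_blockGT 2 4 z
  have h3 := @freeElem_blockGT 4 6 z
  have h4 := @freeElem_isLink 20 21 z
  simp only [decodesEdge, separated, sameTrack, reflTransGen, freeElem, Set.mem_sdiff,
    Set.mem_union, Set.mem_insert_iff, Set.mem_singleton_iff] at h1 h2 h3 h4 ⊢
  tauto

theorem freeSet_sameBlock (x y : ℕ) : (sameBlock x y).freeSet = ∅ := by
  simp [sameBlock, reflTransGen, isTwin, isConsec, isSucc, freeSet]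

theorem freeSet_blockGT (k x : ℕ) : (blockGT k x).freeSet = ∅ := by
  have h : ∀ y, (blockChain x k y).freeSet = ∅ := by
    induction k with
    | zero => intro y; rfl
    | succ k ih => intro y; simp [blockChain, freeSet, freeSet_sameBlock, ih]
  simp [blockGT, freeSet, freeSet_sameBlock, h]

theorem freeSet_decodesVertex : decodesVertex.freeSet = ∅ := freeSet_blockGT 1 0

theorem freeSet_decodesEdge : decodesEdge.freeSet = ∅ := by
  simp [decodesEdge, separated, sameTrack, reflTransGen, isLink, isConsec, isSucc, freeSet,
    freeSet_blockGT]

end MSOFormula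

/-- The translation of sentences. -/
def translateSentence (φ : MSOSentence GraphSymbol) : MSOSentence OrderSymbol :=
  ⟨.translate .decodesVertex .decodesEdge φ.1, by
    have h1 := MSOFormula.freeElem_translate_subset MSOFormula.freeElem_decodesVertex
      MSOFormula.freeElem_decodesEdge φ.1
    have h2 := MSOFormula.freeSet_translate_subset MSOFormula.freeSet_decodesVertex
      MSOFormula.freeSet_decodesEdge φ.1
    rw [φ.2.1, Set.image_empty, Set.subset_empty_iff] at h1
    rw [φ.2.2, Set.image_empty, Set.subset_empty_iff] at h2
    exact ⟨h1, h2⟩⟩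

theorem holds_translateSentence {B V : Type} {I : OrderSymbol → B → B → Prop}
    {J : GraphSymbol → V → V → Prop} (ι : V → B) (hι : Function.Injective ι)
    (hD : ∀ a, ¬ BlockGT I 1 a ↔ ∃ u, ι u = a)
    (hA : ∀ u w, DecodesEdge I (ι u) (ι w) ↔ J .edge u w) (φ : MSOSentence GraphSymbol) :
    (translateSentence φ).Holds I ↔ φ.Holds J :=
  MSOFormula.sat_translate ι hι
    (fun _ _ a h => (MSOFormula.sat_decodesVertex h).trans (hD a))
    (fun _ _ u w h h' => (MSOFormula.sat_decodesEdge h h').trans (hA u w)) φ.1 (fun _ => none)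
    (fun _ => ∅) (fun _ => none) (fun _ => ∅) (fun _ => rfl) (fun _ _ => Iff.rfl)

/-! ### The points of the encoding permutation

Points are natural numbers, composed of a slot, a cell of the path and an index. -/

/-- The slot of a point; tracks run along odd slots. -/
def slotOf (k u : ℕ) : ℕ := u / 5 / k

/-- The position of the cell of a point on the path of cells. -/
def cellOf (k u : ℕ) : ℕ := u / 5 % k

/-- The index of a point among the points of the same cell and slot. -/
def indexOf (u : ℕ) : ℕ := u % 5

/-- The point with the given slot, cell and index. -/
def mkPoint (k s t i : ℕ) : ℕ := (s * k + t) * 5 + i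

/-- The number of points in slot `s` of cell `t`. -/
def blockSize (n : ℕ) (adj : ℕ → ℕ → Bool) (t s : ℕ) : ℕ :=
  if s = 0 ∨ s = 2 * n then 5
  else if s % 2 = 0 then 4
  else if t = 3 * (s / 2) + 1 then 1
  else if t % 3 = 1 ∧ adj (t / 3) (s / 2) = true then 2
  else 3

/-- The points that belong to the encoding. -/
def IsPoint (n k : ℕ) (adj : ℕ → ℕ → Bool) (u : ℕ) : Prop :=
  slotOf k u ≤ 2 * n ∧ indexOf u < blockSize n adj (cellOf k u) (slotOf k u)

instance (n k : ℕ) (adj : ℕ → ℕ → Bool) : DecidablePred (IsPoint n k adj) :=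
  fun _ => inferInstanceAs (Decidable (_ ∧ _))

theorem blockSize_pos (n : ℕ) (adj : ℕ → ℕ → Bool) (t s : ℕ) : 0 < blockSize n adj t s := by
  unfold blockSize; split_ifs <;> omega

theorem blockSize_le (n : ℕ) (adj : ℕ → ℕ → Bool) (t s : ℕ) : blockSize n adj t s ≤ 5 := by
  unfold blockSize; split_ifs <;> omega

section

variable {k s t i : ℕ}

theorem slotOf_mkPoint (ht : t < k) (hi : i < 5) : slotOf k (mkPoint k s t i) = s := by
  unfold slotOf mkPoint
  rw [show ((s * k + t) * 5 + i) / 5 = s * k + t by omega, mul_comm, Nat.mul_add_div (by omega),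
    Nat.div_eq_of_lt ht, add_zero]

theorem cellOf_mkPoint (ht : t < k) (hi : i < 5) : cellOf k (mkPoint k s t i) = t := by
  unfold cellOf mkPoint
  rw [show ((s * k + t) * 5 + i) / 5 = s * k + t by omega, mul_comm, Nat.mul_add_mod,
    Nat.mod_eq_of_lt ht]

theorem indexOf_mkPoint (hi : i < 5) : indexOf (mkPoint k s t i) = i := by
  unfold indexOf mkPoint
  omega

theorem mkPoint_eta (k u : ℕ) : mkPoint k (slotOf k u) (cellOf k u) (indexOf u) = u := by
  unfold mkPoint slotOf cellOf indexOf
  rw [mul_comm (u / 5 / k), Nat.div_add_mod]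
  omega

theorem mkPoint_lt_mkPoint {s' t' i' : ℕ} (ht : t < k) (ht' : t' < k) (hi : i < 5) (hi' : i' < 5) :
    mkPoint k s t i < mkPoint k s' t' i' ↔ s < s' ∨ s = s' ∧ (t < t' ∨ t = t' ∧ i < i') := by
  have key : ∀ {s t i s' t' i' : ℕ}, t < k → i < 5 →
      (s < s' ∨ s = s' ∧ (t < t' ∨ t = t' ∧ i < i')) → mkPoint k s t i < mkPoint k s' t' i' := by
    intro s t i s' t' i' ht hi h
    unfold mkPoint
    rcases h with h | ⟨rfl, h⟩
    · have : (s + 1) * k ≤ s' * k := Nat.mul_le_mul_right k h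
      rw [add_mul, one_mul] at this
      omega
    · omega
  refine ⟨fun h => ?_, key ht hi⟩
  by_contra hne
  have h2 : s' < s ∨ s' = s ∧ (t' < t ∨ t' = t ∧ i' < i) ∨ s = s' ∧ t = t' ∧ i = i' := by omega
  rcases h2 with h2 | h2 | ⟨rfl, rfl, rfl⟩
  · exact absurd (key ht' hi' (.inl h2)) h.asymm
  · exact absurd (key ht' hi' (.inr h2)) h.asymm
  · exact lt_irrefl _ h

theorem point_lt_iff (hk : 0 < k) {u u' : ℕ} : u < u' ↔ slotOf k u < slotOf k u' ∨
    slotOf k u = slotOf k u' ∧ (cellOf k u < cellOf k u' ∨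
      cellOf k u = cellOf k u' ∧ indexOf u < indexOf u') := by
  conv_lhs => rw [← mkPoint_eta k u, ← mkPoint_eta k u']
  exact mkPoint_lt_mkPoint (Nat.mod_lt _ hk) (Nat.mod_lt _ hk) (Nat.mod_lt _ (by omega))
    (Nat.mod_lt _ (by omega))

end

/-- `line r t` is the column (for `lt₁`) or the row (for `lt₂`) of the cell `t` of a path of cells,
and `sign r t` is the direction in which the points of the cell are arranged. -/
structure IsPathLayout (k : ℕ) (line : OrderSymbol → ℕ → ℕ) (sign : OrderSymbol → ℕ → Bool) :
    Prop where
  near : ∀ r t t', t < k → t' < k → line r t = line r t' → t ≤ t' + 1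
  sign_eq : ∀ r t t', t < k → t' < k → line r t = line r t' → sign r t = sign r t'
  step : ∀ t, t + 1 < k → ∃ r, line r t = line r (t + 1)
  inj : ∀ t t', t < k → t' < k → (∀ r, line r t = line r t') → t = t'

/-- The elements of a structure are the points of the encoding, arranged according to a layout. -/
structure IsEncoding {B : Type} (I : OrderSymbol → B → B → Prop) (n k : ℕ) (adj : ℕ → ℕ → Bool)
    (line : OrderSymbol → ℕ → ℕ) (sign : OrderSymbol → ℕ → Bool) (p : B → ℕ) : Prop where
  layout : IsPathLayout k line sign
  le : 3 * n + 2 ≤ k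
  inj : Function.Injective p
  range : ∀ u, (∃ a, p a = u) ↔ IsPoint n k adj u
  lt_iff : ∀ r a b, I r a b ↔ line r (cellOf k (p a)) < line r (cellOf k (p b)) ∨
    line r (cellOf k (p a)) = line r (cellOf k (p b)) ∧
      (if sign r (cellOf k (p a)) = true then p a < p b else p b < p a)

namespace IsEncoding

variable {B : Type} {I : OrderSymbol → B → B → Prop} {n k : ℕ} {adj : ℕ → ℕ → Bool}
  {line : OrderSymbol → ℕ → ℕ} {sign : OrderSymbol → ℕ → Bool} {p : B → ℕ}
  (E : IsEncoding I n k adj line sign p)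

/-- The point belongs to a slot at the border of its cell. -/
def IsBorder (n k : ℕ) (u : ℕ) : Prop := slotOf k u = 0 ∨ slotOf k u = 2 * n

include E

/-! ### Points on a common line and border points -/

theorem pos : 0 < k := by have := E.le; omega

theorem cell_lt (u : ℕ) : cellOf k u < k := Nat.mod_lt _ E.pos

theorem slot_le (a : B) : slotOf k (p a) ≤ 2 * n := ((E.range _).1 ⟨a, rfl⟩).1

theorem index_lt (a : B) : indexOf (p a) < blockSize n adj (cellOf k (p a)) (slotOf k (p a)) :=
  ((E.range _).1 ⟨a, rfl⟩).2

theorem exists_point {s t i : ℕ} (hs : s ≤ 2 * n) (ht : t < k) (hi : i < blockSize n adj t s) :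
    ∃ c, slotOf k (p c) = s ∧ cellOf k (p c) = t ∧ indexOf (p c) = i := by
  have hi' := hi.trans_le (blockSize_le n adj t s)
  have h1 := slotOf_mkPoint (s := s) ht hi'
  have h2 := cellOf_mkPoint (s := s) ht hi'
  have h3 := indexOf_mkPoint (k := k) (s := s) (t := t) hi'
  obtain ⟨c, hc⟩ := (E.range (mkPoint k s t i)).2 ⟨by omega, by rw [h1, h2, h3]; exact hi⟩
  exact ⟨c, by rw [hc, h1], by rw [hc, h2], by rw [hc, h3]⟩

theorem ext_point {a b : B} (hs : slotOf k (p a) = slotOf k (p b))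
    (ht : cellOf k (p a) = cellOf k (p b)) (hi : indexOf (p a) = indexOf (p b)) : a = b := by
  apply E.inj
  rw [← mkPoint_eta k (p a), ← mkPoint_eta k (p b), hs, ht, hi]

/-- Consecutive points on a line have no points of the same line between them. -/
theorem not_between {r : OrderSymbol} {a b c : B} (h : IsConsec I r a b)
    (hab : line r (cellOf k (p a)) = line r (cellOf k (p b)))
    (hac : line r (cellOf k (p a)) = line r (cellOf k (p c))) (h₁ : p a < p c) (h₂ : p c < p b) :
    False := by
  have ha := E.cell_lt (p a)
  have hb := E.cell_lt (p b)
  have hc := E.cell_lt (p c)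
  have s1 := E.layout.sign_eq r _ _ ha hb hab
  have s2 := E.layout.sign_eq r _ _ ha hc hac
  rcases h with ⟨h, h'⟩ | ⟨h, h'⟩ <;> refine h' ⟨c, ?_⟩ <;>
    rw [E.lt_iff] at h ⊢ <;> rw [E.lt_iff] <;> rw [← s1] at * <;> rw [← s2] at * <;>
    split_ifs at * <;> omega

/-- Points on the same line without points of the same line between them are consecutive. -/
theorem isConsec {r : OrderSymbol} {a b : B}
    (hab : line r (cellOf k (p a)) = line r (cellOf k (p b))) (hlt : p a < p b)
    (h : ∀ c, line r (cellOf k (p a)) = line r (cellOf k (p c)) → p a < p c → p c < p b → False) :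
    IsConsec I r a b := by
  have ha := E.cell_lt (p a)
  have hb := E.cell_lt (p b)
  have s1 := E.layout.sign_eq r _ _ ha hb hab
  by_cases hs : sign r (cellOf k (p a)) = true
  · refine .inl ⟨?_, fun ⟨c, h1, h2⟩ => ?_⟩
    · rw [E.lt_iff, if_pos hs]; omega
    · have hc := E.cell_lt (p c)
      rw [E.lt_iff, if_pos hs] at h1
      rw [E.lt_iff] at h2
      have hac : line r (cellOf k (p a)) = line r (cellOf k (p c)) := by omega
      rw [← E.layout.sign_eq r _ _ ha hc hac, if_pos hs] at h2
      exact h c hac (by omega) (by omega)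
  · refine .inr ⟨?_, fun ⟨c, h1, h2⟩ => ?_⟩
    · rw [E.lt_iff, ← s1, if_neg hs]; omega
    · have hc := E.cell_lt (p c)
      rw [E.lt_iff, ← s1, if_neg hs] at h1
      rw [E.lt_iff] at h2
      have hac : line r (cellOf k (p a)) = line r (cellOf k (p c)) := by omega
      rw [← E.layout.sign_eq r _ _ ha hc hac, if_neg hs] at h2
      exact h c hac (by omega) (by omega)

/-- Beyond a point that is not at the border there is a border point of the same cell. -/
theorem exists_border (r : OrderSymbol) {a : B} (ha : ¬ IsBorder n k (p a)) :
    (∃ c, IsBorder n k (p c) ∧ cellOf k (p c) = cellOf k (p a) ∧ I r a c) ∧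
      ∃ c, IsBorder n k (p c) ∧ cellOf k (p c) = cellOf k (p a) ∧ I r c a := by
  have hs := E.slot_le a
  unfold IsBorder at *
  obtain ⟨c, hc1, hc2, -⟩ := E.exists_point (Nat.zero_le _) (E.cell_lt (p a))
    (blockSize_pos n adj _ 0)
  obtain ⟨d, hd1, hd2, -⟩ := E.exists_point le_rfl (E.cell_lt (p a))
    (blockSize_pos n adj _ (2 * n))
  have h1 : p c < p a := (point_lt_iff E.pos).2 (by omega)
  have h2 : p a < p d := (point_lt_iff E.pos).2 (by omega)
  have e1 (b : B) : I r a b ↔ _ := E.lt_iff r a b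
  have e2 (b : B) : I r b a ↔ _ := E.lt_iff r b a
  by_cases hg : sign r (cellOf k (p a)) = true
  · refine ⟨⟨d, by omega, hd2, ?_⟩, c, by omega, hc2, ?_⟩
    · rw [e1, hd2, if_pos hg]; omega
    · rw [e2, hc2, if_pos hg]; omega
  · refine ⟨⟨c, by omega, hc2, ?_⟩, d, by omega, hd2, ?_⟩
    · rw [e1, hc2, if_neg hg]; omega
    · rw [e2, hd2, if_neg hg]; omega

/-- Otherwise, a border point of the cell of the interior point lies beyond it on its own line,
hence between the two points. -/
theorem isBorder_of_isSucc {r : OrderSymbol} {a b : B} (h : IsSucc I r a b)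
    (hab : line r (cellOf k (p a)) ≠ line r (cellOf k (p b))) :
    IsBorder n k (p a) ∧ IsBorder n k (p b) := by
  obtain ⟨h, h'⟩ := h
  have hl := (E.lt_iff r a b).1 h
  refine ⟨by_contra fun ha => ?_, by_contra fun hb => ?_⟩
  · obtain ⟨⟨c, -, hc, hac⟩, -⟩ := E.exists_border r ha
    refine h' ⟨c, hac, ?_⟩
    rw [E.lt_iff, hc]; omega
  · obtain ⟨-, ⟨c, -, hc, hcb⟩⟩ := E.exists_border r hb
    refine h' ⟨c, ?_, hcb⟩
    rw [E.lt_iff, hc]; omega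

theorem isBorder_of_isConsec {r : OrderSymbol} {a b : B} (h : IsConsec I r a b)
    (hab : line r (cellOf k (p a)) ≠ line r (cellOf k (p b))) :
    IsBorder n k (p a) ∧ IsBorder n k (p b) := by
  rcases h with h | h
  · exact E.isBorder_of_isSucc h hab
  · exact (E.isBorder_of_isSucc h hab.symm).symm

/-! ### Blocks of points -/

theorem slot_le_of_isTwin {a b : B} (h : IsTwin I a b)
    (hab : cellOf k (p a) = cellOf k (p b)) : slotOf k (p b) ≤ slotOf k (p a) := by
  by_contra! hlt
  have ht := E.cell_lt (p a)
  have hcon : ∀ r, IsConsec I r a b := fun r => by cases r; exacts [h.1, h.2]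
  -- In particular there are at least two cells, even for `n = 0`, so every cell has a neighbour on
  -- the path.
  have hk := E.le
  by_cases h1 : cellOf k (p a) + 1 < k
  · obtain ⟨r, hr⟩ := E.layout.step _ h1
    -- On the line shared with the next cell, that cell's points in the slot of `a` lie between `a`
    -- and `b`. For the last cell, the previous cell's points in the slot of `b` do the same.
    obtain ⟨c, hc1, hc2, -⟩ := E.exists_point (E.slot_le a) h1 (blockSize_pos n adj _ _)
    exact E.not_between (hcon r) (by rw [hab]) (by rw [hc2, hr])
      ((point_lt_iff E.pos).2 (by omega)) ((point_lt_iff E.pos).2 (by omega))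
  · obtain ⟨t, ht'⟩ : ∃ t, cellOf k (p a) = t + 1 := ⟨cellOf k (p a) - 1, by omega⟩
    obtain ⟨r, hr⟩ := E.layout.step t (by omega)
    obtain ⟨c, hc1, hc2, -⟩ := E.exists_point (E.slot_le b) (t := t) (by omega)
      (blockSize_pos n adj _ _)
    exact E.not_between (hcon r) (by rw [hab]) (by rw [hc2, hr, ht'])
      ((point_lt_iff E.pos).2 (by omega)) ((point_lt_iff E.pos).2 (by omega))

/-- A point off the border is consecutive only to points on its own line, in both orders, and a row
and a column determine the cell. Points of one cell in different slots are kept apart by a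
neighbouring cell. -/
theorem eq_of_isTwin {a b : B} (h : IsTwin I a b) (ha : ¬ IsBorder n k (p a)) :
    slotOf k (p b) = slotOf k (p a) ∧ cellOf k (p b) = cellOf k (p a) := by
  have hcon : ∀ r, IsConsec I r a b := fun r => by cases r; exacts [h.1, h.2]
  have hcell : cellOf k (p a) = cellOf k (p b) :=
    E.layout.inj _ _ (E.cell_lt _) (E.cell_lt _) fun r => by_contra fun hne =>
      ha (E.isBorder_of_isConsec (hcon r) hne).1
  exact ⟨le_antisymm (E.slot_le_of_isTwin h hcell)
    (E.slot_le_of_isTwin ⟨h.1.symm, h.2.symm⟩ hcell.symm), hcell.symm⟩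

theorem eq_of_sameBlock {a b : B} (h : SameBlock I a b) (ha : ¬ IsBorder n k (p a)) :
    slotOf k (p b) = slotOf k (p a) ∧ cellOf k (p b) = cellOf k (p a) := by
  induction h with
  | refl => exact ⟨rfl, rfl⟩
  | tail _ hbc ih =>
    have := E.eq_of_isTwin hbc (by unfold IsBorder at *; rwa [ih.1])
    exact ⟨this.1.trans ih.1, this.2.trans ih.2⟩

/-- Points of the same block with successive indices are consecutive in both orders. -/
theorem isConsec_of_index {a b : B} (hs : slotOf k (p b) = slotOf k (p a))
    (ht : cellOf k (p b) = cellOf k (p a)) (hi : indexOf (p b) = indexOf (p a) + 1)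
    (r : OrderSymbol) : IsConsec I r a b := by
  refine E.isConsec (by rw [ht]) ((point_lt_iff E.pos).2 (by omega)) fun c _ h1 h2 => ?_
  rw [point_lt_iff E.pos] at h1 h2
  omega

omit E in
theorem SameBlock.symm {a b : B} (h : SameBlock I a b) : SameBlock I b a :=
  have : Std.Symm (IsTwin I) := ⟨fun _ _ h => ⟨h.1.symm, h.2.symm⟩⟩
  Relation.ReflTransGen.stdSymm.symm _ _ h

theorem sameBlock {a b : B} (hs : slotOf k (p b) = slotOf k (p a))
    (ht : cellOf k (p b) = cellOf k (p a)) : SameBlock I a b := by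
  have key : ∀ (i : ℕ) (a b : B), slotOf k (p b) = slotOf k (p a) →
      cellOf k (p b) = cellOf k (p a) → indexOf (p b) = indexOf (p a) + i → SameBlock I a b := by
    intro i
    induction i with
    | zero => intro a b hs ht hi; rw [E.ext_point hs ht hi]; exact .refl
    | succ i ih =>
      intro a b hs ht hi
      have := E.index_lt b
      obtain ⟨c, hc1, hc2, hc3⟩ := E.exists_point (E.slot_le a) (E.cell_lt (p a))
        (i := indexOf (p a) + i) (by rw [hs, ht] at this; omega)
      have h1 := fun r => E.isConsec_of_index (a := c) (b := b) (by omega) (by omega) (by omega) r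
      exact (ih a c hc1 hc2 hc3).tail ⟨h1 _, h1 _⟩
  rcases le_total (indexOf (p a)) (indexOf (p b)) with h | h
  · exact key (indexOf (p b) - indexOf (p a)) a b hs ht (by omega)
  · exact SameBlock.symm (key (indexOf (p a) - indexOf (p b)) b a hs.symm ht.symm (by omega))

/-- Chains run to the right, so along a block the index increases or decreases according to the
direction of the column; the two cases start at opposite ends of the block. -/
theorem blockGT_of_lt {a : B} {m : ℕ}
    (hm : m < blockSize n adj (cellOf k (p a)) (slotOf k (p a))) : BlockGT I m a := by
  obtain ⟨z, hz⟩ : ∃ z, z = blockSize n adj (cellOf k (p a)) (slotOf k (p a)) := ⟨_, rfl⟩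
  have hp : ∀ i < z, ∃ c, slotOf k (p c) = slotOf k (p a) ∧ cellOf k (p c) = cellOf k (p a) ∧
      indexOf (p c) = i := fun i hi => E.exists_point (E.slot_le a) (E.cell_lt _) (by omega)
  by_cases hg : sign .lt₁ (cellOf k (p a)) = true
  · have key : ∀ (m : ℕ) (b : B), slotOf k (p b) = slotOf k (p a) → cellOf k (p b) = cellOf k (p a) →
        indexOf (p b) + m < z → BlockChain I a m b := by
      intro m
      induction m with
      | zero => intro _ _ _ _; trivial
      | succ m ih =>
        intro b h1 h2 h3
        obtain ⟨c, c1, c2, c3⟩ := hp (indexOf (p b) + 1) (by omega)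
        refine ⟨c, E.sameBlock c1 c2, ?_, ih c c1 c2 (by omega)⟩
        rw [E.lt_iff, h2, c2, if_pos hg, point_lt_iff (u := p b) E.pos]
        omega
    obtain ⟨c, c1, c2, c3⟩ := hp 0 (by omega)
    exact ⟨c, E.sameBlock c1 c2, key m c c1 c2 (by omega)⟩
  · have key : ∀ (m : ℕ) (b : B), slotOf k (p b) = slotOf k (p a) → cellOf k (p b) = cellOf k (p a) →
        m ≤ indexOf (p b) → indexOf (p b) < z → BlockChain I a m b := by
      intro m
      induction m with
      | zero => intro _ _ _ _ _; trivial
      | succ m ih =>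
        intro b h1 h2 h3 h4
        obtain ⟨c, c1, c2, c3⟩ := hp (indexOf (p b) - 1) (by omega)
        refine ⟨c, E.sameBlock c1 c2, ?_, ih c c1 c2 (by omega) (by omega)⟩
        rw [E.lt_iff, h2, c2, if_neg hg, point_lt_iff (u := p c) E.pos]
        omega
    obtain ⟨c, c1, c2, c3⟩ := hp (z - 1) (by omega)
    exact ⟨c, E.sameBlock c1 c2, key m c c1 c2 (by omega) (by omega)⟩

/-- Each step of a chain moves the index strictly in one direction inside a single slot of a single
cell. The assumption is needed because border points of different cells may also be consecutive in
both orders, which would merge their blocks. -/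
theorem blockGT_iff {a : B} (ha : ¬ IsBorder n k (p a)) {m : ℕ} :
    BlockGT I m a ↔ m < blockSize n adj (cellOf k (p a)) (slotOf k (p a)) := by
  refine ⟨?_, E.blockGT_of_lt⟩
  rintro ⟨b, hab, hb⟩
  obtain ⟨b1, b2⟩ := E.eq_of_sameBlock hab ha
  have hz := E.index_lt b
  rw [b1, b2] at hz
  have key : ∀ (m : ℕ) (b : B), SameBlock I a b → BlockChain I a m b →
      (sign .lt₁ (cellOf k (p a)) = true → indexOf (p b) + m <
        blockSize n adj (cellOf k (p a)) (slotOf k (p a))) ∧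
      (¬ sign .lt₁ (cellOf k (p a)) = true → m ≤ indexOf (p b)) := by
    intro m
    induction m with
    | zero =>
      intro b hab _
      obtain ⟨b1, b2⟩ := E.eq_of_sameBlock hab ha
      have hz := E.index_lt b
      rw [b1, b2] at hz
      exact ⟨fun _ => hz, fun _ => Nat.zero_le _⟩
    | succ m ih =>
      rintro b hab ⟨c, hac, hbc, hc⟩
      obtain ⟨b1, b2⟩ := E.eq_of_sameBlock hab ha
      obtain ⟨c1, c2⟩ := E.eq_of_sameBlock hac ha
      obtain ⟨h1, h2⟩ := ih c hac hc
      rw [E.lt_iff, b2, c2, point_lt_iff (u := p b) E.pos, point_lt_iff (u := p c) E.pos] at hbc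
      constructor
      · intro hg
        have := h1 hg
        rw [if_pos hg] at hbc
        omega
      · intro hg
        have := h2 hg
        rw [if_neg hg] at hbc
        omega
  obtain ⟨h1, h2⟩ := key m b hab hb
  by_cases hg : sign .lt₁ (cellOf k (p a)) = true
  · have := h1 hg; omega
  · have := h2 hg; omega

omit E in
theorem blockSize_of_isBorder {u : ℕ} (h : IsBorder n k u) (t : ℕ) :
    blockSize n adj t (slotOf k u) = 5 := by
  unfold blockSize IsBorder at *
  rw [if_pos h]

/-- Border blocks may merge into larger ones, but for them only the lower bound of five points is
needed. Every other block has at most four points. -/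
theorem blockGT_four_iff {a : B} : BlockGT I 4 a ↔ IsBorder n k (p a) := by
  by_cases h : IsBorder n k (p a)
  · exact iff_of_true (E.blockGT_of_lt (by rw [blockSize_of_isBorder h]; omega)) h
  · rw [E.blockGT_iff h]
    refine iff_of_false ?_ h
    unfold IsBorder at h
    unfold blockSize
    rw [if_neg h]
    split_ifs <;> omega

theorem blockGT_three_iff {a : B} : BlockGT I 3 a ↔ slotOf k (p a) % 2 = 0 := by
  by_cases h : IsBorder n k (p a)
  · refine iff_of_true (E.blockGT_of_lt (by rw [blockSize_of_isBorder h]; omega)) ?_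
    unfold IsBorder at h; omega
  · rw [E.blockGT_iff h]
    unfold IsBorder at h
    unfold blockSize
    rw [if_neg h]
    split_ifs <;> omega

/-! ### Tracks -/

theorem slot_le_of_isConsec {r : OrderSymbol} {a b : B} (h : IsConsec I r a b)
    (ha : slotOf k (p a) % 2 ≠ 0) (hb : slotOf k (p b) % 2 ≠ 0) :
    slotOf k (p b) ≤ slotOf k (p a) := by
  by_contra! hlt
  have hl : line r (cellOf k (p a)) = line r (cellOf k (p b)) := by
    by_contra hne
    have := (E.isBorder_of_isConsec h hne).1
    unfold IsBorder at this
    omega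
  have hb' := E.slot_le b
  -- Odd slots are not at the border, so the points share a line. If their slots differed, the wall
  -- in the even slot after that of `a` would lie between them.
  obtain ⟨c, hc1, hc2, -⟩ := E.exists_point (s := slotOf k (p a) + 1) (by omega) (E.cell_lt (p a))
    (blockSize_pos n adj _ _)
  exact E.not_between h hl (by rw [hc2]) ((point_lt_iff E.pos).2 (by omega))
      ((point_lt_iff E.pos).2 (by omega))

theorem slot_eq_of_sameTrack {a b : B} (h : SameTrack I a b) :
    slotOf k (p b) = slotOf k (p a) := by
  induction h with
  | refl => rfl
  | @tail b c _ hbc ih =>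
    rw [← ih]
    obtain ⟨h, hb, hc⟩ := hbc
    rw [E.blockGT_three_iff] at hb hc
    obtain ⟨r, hr⟩ : ∃ r, IsConsec I r b c := by rcases h with h | h; exacts [⟨_, h⟩, ⟨_, h⟩]
    exact le_antisymm (E.slot_le_of_isConsec hr hb hc) (E.slot_le_of_isConsec hr.symm hc hb)

theorem isLink {r : OrderSymbol} {a b : B} (h : IsConsec I r a b)
    (ha : slotOf k (p a) % 2 ≠ 0) (hb : slotOf k (p b) % 2 ≠ 0) : IsLink I a b := by
  refine ⟨?_, by rwa [E.blockGT_three_iff], by rwa [E.blockGT_three_iff]⟩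
  cases r
  exacts [.inl h, .inr h]

omit E in
theorem SameTrack.symm {a b : B} (h : SameTrack I a b) : SameTrack I b a :=
  have : Std.Symm (IsLink I) := ⟨fun _ _ h => ⟨h.1.imp Or.symm Or.symm, h.2.2, h.2.1⟩⟩
  Relation.ReflTransGen.stdSymm.symm _ _ h

theorem sameTrack {a b : B} (ha : slotOf k (p a) % 2 ≠ 0) (hs : slotOf k (p b) = slotOf k (p a)) :
    SameTrack I a b := by
  -- All points of the slot are connected to one of its points in the first cell, by induction on
  -- the cell and then on the index.
  obtain ⟨o, o1, o2, o3⟩ := E.exists_point (E.slot_le a) E.pos (blockSize_pos n adj _ _)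
  have key : ∀ (t i : ℕ) (c : B), slotOf k (p c) = slotOf k (p a) → cellOf k (p c) = t →
      indexOf (p c) = i → SameTrack I o c := by
    intro t
    induction t with
    | zero =>
      intro i
      induction i with
      | zero =>
        intro c c1 c2 c3
        rw [E.ext_point (a := c) (b := o) (by omega) (by omega) (by omega)]; exact .refl
      | succ i ih =>
        intro c c1 c2 c3
        have hc := E.index_lt c
        obtain ⟨d, d1, d2, d3⟩ := E.exists_point (E.slot_le c) (E.cell_lt (p c)) (i := i) (by omega)
        exact (ih d (by omega) (by omega) d3).tail (E.isLink (E.isConsec_of_index (r := .lt₁)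
          (by omega) (by omega) (by omega)) (by omega) (by omega))
    | succ t iht =>
      intro i
      induction i with
      | zero =>
        intro c c1 c2 c3
        have hc := E.cell_lt (p c)
        obtain ⟨r, hr⟩ := E.layout.step t (by omega)
        -- The last point of the block in cell `t` and the first one in cell `t + 1` are consecutive
        -- on the line that the two cells share.
        obtain ⟨d, d1, d2, d3⟩ := E.exists_point (E.slot_le c) (t := t) (by omega)
          (i := blockSize n adj t (slotOf k (p c)) - 1) (by
            have := blockSize_pos n adj t (slotOf k (p c)); omega)
        refine (iht _ d (by omega) d2 rfl).tail (E.isLink (r := r) (E.isConsec (by rw [d2, c2, hr])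
          ((point_lt_iff E.pos).2 (by omega)) fun e he h1 h2 => ?_) (by omega) (by omega))
        rw [point_lt_iff E.pos] at h1 h2
        have he' := E.index_lt e
        rcases lt_trichotomy (cellOf k (p e)) t with h | h | h
        · omega
        · have hse : slotOf k (p e) = slotOf k (p c) := by omega
          rw [h, hse] at he'
          omega
        · omega
      | succ i ih =>
        intro c c1 c2 c3
        have hc := E.index_lt c
        obtain ⟨d, d1, d2, d3⟩ := E.exists_point (E.slot_le c) (E.cell_lt (p c)) (i := i) (by omega)
        exact (ih d (by omega) (by omega) d3).tail (E.isLink (E.isConsec_of_index (r := .lt₁)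
          (by omega) (by omega) (by omega)) (by omega) (by omega))
  exact (SameTrack.symm (key _ _ a rfl rfl rfl)).trans (key _ _ b hs rfl rfl)

/-! ### Rows, vertices and edges -/

theorem separated_iff {a b : B} (ha : ¬ IsBorder n k (p a)) (hb : ¬ IsBorder n k (p b)) :
    Separated I a b ↔ line .lt₂ (cellOf k (p a)) ≠ line .lt₂ (cellOf k (p b)) := by
  constructor
  · rintro ⟨c, hc, h⟩ hab
    rw [E.blockGT_four_iff] at hc
    have s1 := E.layout.sign_eq .lt₂ _ _ (E.cell_lt _) (E.cell_lt _) hab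
    -- A point between two points of a row belongs to that row. Border slots are the extreme ones on
    -- it, so no border point lies between two points off the border.
    have hac : line .lt₂ (cellOf k (p a)) = line .lt₂ (cellOf k (p c)) := by
      rcases h with ⟨h1, h2⟩ | ⟨h1, h2⟩ <;> rw [E.lt_iff] at h1 h2 <;> omega
    have s2 := E.layout.sign_eq .lt₂ _ _ (E.cell_lt _) (E.cell_lt _) hac
    have hbet : p a < p c ∧ p c < p b ∨ p b < p c ∧ p c < p a := by
      rcases h with ⟨h1, h2⟩ | ⟨h1, h2⟩ <;> rw [E.lt_iff] at h1 h2 <;>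
        simp only [← s1, ← s2] at h1 h2 <;> split_ifs at h1 h2 <;> omega
    rw [point_lt_iff (u := p a) E.pos, point_lt_iff (u := p c) E.pos,
      point_lt_iff (u := p b) E.pos, point_lt_iff (u := p c) E.pos] at hbet
    unfold IsBorder at *
    have := E.slot_le a
    have := E.slot_le b
    omega
  · intro hab
    rcases lt_or_gt_of_ne hab with h | h
    -- For different rows, one of the border points in the cell of `a` lies between `a` and the row
    -- of `b`.
    · obtain ⟨⟨c, hc, hca, hac⟩, -⟩ := E.exists_border .lt₂ ha
      exact ⟨c, E.blockGT_four_iff.2 hc, .inl ⟨hac, (E.lt_iff _ _ _).2 (.inl (by rwa [hca]))⟩⟩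
    · obtain ⟨-, ⟨c, hc, hca, hac⟩⟩ := E.exists_border .lt₂ ha
      exact ⟨c, E.blockGT_four_iff.2 hc, .inr ⟨(E.lt_iff _ _ _).2 (.inl (by rwa [hca])), hac⟩⟩

/-- The points that represent the vertices. -/
theorem exists_vertexPoint : ∃ ι : Fin n → B, ∀ w, slotOf k (p (ι w)) = 2 * w + 1 ∧
    cellOf k (p (ι w)) = 3 * w + 1 ∧ indexOf (p (ι w)) = 0 := by
  have (w : Fin n) := E.exists_point (s := 2 * w + 1) (t := 3 * w + 1) (by omega)
    (by have := E.le; omega) (blockSize_pos n adj _ _)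
  choose ι hι using this
  exact ⟨ι, hι⟩

/-- The only blocks of size 1 are those on the track `2w + 1` in the cell `3w + 1`. -/
theorem not_blockGT_one_iff {ι : Fin n → B} (hι : ∀ w, slotOf k (p (ι w)) = 2 * w + 1 ∧
    cellOf k (p (ι w)) = 3 * w + 1 ∧ indexOf (p (ι w)) = 0) (a : B) :
    ¬ BlockGT I 1 a ↔ ∃ w, ι w = a := by
  constructor
  · intro h
    have hb : ¬ IsBorder n k (p a) := fun hb =>
      h (E.blockGT_of_lt (by rw [blockSize_of_isBorder hb]; omega))
    rw [E.blockGT_iff hb] at h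
    have hi := E.index_lt a
    have hs := E.slot_le a
    unfold IsBorder at hb
    have hd : slotOf k (p a) % 2 ≠ 0 ∧ cellOf k (p a) = 3 * (slotOf k (p a) / 2) + 1 := by
      unfold blockSize at h
      rw [if_neg hb] at h
      split_ifs at h <;> omega
    refine ⟨⟨slotOf k (p a) / 2, by omega⟩, E.ext_point ?_ ?_ ?_⟩
    · rw [(hι _).1]; simp only; omega
    · rw [(hι _).2.1]; simp only; omega
    · rw [(hι _).2.2]; omega
  · rintro ⟨w, rfl⟩
    obtain ⟨h1, h2, -⟩ := hι w
    rw [E.blockGT_iff (by unfold IsBorder; omega), h1, h2]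
    unfold blockSize
    rw [if_neg (by omega), if_neg (by omega), if_pos (by omega)]
    omega

/-- The witness is a point of the block of size 2 in the cell of `u` on the track of `w`. There are
no loops, so this block does not compete with the vertex marker in the same place. -/
theorem decodesEdge_iff {ι : Fin n → B} (hι : ∀ w, slotOf k (p (ι w)) = 2 * w + 1 ∧
    cellOf k (p (ι w)) = 3 * w + 1 ∧ indexOf (p (ι w)) = 0) (hadj : ∀ w, adj w w = false)
    (u w : Fin n) : DecodesEdge I (ι u) (ι w) ↔ adj u w = true := by
  obtain ⟨u1, u2, u3⟩ := hι u
  obtain ⟨w1, w2, w3⟩ := hι w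
  have hu : ¬ IsBorder n k (p (ι u)) := by unfold IsBorder; omega
  constructor
  · rintro ⟨c, h1, h2, h3, h4⟩
    have hb : ¬ IsBorder n k (p c) := fun hb =>
      h2 (E.blockGT_of_lt (by rw [blockSize_of_isBorder hb]; omega))
    rw [E.blockGT_iff hb] at h1 h2
    rw [E.separated_iff hu hb, not_not] at h3
    have h5 := E.slot_eq_of_sameTrack h4
    have hd : cellOf k (p c) % 3 = 1 ∧ adj (cellOf k (p c) / 3) (slotOf k (p c) / 2) = true := by
      unfold blockSize at h1 h2
      unfold IsBorder at hb
      rw [if_neg hb] at h1 h2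
      split_ifs at h1 h2 with c1 c2 c3
      all_goals first | assumption | omega
    -- Cells in the same row differ by at most 1 on the path, and both are congruent to 1 modulo 3,
    -- so they coincide.
    have n1 := E.layout.near _ _ _ (E.cell_lt _) (E.cell_lt _) h3
    have n2 := E.layout.near _ _ _ (E.cell_lt _) (E.cell_lt _) h3.symm
    obtain ⟨d1, d2⟩ := hd
    rwa [show cellOf k (p c) / 3 = u by omega, show slotOf k (p c) / 2 = w by omega] at d2
  · intro h
    have hne : (u : ℕ) ≠ w := fun h' => by rw [h', hadj] at h; cases h
    obtain ⟨c, c1, c2, c3⟩ := E.exists_point (s := 2 * w + 1) (t := 3 * u + 1) (by omega)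
      (by have := E.le; omega) (blockSize_pos n adj _ _)
    have hb : ¬ IsBorder n k (p c) := by unfold IsBorder; omega
    have hz : blockSize n adj (3 * u + 1) (2 * w + 1) = 2 := by
      unfold blockSize
      rw [if_neg (by omega), if_neg (by omega), if_neg (by omega), if_pos]
      rw [show (3 * (u : ℕ) + 1) / 3 = u by omega, show (2 * (w : ℕ) + 1) / 2 = w by omega]
      exact ⟨by omega, h⟩
    refine ⟨c, ?_, ?_, ?_, E.sameTrack (by omega) (by omega)⟩
    · rw [E.blockGT_iff hb, c1, c2, hz]; omega
    · rw [E.blockGT_iff hb, c1, c2, hz]; omega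
    · rw [E.separated_iff hu hb, c2, u2, not_not]

end IsEncoding

/-! ### Permutations from lists of points -/

/-- The elements of `l`, sorted by the key `X`, which takes values below `K`. -/
def sortByKey (K : ℕ) (X : ℕ → ℕ) (l : List ℕ) : List ℕ :=
  (List.range K).flatMap fun x => l.filter fun u => decide (X u = x)

/-- The number of elements of `l` with smaller key. -/
def rankByKey (Y : ℕ → ℕ) (l : List ℕ) (u : ℕ) : ℕ :=
  (l.filter fun w => decide (Y w < Y u)).length

theorem mem_sortByKey {K : ℕ} {X : ℕ → ℕ} {l : List ℕ} (hX : ∀ u ∈ l, X u < K) {u : ℕ} :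
    u ∈ sortByKey K X l ↔ u ∈ l := by
  simp only [sortByKey, List.mem_flatMap, List.mem_range, List.mem_filter, decide_eq_true_eq]
  exact ⟨fun ⟨_, _, h, _⟩ => h, fun h => ⟨X u, hX u h, h, rfl⟩⟩

theorem pairwise_sortByKey {K : ℕ} {X : ℕ → ℕ} {l : List ℕ} (hl : l.Nodup)
    (hinj : ∀ u ∈ l, ∀ w ∈ l, X u = X w → u = w) :
    (sortByKey K X l).Pairwise fun u w => X u < X w := by
  rw [sortByKey, List.pairwise_flatMap]
  refine ⟨fun x _ => ?_, ?_⟩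
  · refine (hl.filter _).imp_of_mem fun {u w} hu hw hne => ?_
    simp only [List.mem_filter, decide_eq_true_eq] at hu hw
    exact absurd (hinj u hu.1 w hw.1 (hu.2.trans hw.2.symm)) hne
  · refine List.pairwise_lt_range.imp fun {x y} hxy u hu w hw => ?_
    simp only [List.mem_filter, decide_eq_true_eq] at hu hw
    omega

/-- Positions are ranks with respect to `X`, and values are ranks with respect to `Y`. The last
clause gives the values in the form in which they are computed. -/
theorem exists_perm_of_keys {K : ℕ} {X Y : ℕ → ℕ} {l : List ℕ} (hl : l.Nodup)
    (hX : ∀ u ∈ l, X u < K) (hXinj : ∀ u ∈ l, ∀ w ∈ l, X u = X w → u = w)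
    (hYinj : ∀ u ∈ l, ∀ w ∈ l, Y u = Y w → u = w) :
    ∃ (π : Permutation) (p : Fin π.1 → ℕ), π.1 = l.length ∧ Function.Injective p ∧
      (∀ u, (∃ a, p a = u) ↔ u ∈ l) ∧ (∀ a b, a < b ↔ X (p a) < X (p b)) ∧
      (∀ a b, π.2 a < π.2 b ↔ Y (p a) < Y (p b)) ∧
      List.ofFn (fun a => (π.2 a : ℕ)) = (sortByKey K X l).map (rankByKey Y l) := by
  have hpw := pairwise_sortByKey (K := K) hl hXinj
  have hmem := fun u => mem_sortByKey hX (u := u)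
  obtain ⟨L, hL⟩ : ∃ L, L = sortByKey K X l := ⟨_, rfl⟩
  rw [← hL] at hpw ⊢
  simp only [← hL] at hmem
  have hnd : L.Nodup := hpw.imp fun {u w} h => by rintro rfl; exact lt_irrefl _ h
  have hlen : L.length = l.length := ((List.perm_ext_iff_of_nodup hnd hl).2 hmem).length_eq
  have hpl (a : Fin L.length) : L[a] ∈ l := (hmem _).1 (List.getElem_mem _)
  have hlt (a b : Fin L.length) : a < b ↔ X L[a] < X L[b] := by
    have h1 : ∀ a b : Fin L.length, a < b → X L[a] < X L[b] := fun a b h =>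
      List.pairwise_iff_getElem.1 hpw _ _ a.2 b.2 h
    rcases lt_trichotomy a b with h | rfl | h
    · exact iff_of_true h (h1 a b h)
    · simp
    · exact iff_of_false h.asymm (h1 b a h).asymm
  have hrank : ∀ u ∈ l, rankByKey Y l u < L.length := by
    intro u hu
    rw [hlen, rankByKey]
    refine lt_of_le_of_ne (List.length_filter_le _ _) fun h => ?_
    have := List.length_filter_eq_length_iff.1 h u hu
    simp at this
  have hmono : ∀ u ∈ l, ∀ w ∈ l, Y u < Y w → rankByKey Y l u < rankByKey Y l w := by
    intro u hu w hw h
    have h1 : ∀ m : List ℕ, u ∈ m → (m.filter fun x => decide (Y x < Y u)).length <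
        (m.filter fun x => decide (Y x < Y w)).length := by
      intro m
      have h2 : ∀ m : List ℕ, (m.filter fun x => decide (Y x < Y u)).length ≤
          (m.filter fun x => decide (Y x < Y w)).length := by
        intro m
        rw [← List.countP_eq_length_filter, ← List.countP_eq_length_filter]
        exact List.countP_mono_left fun x _ hx => by
          simp only [decide_eq_true_eq] at hx ⊢; omega
      induction m with
      | nil => simp
      | cons x m ih =>
        intro hx
        rcases List.mem_cons.1 hx with rfl | hx
        · rw [List.filter_cons_of_neg (by simp), List.filter_cons_of_pos (by simpa using h),
            List.length_cons]
          exact Nat.lt_succ_of_le (h2 m)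
        · have := ih hx
          by_cases h3 : Y x < Y u
          · rw [List.filter_cons_of_pos (by simpa using h3), List.filter_cons_of_pos
              (by simpa using h3.trans h), List.length_cons, List.length_cons]
            omega
          · rw [List.filter_cons_of_neg (by simpa using h3), List.filter_cons]
            split_ifs <;> (try rw [List.length_cons]) <;> omega
    exact h1 l hu
  have hYlt : ∀ u ∈ l, ∀ w ∈ l, rankByKey Y l u < rankByKey Y l w ↔ Y u < Y w := by
    intro u hu w hw
    rcases lt_trichotomy (Y u) (Y w) with h | h | h
    · exact iff_of_true (hmono u hu w hw h) h
    · rw [hYinj u hu w hw h]; simp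
    · exact iff_of_false (hmono w hw u hu h).asymm h.asymm
  let f : Fin L.length → Fin L.length := fun a => ⟨rankByKey Y l L[a], hrank _ (hpl a)⟩
  have hinj : Function.Injective (fun a : Fin L.length => L[a]) := fun a b h => by
    by_contra hne
    rcases lt_or_gt_of_ne hne with h' | h'
    · exact ((hlt a b).1 h').ne (congrArg X h)
    · exact ((hlt b a).1 h').ne' (congrArg X h)
  have hf : Function.Injective f := by
    intro a b h
    apply hinj
    apply hYinj _ (hpl a) _ (hpl b)
    have h' : rankByKey Y l L[a] = rankByKey Y l L[b] := congrArg Fin.val h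
    have h1 := hYlt _ (hpl a) _ (hpl b)
    have h2 := hYlt _ (hpl b) _ (hpl a)
    omega
  refine ⟨⟨L.length, Equiv.ofBijective f (Finite.injective_iff_bijective.1 hf)⟩, fun a => L[a], hlen,
    hinj, fun u => ?_, hlt, fun a b => hYlt _ (hpl a) _ (hpl b), ?_⟩
  · rw [← hmem u, List.mem_iff_getElem]
    exact ⟨fun ⟨a, h⟩ => ⟨a, a.2, h⟩, fun ⟨a, ha, h⟩ => ⟨⟨a, ha⟩, h⟩⟩
  · apply List.ext_getElem
    · simp
    · intro i h1 h2
      simp [f]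

/-! ### Griddings -/

/-- A monotone function on `Fin N` takes values below `i` exactly on an initial segment. -/
theorem lt_card_filter_iff {N : ℕ} {f : Fin N → ℕ} (hf : Monotone f) (i : ℕ) (a : Fin N) :
    (a : ℕ) < (Finset.univ.filter fun b => f b < i).card ↔ f a < i := by
  constructor
  · intro h
    by_contra! hi
    have : (Finset.univ.filter fun b => f b < i) ⊆ Finset.Iio a := by
      intro b hb
      rw [Finset.mem_filter] at hb
      rw [Finset.mem_Iio]
      by_contra! hab
      have := hf hab
      omega
    have := Finset.card_le_card this
    rw [Fin.card_Iio] at this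
    omega
  · intro h
    have : Finset.Iic a ⊆ (Finset.univ.filter fun b => f b < i) := by
      intro b hb
      rw [Finset.mem_Iic] at hb
      have := hf hb
      simp only [Finset.mem_filter, Finset.mem_univ, true_and]
      omega
    have := Finset.card_le_card this
    rw [Fin.card_Iic] at this
    omega

/-- A permutation whose points are assigned to columns and rows belongs to the grid class, if the
points of each cell are monotone as required. -/
theorem mem_grid_of_lines {M : GriddingMatrix} {π : Permutation} (f g : Fin π.1 → ℕ)
    (hf : Monotone f) (hg : Monotone (g ∘ π.2.symm)) (hfM : ∀ a, f a < M.cols)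
    (hgM : ∀ a, g a < M.rows)
    (h : ∀ i j, (M.entry i j).Allows π {a | f a = i ∧ g a = j}) : π ∈ M.Grid := by
  -- The dividing line before a column is the number of points in earlier columns. By monotonicity
  -- these points form an initial segment. Rows are treated in the same way, with values in place of
  -- positions.
  refine ⟨fun i => (Finset.univ.filter fun b => f b < i).card,
    fun j => (Finset.univ.filter fun b => (g ∘ π.2.symm) b < j).card,
    ?_, ?_, ?_, ?_, ?_, ?_, fun i j => ?_⟩
  · exact fun i j hij => Finset.card_le_card fun b hb => by
      have : (i : ℕ) ≤ j := hij
      simp only [Finset.mem_filter, Finset.mem_univ, true_and] at hb ⊢; omega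
  · simp
  · simp [hfM]
  · exact fun i j hij => Finset.card_le_card fun b hb => by
      have : (i : ℕ) ≤ j := hij
      simp only [Finset.mem_filter, Finset.mem_univ, true_and] at hb ⊢; omega
  · simp
  · simp [hgM]
  · convert h i j using 1
    ext a
    simp only [GriddingMatrix.cell, Set.mem_ofPred_eq]
    have h1 := lt_card_filter_iff hf i.castSucc a
    have h2 := lt_card_filter_iff hf i.succ a
    have h3 := lt_card_filter_iff hg j.castSucc (π.2 a)
    have h4 := lt_card_filter_iff hg j.succ (π.2 a)
    simp only [Fin.val_castSucc, Fin.val_succ, Function.comp_apply, Equiv.symm_apply_apply] at *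
    omega

/-! ### The encoding permutation -/

/-- The position of a point on a line of index `l`, the points being below `W`. -/
def pointKey (W l : ℕ) (b : Bool) (u : ℕ) : ℕ := l * W + if b then u else W - 1 - u

/-- Each line owns an interval of length `W` of keys, traversed forwards or backwards; hence the
direction must depend only on the line. -/
theorem pointKey_lt_iff {W l l' u u' : ℕ} {b b' : Bool} (hu : u < W) (hu' : u' < W)
    (hb : l = l' → b = b') : pointKey W l b u < pointKey W l' b' u' ↔
      l < l' ∨ l = l' ∧ (if b = true then u < u' else u' < u) := by
  have hlt : ∀ {l l' u u' : ℕ} (b b' : Bool), u < W → l < l' →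
      pointKey W l b u < pointKey W l' b' u' := by
    intro l l' u u' b b' hu h
    have : (l + 1) * W ≤ l' * W := Nat.mul_le_mul_right _ h
    rw [add_mul, one_mul] at this
    unfold pointKey
    have h2 : (if b = true then u else W - 1 - u) < W := by split_ifs <;> omega
    omega
  rcases lt_trichotomy l l' with h | rfl | h
  · exact iff_of_true (hlt b b' hu h) (.inl h)
  · rw [← hb rfl]
    unfold pointKey
    split_ifs <;> omega
  · exact iff_of_false (hlt b' b hu' h).asymm (by omega)

/-- An upper bound for the points. -/
def pointBound (n k : ℕ) : ℕ := 5 * k * (2 * n + 1)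

theorem IsPoint.lt {n k u : ℕ} {adj : ℕ → ℕ → Bool} (hk : 0 < k) (h : IsPoint n k adj u) :
    u < pointBound n k := by
  have h1 := h.1
  unfold slotOf at h1
  unfold pointBound
  by_contra! hu
  have : k * (2 * n + 1) ≤ u / 5 := by
    rw [Nat.le_div_iff_mul_le (by omega)]
    linarith
  have : 2 * n + 1 ≤ u / 5 / k := by
    rw [Nat.le_div_iff_mul_le hk]
    linarith
  omega

/-- The list of all points. -/
def pointList (n k : ℕ) (adj : ℕ → ℕ → Bool) : List ℕ :=
  (List.range (pointBound n k)).filter fun u => decide (IsPoint n k adj u)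

/-- The values of the encoding permutation. -/
def permValues (n k K : ℕ) (adj : ℕ → ℕ → Bool) (line : OrderSymbol → ℕ → ℕ)
    (sign : OrderSymbol → ℕ → Bool) : List ℕ :=
  (sortByKey K (fun u => pointKey (pointBound n k) (line .lt₁ (cellOf k u)) (sign .lt₁ (cellOf k u)) u)
    (pointList n k adj)).map
      (rankByKey (fun u => pointKey (pointBound n k) (line .lt₂ (cellOf k u)) (sign .lt₂ (cellOf k u)) u)
    (pointList n k adj))

/-- The path of cells of a gridding matrix, with directions for the columns and the rows. -/
structure IsLayoutOf (M : GriddingMatrix) (k : ℕ) (line : OrderSymbol → ℕ → ℕ)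
    (sign : OrderSymbol → ℕ → Bool) : Prop extends IsPathLayout k line sign where
  exists_entry : ∀ t < k, ∃ (i : Fin M.cols) (j : Fin M.rows), line .lt₁ t = i ∧ line .lt₂ t = j ∧
    M.entry i j = if sign .lt₁ t = sign .lt₂ t then .increasing else .decreasing

/-- Both orders of the points of one cell come from their numbering, up to reversal. So the cell is
increasing or decreasing according to whether the directions of its column and its row agree, which
is how the entry is described in `IsLayoutOf`. -/
theorem exists_encoding {M : GriddingMatrix} {n k : ℕ} {adj : ℕ → ℕ → Bool}
    {line : OrderSymbol → ℕ → ℕ} {sign : OrderSymbol → ℕ → Bool} (hM : IsLayoutOf M k line sign)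
    (hk : 3 * n + 2 ≤ k) :
    ∃ (π : Permutation) (p : Fin π.1 → ℕ), π ∈ M.Grid ∧ π.1 ≤ pointBound n k ∧
      List.ofFn (fun a => (π.2 a : ℕ)) =
        permValues n k (M.cols * pointBound n k) adj line sign ∧
      IsEncoding (fun | .lt₁ => fun i j : Fin π.1 => i < j | .lt₂ => fun i j => π.2 i < π.2 j)
        n k adj line sign p := by
  have hk0 : 0 < k := by omega
  have hmem : ∀ u, u ∈ pointList n k adj ↔ IsPoint n k adj u := by
    intro u
    simp only [pointList, List.mem_filter, List.mem_range, decide_eq_true_eq, and_iff_right_iff_imp]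
    exact IsPoint.lt hk0
  have hcell : ∀ u, cellOf k u < k := fun u => Nat.mod_lt _ hk0
  have hlt : ∀ r, ∀ u ∈ pointList n k adj, ∀ w ∈ pointList n k adj,
      pointKey (pointBound n k) (line r (cellOf k u)) (sign r (cellOf k u)) u <
        pointKey (pointBound n k) (line r (cellOf k w)) (sign r (cellOf k w)) w ↔ _ :=
    fun r u hu w hw => pointKey_lt_iff (((hmem u).1 hu).lt hk0) (((hmem w).1 hw).lt hk0)
      (hM.sign_eq r _ _ (hcell u) (hcell w))
  have hinj : ∀ r, ∀ u ∈ pointList n k adj, ∀ w ∈ pointList n k adj,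
      pointKey (pointBound n k) (line r (cellOf k u)) (sign r (cellOf k u)) u =
        pointKey (pointBound n k) (line r (cellOf k w)) (sign r (cellOf k w)) w → u = w := by
    intro r u hu w hw h
    have h1 := hlt r u hu w hw
    have h2 := hlt r w hw u hu
    rw [h] at h1 h2
    simp only [lt_irrefl, false_iff] at h1 h2
    have h3 : line r (cellOf k u) = line r (cellOf k w) := by omega
    rw [← hM.sign_eq r _ _ (hcell u) (hcell w) h3] at h2
    split_ifs at h1 h2 <;> omega
  have hcol : ∀ t < k, line .lt₁ t < M.cols ∧ line .lt₂ t < M.rows := by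
    intro t ht
    obtain ⟨i, j, h1, h2, -⟩ := hM.exists_entry t ht
    rw [h1, h2]
    exact ⟨i.2, j.2⟩
  obtain ⟨π, p, hπ, hp, hrange, hX, hY, hlist⟩ := exists_perm_of_keys
    (K := M.cols * pointBound n k) (List.nodup_range.filter _ : (pointList n k adj).Nodup)
    (fun u hu => by
      have h1 := (hcol _ (hcell u)).1
      have h2 := ((hmem u).1 hu).lt hk0
      have h3 : (line .lt₁ (cellOf k u) + 1) * pointBound n k ≤ M.cols * pointBound n k :=
        Nat.mul_le_mul_right _ h1
      rw [add_mul, one_mul] at h3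
      simp only [pointKey]
      split_ifs <;> omega) (hinj .lt₁) (hinj .lt₂)
  have hpm : ∀ a, p a ∈ pointList n k adj := fun a => (hrange _).1 ⟨a, rfl⟩
  simp only [hlt .lt₁ _ (hpm _) _ (hpm _)] at hX
  simp only [hlt .lt₂ _ (hpm _) _ (hpm _)] at hY
  refine ⟨π, p, ?_, ?_, hlist, ?_⟩
  · refine mem_grid_of_lines (fun a => line .lt₁ (cellOf k (p a)))
      (fun a => line .lt₂ (cellOf k (p a))) ?_ ?_ (fun a => (hcol _ (hcell _)).1)
      (fun a => (hcol _ (hcell _)).2) fun i j => ?_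
    · intro a b hab
      rcases hab.eq_or_lt with rfl | hab
      · exact le_rfl
      · have := (hX a b).1 hab
        simp only
        omega
    · intro a b hab
      rcases hab.eq_or_lt with rfl | hab
      · exact le_rfl
      · have := (hY (π.2.symm a) (π.2.symm b)).1 (by simpa using hab)
        simp only [Function.comp_apply]
        omega
    · have hent : ∀ a, line .lt₁ (cellOf k (p a)) = i ∧ line .lt₂ (cellOf k (p a)) = j →
          M.entry i j = if sign .lt₁ (cellOf k (p a)) = sign .lt₂ (cellOf k (p a)) then .increasing
            else .decreasing := by
        rintro a ⟨h1, h2⟩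
        obtain ⟨i', j', h3, h4, h5⟩ := hM.exists_entry _ (hcell (p a))
        have e1 : i = i' := Fin.ext (by omega)
        have e2 : j = j' := Fin.ext (by omega)
        rw [e1, e2, h5]
      -- No two cells of the path have the same column and the same row, so the points in one cell
      -- of the grid belong to one cell of the path.
      have hsame : ∀ a b, line .lt₁ (cellOf k (p a)) = i ∧ line .lt₂ (cellOf k (p a)) = j →
          line .lt₁ (cellOf k (p b)) = i ∧ line .lt₂ (cellOf k (p b)) = j →
          cellOf k (p a) = cellOf k (p b) := fun a b ha hb =>
        hM.inj _ _ (hcell _) (hcell _) fun r => by cases r <;> omega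
      cases he : M.entry i j with
      | empty =>
        refine Set.eq_empty_iff_forall_notMem.2 fun a ha => ?_
        have := hent a ha
        rw [he] at this
        split_ifs at this
      | increasing =>
        intro a ha b hb hab
        have h1 := hent a ha
        have h2 := hsame a b ha hb
        rw [he] at h1
        have h3 : sign .lt₁ (cellOf k (p a)) = sign .lt₂ (cellOf k (p a)) := by
          by_contra hne; rw [if_neg hne] at h1; cases h1
        rw [hX] at hab
        rw [hY]
        simp only [← h2, lt_irrefl, false_or, true_and, h3] at hab ⊢
        exact hab
      | decreasing =>
        intro a ha b hb hab
        have h1 := hent a ha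
        have h2 := hsame a b ha hb
        rw [he] at h1
        have h3 : sign .lt₁ (cellOf k (p a)) ≠ sign .lt₂ (cellOf k (p a)) := by
          intro hne; rw [if_pos hne] at h1; cases h1
        rw [hX] at hab
        rw [hY]
        simp only [← h2, lt_irrefl, false_or, true_and] at hab ⊢
        cases h4 : sign .lt₁ (cellOf k (p a)) <;> cases h5 : sign .lt₂ (cellOf k (p a)) <;>
          rw [h4] at hab <;> first | exact absurd (h4.trans h5.symm) h3 | simpa using hab
  · rw [hπ]
    exact (List.length_filter_le _ _).trans_eq List.length_range
  · exact ⟨hM.toIsPathLayout, hk, hp, fun u => (hrange u).trans (hmem u), fun r a b => by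
      cases r
      exacts [hX a b, hY a b]⟩

/-! ### The encoding takes polynomial time -/

section

variable {α β γ σ : Type} [Enc α] [Enc β] [Enc γ] [Enc σ]

theorem PolyTime.ite {P : γ → Prop} [DecidablePred P] {f g : γ → α}
    (hP : PolyTime (fun c => decide (P c))) (hf : PolyTime f) (hg : PolyTime g) :
    PolyTime (fun c => if P c then f c else g c) := by
  simpa using hP.cond hf hg

theorem PolyTime.decideOr {P Q : γ → Prop} [DecidablePred P] [DecidablePred Q]
    (hP : PolyTime (fun c => decide (P c))) (hQ : PolyTime (fun c => decide (Q c))) :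
    PolyTime (fun c => decide (P c ∨ Q c)) := by
  simpa using hP.or hQ

theorem PolyTime.decideAnd {P Q : γ → Prop} [DecidablePred P] [DecidablePred Q]
    (hP : PolyTime (fun c => decide (P c))) (hQ : PolyTime (fun c => decide (Q c))) :
    PolyTime (fun c => decide (P c ∧ Q c)) := by
  simpa using hP.and hQ

theorem PolyTime.decideBool {f : γ → Bool} (hf : PolyTime f) :
    PolyTime (fun c => decide (f c = true)) := by
  simpa using hf

theorem PolyTime.natLe {f g : γ → ℕ} (hf : PolyTime f) (hg : PolyTime g) :
    PolyTime (fun c => decide (f c ≤ g c)) := by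
  have := hf.natLt hg.succ
  simpa only [Nat.lt_succ_iff] using this

/-- The quotient is the number of `i` with `(i + 1) * g c ≤ f c`, and all of these are below `f c`.
As numbers are in unary, this search is polynomial. -/
theorem PolyTime.div {f g : γ → ℕ} (hf : PolyTime f) (hg : PolyTime g) (h : ∀ c, 0 < g c) :
    PolyTime (fun c => f c / g c) := by
  have : PolyTime (fun c => ((List.range (f c)).filter
      fun i => decide ((i + 1) * g c ≤ f c)).length) :=
    .length (.filter (.natLe (.mul (.succ .snd) (hg.comp .fst)) (hf.comp .fst)) hf.range)
  refine cast (congrArg _ (funext fun c => ?_)) this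
  have h1 : ∀ i, decide ((i + 1) * g c ≤ f c) = decide (i < f c / g c) := fun i => by
    rw [decide_eq_decide, ← Nat.le_div_iff_mul_le (h c), Nat.succ_le_iff]
  simp only [h1]
  have h2 := Nat.div_le_self (f c) (g c)
  generalize f c / g c = q at h2 ⊢
  obtain ⟨m, hm⟩ := Nat.exists_eq_add_of_le h2
  rw [hm, List.range_add, List.filter_append, List.length_append, List.filter_eq_self.2,
    List.filter_eq_nil_iff.2]
  · simp
  · intro i hi
    simp only [List.mem_map] at hi
    obtain ⟨j, -, rfl⟩ := hi
    simp
  · intro i hi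
    simpa using hi

theorem PolyTime.mod {f g : γ → ℕ} (hf : PolyTime f) (hg : PolyTime g) (h : ∀ c, 0 < g c) :
    PolyTime (fun c => f c % g c) := by
  have := hf.sub (hg.mul (hf.div hg h))
  simpa only [← Nat.mod_eq_sub_mul_div] using this

theorem PolyTime.sortByKey {K : γ → ℕ} {X : γ → ℕ → ℕ} {l : γ → List ℕ}
    (hX : PolyTime (fun x : γ × ℕ => X x.1 x.2)) (hK : PolyTime K) (hl : PolyTime l) :
    PolyTime (fun c => PermMSO.sortByKey (K c) (X c) (l c)) :=
  .flatMap (.filter (.natEq (hX.comp (.pair (.comp .fst .fst) .snd)) (.comp .snd .fst))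
    (hl.comp .fst)) hK.range

theorem PolyTime.rankByKey {Y : γ → ℕ → ℕ} {l : γ → List ℕ} {u : γ → ℕ}
    (hY : PolyTime (fun x : γ × ℕ => Y x.1 x.2)) (hl : PolyTime l) (hu : PolyTime u) :
    PolyTime (fun c => PermMSO.rankByKey (Y c) (l c) (u c)) :=
  .length (.filter (.natLt hY (hY.comp (.pair .fst (hu.comp .fst)))) hl)

end

/-- The records of the cells of a path: column, row, and the directions of both. -/
abbrev CellRecord : Type := ℕ × ℕ × Bool × Bool

/-- The columns and rows of a list of cell records. -/
def lineOf (q : List CellRecord) : OrderSymbol → ℕ → ℕ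
  | .lt₁, t => (q.getD t (0, 0, false, false)).1
  | .lt₂, t => (q.getD t (0, 0, false, false)).2.1

/-- The directions of a list of cell records. -/
def signOf (q : List CellRecord) : OrderSymbol → ℕ → Bool
  | .lt₁, t => (q.getD t (0, 0, false, false)).2.2.1
  | .lt₂, t => (q.getD t (0, 0, false, false)).2.2.2

/-- The adjacency relation of an adjacency matrix. -/
def adjOf (g : List (List Bool)) (u w : ℕ) : Bool := (g.getD u []).getD w false

/-- The input of the construction of the permutation: an adjacency matrix, the number of columns of
the gridding matrix, and the path of cells. -/
abbrev EncodingInput : Type := List (List Bool) × ℕ × List CellRecord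

/-- The construction of the permutation. -/
def permOfInput (x : EncodingInput) : List ℕ :=
  permValues x.1.length (3 * x.1.length + 2)
    (x.2.1 * pointBound x.1.length (3 * x.1.length + 2)) (adjOf x.1) (lineOf x.2.2) (signOf x.2.2)

theorem polyTime_permOfInput : PolyTime permOfInput := by
  have hn : PolyTime (fun x : EncodingInput => x.1.length) := .length .fst
  have hk : PolyTime (fun x : EncodingInput => 3 * x.1.length + 2) :=
    .succ (.succ (.mul (.const 3) hn))
  have hW : PolyTime (fun x : EncodingInput => pointBound x.1.length (3 * x.1.length + 2)) :=
    .mul (.mul (.const 5) hk) (.succ (.mul (.const 2) hn))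
  have hk' : PolyTime (fun x : EncodingInput × ℕ => 3 * x.1.1.length + 2) := hk.comp .fst
  have hslot : PolyTime (fun x : EncodingInput × ℕ => slotOf (3 * x.1.1.length + 2) x.2) :=
    .div (.div .snd (.const 5) (fun _ => by omega)) hk' (fun _ => by omega)
  have hcell : PolyTime (fun x : EncodingInput × ℕ => cellOf (3 * x.1.1.length + 2) x.2) :=
    .mod (.div .snd (.const 5) (fun _ => by omega)) hk' (fun _ => by omega)
  have hindex : PolyTime (fun x : EncodingInput × ℕ => indexOf x.2) :=
    .mod .snd (.const 5) (fun _ => by omega)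
  have h2n : PolyTime (fun x : EncodingInput × ℕ => 2 * x.1.1.length) :=
    .mul (.const 2) (hn.comp .fst)
  have hhalf := hslot.div (.const 2) (fun _ => by omega)
  have hthird := hcell.div (.const 3) (fun _ => by omega)
  have hsize : PolyTime (fun x : EncodingInput × ℕ => blockSize x.1.1.length (adjOf x.1.1)
      (cellOf (3 * x.1.1.length + 2) x.2) (slotOf (3 * x.1.1.length + 2) x.2)) :=
    .ite (.decideOr (.natEq hslot (.const 0)) (.natEq hslot h2n)) (.const 5)
      (.ite (.natEq (.mod hslot (.const 2) fun _ => by omega) (.const 0)) (.const 4)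
        (.ite (.natEq hcell (.succ (.mul (.const 3) hhalf))) (.const 1)
          (.ite (.decideAnd (.natEq (.mod hcell (.const 3) fun _ => by omega) (.const 1))
            (.decideBool (.getD (.getD (.comp .fst .fst) hthird (.const [])) hhalf (.const false))))
            (.const 2) (.const 3))))
  have hlist : PolyTime (fun x : EncodingInput =>
      pointList x.1.length (3 * x.1.length + 2) (adjOf x.1)) :=
    .filter (.decideAnd (.natLe hslot h2n) (.natLt hindex hsize)) hW.range
  have hrec : PolyTime (fun x : EncodingInput × ℕ =>
      x.1.2.2.getD (cellOf (3 * x.1.1.length + 2) x.2) (0, 0, false, false)) :=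
    .getD (.comp .snd (.comp .snd .fst)) hcell (.const _)
  have hkey : ∀ {l : EncodingInput × ℕ → ℕ} {b : EncodingInput × ℕ → Bool}, PolyTime l →
      PolyTime b → PolyTime (fun x : EncodingInput × ℕ =>
        pointKey (pointBound x.1.1.length (3 * x.1.1.length + 2)) (l x) (b x) x.2) := by
    intro l b hl hb
    exact .add (.mul hl (hW.comp .fst))
      (.cond hb .snd (.sub (.sub (hW.comp .fst) (.const 1)) .snd))
  have h1 := hkey (PolyTime.comp .fst hrec) (.comp .fst (.comp .snd (.comp .snd hrec)))
  have h2 := hkey (PolyTime.comp .fst (.comp .snd hrec)) (.comp .snd (.comp .snd (.comp .snd hrec)))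
  have hs := PolyTime.sortByKey (X := fun (x : EncodingInput) u => pointKey (pointBound x.1.length
    (3 * x.1.length + 2)) (lineOf x.2.2 .lt₁ (cellOf (3 * x.1.length + 2) u)) (signOf x.2.2 .lt₁
      (cellOf (3 * x.1.length + 2) u)) u) h1 (.mul (.comp .fst .snd) hW) hlist
  exact .map (f := fun (x : EncodingInput) => rankByKey (fun u => pointKey (pointBound x.1.length
    (3 * x.1.length + 2)) (lineOf x.2.2 .lt₂ (cellOf (3 * x.1.length + 2) u)) (signOf x.2.2 .lt₂
      (cellOf (3 * x.1.length + 2) u)) u) (pointList x.1.length (3 * x.1.length + 2) (adjOf x.1)))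
    (.rankByKey (Y := fun (y : EncodingInput × ℕ) u => pointKey (pointBound y.1.1.length
    (3 * y.1.1.length + 2)) (lineOf y.1.2.2 .lt₂ (cellOf (3 * y.1.1.length + 2) u))
      (signOf y.1.2.2 .lt₂ (cellOf (3 * y.1.1.length + 2) u)) u)
      (h2.comp (f := fun z : (EncodingInput × ℕ) × ℕ => (z.1.1, z.2)) (.pair (.comp .fst .fst) .snd))
      (hlist.comp .fst) .snd) hs

/-! ### The path of cells of a gridding matrix -/

/-- A non-empty entry of a gridding matrix: its column, its row, and whether it is increasing. -/
abbrev CellEntry : Type := ℕ × ℕ × Bool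

/-- The column or the row of an entry. -/
def CellEntry.coord (d : Bool) (c : CellEntry) : ℕ := if d then c.1 else c.2.1

/-- `R` lists the elements of `L` along a path whose adjacent elements share a line; there are no
other common lines. -/
structure IsCellPath (L : List CellEntry) (k : ℕ) (R : ℕ → CellEntry) : Prop where
  mem_iff : ∀ c, c ∈ L ↔ ∃ t < k, R t = c
  near : ∀ d t t', t < k → t' < k → (R t).coord d = (R t').coord d → t ≤ t' + 1
  step : ∀ t, t + 1 < k → ∃ d, (R t).coord d = (R (t + 1)).coord d
  inj : ∀ t t', t < k → t' < k → (∀ d, (R t).coord d = (R t').coord d) → t = t'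
  turn : ∀ d t, t + 2 < k → (R t).coord d = (R (t + 1)).coord d →
    (R (t + 1)).coord d ≠ (R (t + 2)).coord d

namespace IsCellPath

variable {L : List CellEntry} {k : ℕ} {R : ℕ → CellEntry} (H : IsCellPath L k R)

include H

theorem reverse : IsCellPath L k fun t => R (k - 1 - t) where
  mem_iff c := by
    rw [H.mem_iff]
    constructor
    · rintro ⟨t, ht, rfl⟩
      exact ⟨k - 1 - t, by omega, by congr 1; omega⟩
    · rintro ⟨t, ht, rfl⟩
      exact ⟨k - 1 - t, by omega, rfl⟩
  near d t t' ht ht' h := by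
    have := H.near d (k - 1 - t') (k - 1 - t) (by omega) (by omega) h.symm
    omega
  step t ht := by
    obtain ⟨d, hd⟩ := H.step (k - 1 - (t + 1)) (by omega)
    rw [show k - 1 - (t + 1) + 1 = k - 1 - t by omega] at hd
    exact ⟨d, hd.symm⟩
  inj t t' ht ht' h := by
    have := H.inj (k - 1 - t) (k - 1 - t') (by omega) (by omega) h
    omega
  turn d t ht h h' := by
    refine H.turn d (k - 1 - (t + 2)) (by omega) ?_ ?_
    · rw [show k - 1 - (t + 2) + 1 = k - 1 - (t + 1) by omega]
      exact h'.symm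
    · rw [show k - 1 - (t + 2) + 1 = k - 1 - (t + 1) by omega,
        show k - 1 - (t + 2) + 2 = k - 1 - t by omega]
      exact h.symm

/-- Adjacent cells share only one line. -/
theorem eq_of_shared {d d' : Bool} {t : ℕ} (ht : t + 1 < k)
    (hd : (R t).coord d = (R (t + 1)).coord d) (hd' : (R t).coord d' = (R (t + 1)).coord d') :
    d = d' := by
  by_contra hne
  have := H.inj t (t + 1) (by omega) ht fun d'' => by
    by_cases h : d'' = d
    · rw [h, hd]
    · rw [show d'' = d' by revert hne h; cases d <;> cases d' <;> cases d'' <;> decide, hd']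
  omega

/-- The shared lines of the pairs of adjacent cells alternate. -/
theorem shared_succ {d : Bool} {t : ℕ} (ht : t + 2 < k)
    (hd : (R t).coord d = (R (t + 1)).coord d) :
    (R (t + 1)).coord (!d) = (R (t + 2)).coord (!d) := by
  obtain ⟨d', hd'⟩ := H.step (t + 1) ht
  by_cases h : d' = d
  · rw [h] at hd'
    exact absurd hd' (H.turn d t ht hd)
  · rwa [show (!d) = d' by revert h; cases d <;> cases d' <;> decide]

theorem shared_iterate {d : Bool} (hd : (R 0).coord d = (R 1).coord d) (t : ℕ) (ht : t + 1 < k) :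
    (R t).coord (Bool.not^[t] d) = (R (t + 1)).coord (Bool.not^[t] d) := by
  induction t with
  | zero => exact hd
  | succ t ih =>
    rw [Function.iterate_succ_apply']
    exact H.shared_succ ht (ih (by omega))

end IsCellPath

/-! ### The walk along the path -/

/-- `c` and `c'` share a line in the direction `d`, but no line in the other direction. -/
def linked (d : Bool) (c c' : CellEntry) : Bool :=
  decide (c.coord d = c'.coord d) && !decide (c.coord (!d) = c'.coord (!d))

/-- The cells of `L` that are linked to `c` by a line in direction `d`. -/
def linkedCells (L : List CellEntry) (d : Bool) (c : CellEntry) : List CellEntry :=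
  L.filter (linked d c)

/-- A cell is at an end of the path if it does not share both its column and its row. -/
def isEnd (L : List CellEntry) (c : CellEntry) : Bool :=
  !(L.any (linked true c) && L.any (linked false c))

/-- The record of the cell `c'`, which shares a line in direction `d` with the cell of the record
`c`. -/
def nextRecord (d : Bool) (c : CellRecord) (c' : CellEntry) : CellRecord :=
  if d then (c'.1, c'.2.1, c.2.2.1, decide (c.2.2.1 = c'.2.2))
  else (c'.1, c'.2.1, decide (c.2.2.2 = c'.2.2), c.2.2.2)

/-- Extending a path, which is stored in reverse order, by one cell. -/
def walkStep (L : List CellEntry) (st : List CellRecord × Bool) : List CellRecord × Bool :=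
  (nextRecord st.2 (st.1.headD (0, 0, false, false))
    ((linkedCells L st.2 ((st.1.headD (0, 0, false, false)).1,
      (st.1.headD (0, 0, false, false)).2.1, false)).headD (0, 0, false)) :: st.1, !st.2)

/-- The first cell of the path. -/
def startCell (L : List CellEntry) : CellEntry := (L.filter (isEnd L)).headD (0, 0, false)

/-- The record of the first cell. -/
def startRecord (c : CellEntry) : CellRecord := (c.1, c.2.1, true, c.2.2)

/-- The records of the `k` cells of the path. -/
def walk (k : ℕ) (L : List CellEntry) : List CellRecord :=
  ((walkStep L)^[k - 1]
    ([startRecord (startCell L)], L.any (linked true (startCell L)))).1.reverse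

theorem headD_eq_of_forall {α : Type} {l : List α} {a d : α} (h : ∃ b, b ∈ l)
    (hl : ∀ b ∈ l, b = a) : l.headD d = a := by
  cases l with
  | nil => simp at h
  | cons b l => exact hl b (by simp)

namespace IsCellPath

variable {L : List CellEntry} {k : ℕ} {R : ℕ → CellEntry} (H : IsCellPath L k R)

include H

/-- Cells on a common line are equal or neighbours on the path. The condition on the other direction
excludes equality and nothing else, since different cells do not share both lines. -/
theorem linked_iff {d : Bool} {t t' : ℕ} (ht : t < k) (ht' : t' < k) :
    linked d (R t) (R t') = true ↔
      (R t).coord d = (R t').coord d ∧ (t' = t + 1 ∨ t = t' + 1) := by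
  simp only [linked, Bool.and_eq_true, decide_eq_true_eq, Bool.not_eq_true', decide_eq_false_iff_not]
  refine and_congr_right fun h => ?_
  have h1 := H.near d t t' ht ht' h
  have h2 := H.near d t' t ht' ht h.symm
  constructor
  · intro h'
    have : t ≠ t' := by rintro rfl; exact h' rfl
    omega
  · intro h3 h4
    have := H.inj t t' ht ht' fun d' => by
      by_cases e : d' = d
      · rw [e, h]
      · rwa [show d' = !d by revert e; cases d <;> cases d' <;> decide]
    omega

theorem any_linked_iff {d : Bool} {t : ℕ} (ht : t < k) :
    L.any (linked d (R t)) = true ↔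
      ∃ t' < k, (R t).coord d = (R t').coord d ∧ (t' = t + 1 ∨ t = t' + 1) := by
  rw [List.any_eq_true]
  constructor
  · rintro ⟨c, hc, h⟩
    obtain ⟨t', ht', rfl⟩ := (H.mem_iff c).1 hc
    exact ⟨t', ht', (H.linked_iff ht ht').1 h⟩
  · rintro ⟨t', ht', h⟩
    exact ⟨R t', (H.mem_iff _).2 ⟨t', ht', rfl⟩, (H.linked_iff ht ht').2 h⟩

/-- An inner cell shares lines of different directions with its two neighbours. An end cell has at
most one neighbour and cannot share both lines with it. -/
theorem isEnd_iff {t : ℕ} (ht : t < k) : isEnd L (R t) = true ↔ t = 0 ∨ t = k - 1 := by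
  rw [isEnd, Bool.not_eq_true', ← Bool.not_eq_true, Bool.and_eq_true, H.any_linked_iff ht,
    H.any_linked_iff ht]
  constructor
  · intro h
    by_contra hne
    obtain ⟨s, rfl⟩ : ∃ s, t = s + 1 := ⟨t - 1, by omega⟩
    obtain ⟨d, hd⟩ := H.step s ht
    have hd' := H.shared_succ (by omega) hd
    have h1 : ∃ t' < k, (R (s + 1)).coord d = (R t').coord d ∧ (t' = s + 1 + 1 ∨ s + 1 = t' + 1) :=
      ⟨s, by omega, hd.symm, Or.inr rfl⟩
    have h2 : ∃ t' < k, (R (s + 1)).coord (!d) = (R t').coord (!d) ∧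
        (t' = s + 1 + 1 ∨ s + 1 = t' + 1) :=
      ⟨s + 2, by omega, hd', Or.inl rfl⟩
    cases d
    · exact h ⟨h2, h1⟩
    · exact h ⟨h1, h2⟩
  · rintro h ⟨⟨t₁, h₁, e₁, o₁⟩, t₂, h₂, e₂, o₂⟩
    have : t₁ = t₂ := by omega
    subst this
    have := H.inj t t₁ ht h₁ fun d => by cases d <;> assumption
    omega

/-- The path can be directed such that it begins with the cell found by the search. -/
theorem exists_start (hk : 0 < k) : ∃ R', IsCellPath L k R' ∧ R' 0 = startCell L := by
  have hmem : startCell L ∈ L.filter (isEnd L) := by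
    have h0 : R 0 ∈ L.filter (isEnd L) := by
      rw [List.mem_filter]
      exact ⟨(H.mem_iff _).2 ⟨0, hk, rfl⟩, (H.isEnd_iff hk).2 (Or.inl rfl)⟩
    unfold startCell
    cases h : L.filter (isEnd L) with
    | nil => rw [h] at h0; simp at h0
    | cons a l => simp
  rw [List.mem_filter, H.mem_iff] at hmem
  obtain ⟨⟨t, ht, e⟩, hend⟩ := hmem
  rw [← e, H.isEnd_iff ht] at hend
  rcases hend with rfl | rfl
  · exact ⟨R, H, e⟩
  · exact ⟨_, H.reverse, e⟩

/-- The cell after a given one is the only one linked to it in the right direction. -/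
theorem linkedCells_headD {d : Bool} {t : ℕ} (ht : t + 1 < k)
    (hd : (R t).coord d = (R (t + 1)).coord d) (b a : Bool) :
    (linkedCells L d ((R t).1, (R t).2.1, b)).headD (0, 0, a) = R (t + 1) := by
  change (linkedCells L d (R t)).headD (0, 0, a) = R (t + 1)
  apply headD_eq_of_forall
  · exact ⟨R (t + 1), List.mem_filter.2 ⟨(H.mem_iff _).2 ⟨t + 1, ht, rfl⟩,
      (H.linked_iff (by omega) ht).2 ⟨hd, Or.inl rfl⟩⟩⟩
  · intro c hc
    obtain ⟨hc, hl⟩ := List.mem_filter.1 hc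
    obtain ⟨t', ht', rfl⟩ := (H.mem_iff c).1 hc
    obtain ⟨hd', rfl | rfl⟩ := (H.linked_iff (by omega) ht').1 hl
    · rfl
    · exact absurd hd (H.turn d t' ht hd'.symm)

end IsCellPath

/-- The records along a path. -/
def recordAt (R : ℕ → CellEntry) (d : Bool) : ℕ → CellRecord
  | 0 => startRecord (R 0)
  | t + 1 => nextRecord (Bool.not^[t] d) (recordAt R d t) (R (t + 1))

theorem recordAt_fst (R : ℕ → CellEntry) (d : Bool) (t : ℕ) : (recordAt R d t).1 = (R t).1 := by
  cases t with
  | zero => rfl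
  | succ t => rw [recordAt, nextRecord]; split <;> rfl

theorem recordAt_snd (R : ℕ → CellEntry) (d : Bool) (t : ℕ) :
    (recordAt R d t).2.1 = (R t).2.1 := by
  cases t with
  | zero => rfl
  | succ t => rw [recordAt, nextRecord]; split <;> rfl

/-- In each new record one direction is inherited and the other is chosen to make this hold. -/
theorem recordAt_sign (R : ℕ → CellEntry) (d : Bool) (t : ℕ) :
    decide ((recordAt R d t).2.2.1 = (recordAt R d t).2.2.2) = (R t).2.2 := by
  cases t with
  | zero => simp [recordAt, startRecord]
  | succ t =>
    rw [recordAt, nextRecord]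
    split
    · generalize (recordAt R d t).2.2.1 = a, (R (t + 1)).2.2 = b
      cases a <;> cases b <;> rfl
    · generalize (recordAt R d t).2.2.2 = a, (R (t + 1)).2.2 = b
      cases a <;> cases b <;> rfl

namespace IsCellPath

variable {L : List CellEntry} {k : ℕ} {R : ℕ → CellEntry} (H : IsCellPath L k R)

include H

theorem iterate_walkStep {d : Bool} (hd : (R 0).coord d = (R 1).coord d) (t : ℕ) (ht : t < k) :
    (walkStep L)^[t] ([startRecord (R 0)], d) =
      (((List.range (t + 1)).map (recordAt R d)).reverse, Bool.not^[t] d) := by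
  induction t with
  | zero => rfl
  | succ t ih =>
    rw [Function.iterate_succ_apply', ih (by omega), List.range_succ (n := t + 1), List.map_append,
      List.reverse_append, Function.iterate_succ_apply', walkStep]
    have hh : ((List.range (t + 1)).map (recordAt R d)).reverse.headD (0, 0, false, false) =
        recordAt R d t := by
      rw [List.range_succ, List.map_append, List.reverse_append]; rfl
    rw [hh, recordAt_fst, recordAt_snd, H.linkedCells_headD ht (H.shared_iterate hd t ht)]
    rfl

/-- The walk finds the records along the path. -/
theorem walk_eq (hk : 2 ≤ k) (hR : R 0 = startCell L) :
    ∃ d, (R 0).coord d = (R 1).coord d ∧ walk k L = (List.range k).map (recordAt R d) := by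
  obtain ⟨d, hd⟩ := H.step 0 hk
  -- The first cell has only one neighbour, so whether it shares a column with any cell tells the
  -- direction of the first step.
  have hany : L.any (linked true (R 0)) = d := by
    rw [Bool.eq_iff_iff, H.any_linked_iff (by omega)]
    constructor
    · rintro ⟨t', ht', e, h⟩
      obtain rfl : t' = 1 := by omega
      exact (H.eq_of_shared (by omega) e hd).symm
    · rintro rfl
      exact ⟨1, by omega, hd, Or.inl rfl⟩
  refine ⟨d, hd, ?_⟩
  rw [walk, ← hR, hany, H.iterate_walkStep hd _ (by omega), List.reverse_reverse,
    Nat.sub_add_cancel (by omega)]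

/-- Adjacent cells share only one line, and it is the one whose direction `nextRecord` copies. -/
theorem sign_recordAt {d : Bool} (hd : (R 0).coord d = (R 1).coord d) {t : ℕ} (ht : t + 1 < k)
    {d' : Bool} (h : (R t).coord d' = (R (t + 1)).coord d') :
    (if d' then (recordAt R d t).2.2.1 else (recordAt R d t).2.2.2) =
      if d' then (recordAt R d (t + 1)).2.2.1 else (recordAt R d (t + 1)).2.2.2 := by
  have := H.eq_of_shared ht h (H.shared_iterate hd t ht)
  rw [recordAt, nextRecord, ← this]
  cases d' <;> rfl

/-- Cells on a common line are equal or adjacent on the path, so consistency of the directions along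
a line only has to be checked for successive records. -/
theorem isPathLayout_walk (hk : 2 ≤ k) :
    ∃ R', IsCellPath L k R' ∧ IsPathLayout k (lineOf (walk k L)) (signOf (walk k L)) ∧
      ∀ t < k, lineOf (walk k L) .lt₁ t = (R' t).1 ∧ lineOf (walk k L) .lt₂ t = (R' t).2.1 ∧
        decide (signOf (walk k L) .lt₁ t = signOf (walk k L) .lt₂ t) = (R' t).2.2 := by
  obtain ⟨R', H', hR'⟩ := H.exists_start (by omega)
  obtain ⟨d, hd, hw⟩ := H'.walk_eq hk hR'
  have hget : ∀ t < k, (walk k L).getD t (0, 0, false, false) = recordAt R' d t := fun t ht => by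
    rw [hw, List.getD_eq_getElem _ _ (by simpa using ht)]
    simp
  let b : OrderSymbol → Bool | .lt₁ => true | .lt₂ => false
  have hline : ∀ r t, t < k → lineOf (walk k L) r t = (R' t).coord (b r) := fun r t ht => by
    cases r
    · exact (congrArg (·.1) (hget t ht)).trans (recordAt_fst _ _ _)
    · exact (congrArg (·.2.1) (hget t ht)).trans (recordAt_snd _ _ _)
  have hsign : ∀ r t, t < k → signOf (walk k L) r t =
      if b r then (recordAt R' d t).2.2.1 else (recordAt R' d t).2.2.2 := fun r t ht => by
    cases r
    · exact congrArg (·.2.2.1) (hget t ht)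
    · exact congrArg (·.2.2.2) (hget t ht)
  refine ⟨R', H', ⟨?_, ?_, ?_, ?_⟩, fun t ht => ⟨hline .lt₁ t ht, hline .lt₂ t ht, ?_⟩⟩
  · intro r t t' ht ht' h
    rw [hline r t ht, hline r t' ht'] at h
    exact H'.near _ t t' ht ht' h
  · intro r t t' ht ht' h
    rw [hline r t ht, hline r t' ht'] at h
    rw [hsign r t ht, hsign r t' ht']
    have h1 := H'.near _ t t' ht ht' h
    have h2 := H'.near _ t' t ht' ht h.symm
    obtain rfl | rfl | rfl : t = t' ∨ t' = t + 1 ∨ t = t' + 1 := by omega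
    · rfl
    · exact H'.sign_recordAt hd ht' h
    · exact (H'.sign_recordAt hd ht h.symm).symm
  · intro t ht
    obtain ⟨d', hd'⟩ := H'.step t ht
    refine ⟨if d' then .lt₁ else .lt₂, ?_⟩
    rw [hline _ t (by omega), hline _ (t + 1) ht]
    cases d' <;> exact hd'
  · intro t t' ht ht' h
    refine H'.inj t t' ht ht' fun d' => ?_
    have := h (if d' then .lt₁ else .lt₂)
    rw [hline _ t ht, hline _ t' ht'] at this
    cases d' <;> exact this
  · rw [hsign .lt₁ t ht, hsign .lt₂ t ht]
    exact recordAt_sign R' d t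

end IsCellPath

/-! #### The cells of a gridding matrix -/

/-- The number by which the type of a cell is encoded. -/
def CellType.code : CellType → ℕ
  | .empty => 0
  | .increasing => 1
  | .decreasing => 2

/-- The columns of a gridding matrix. -/
def GriddingMatrix.toLists (M : GriddingMatrix) : List (List ℕ) :=
  List.ofFn fun i => List.ofFn fun j => (M.entry i j).code

/-- The non-empty entries of a gridding matrix that is given by its columns. -/
def cellEntries (m : List (List ℕ)) : List CellEntry :=
  (List.range m.length).flatMap fun i =>
    ((List.range (m.getD i []).length).filter fun j => !decide ((m.getD i []).getD j 0 = 0)).map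
      fun j => (i, j, decide ((m.getD i []).getD j 0 = 1))

/-- The entry of a gridding matrix at a non-empty cell. -/
def GriddingMatrix.cellEntry (M : GriddingMatrix) (c : M.NonemptyCell) : CellEntry :=
  (c.1.1, c.1.2, decide ((M.entry c.1.1 c.1.2).code = 1))

theorem mem_cellEntries_toLists {M : GriddingMatrix} {c : CellEntry} :
    c ∈ cellEntries M.toLists ↔ ∃ p, M.cellEntry p = c := by
  have hrow : ∀ i : Fin M.cols, M.toLists.getD i [] = List.ofFn fun j => (M.entry i j).code :=
    fun i => by
      rw [List.getD_eq_getElem _ _ (by simp [GriddingMatrix.toLists])]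
      simp [GriddingMatrix.toLists]
  have hentry : ∀ (i : Fin M.cols) (j : Fin M.rows),
      (List.ofFn fun j => (M.entry i j).code).getD (j : ℕ) 0 = (M.entry i j).code := fun i j => by
    rw [List.getD_eq_getElem _ _ (by simp)]
    simp
  have hcode : ∀ t : CellType, t.code = 0 ↔ t = .empty := fun t => by
    cases t <;> simp [CellType.code]
  simp only [cellEntries, List.mem_flatMap, List.mem_map, List.mem_filter, List.mem_range]
  constructor
  · rintro ⟨i, hi, j, ⟨hj, h⟩, rfl⟩
    lift i to Fin M.cols using by simpa [GriddingMatrix.toLists] using hi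
    rw [hrow i] at h hj ⊢
    lift j to Fin M.rows using by simpa using hj
    rw [hentry] at h ⊢
    exact ⟨⟨(i, j), by simpa [hcode] using h⟩, rfl⟩
  · rintro ⟨⟨⟨i, j⟩, h⟩, rfl⟩
    refine ⟨i, by simp [GriddingMatrix.toLists], j, ?_⟩
    rw [hrow i, hentry]
    exact ⟨⟨by simp, by simpa [hcode] using h⟩, rfl⟩

/-- If neighbours in a subset of a linear order are related, and no three elements are related
consecutively, then any two elements are related. -/
theorem rel_of_neighbours {m : ℕ} {P : Fin m → Prop} {A : Fin m → Fin m → Prop}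
    (hA : ∀ i j, i < j → P i → P j → (∀ l, i < l → l < j → ¬ P l) → A i j)
    (htri : ∀ i j l, i < j → j < l → P i → P j → P l → A i j → ¬ A j l)
    {i j : Fin m} (hij : i < j) (hi : P i) (hj : P j) : A i j := by
  have hnext : ∀ i j : Fin m, i < j → P j →
      ∃ l, i < l ∧ l ≤ j ∧ P l ∧ ∀ x, i < x → x < l → ¬ P x := fun i j hij hj => by
    obtain ⟨l, hl, hmin⟩ := WellFounded.has_min (wellFounded_lt (α := Fin m))
      {l | i < l ∧ P l} ⟨j, hij, hj⟩
    exact ⟨l, hl.1, not_lt.1 (hmin j ⟨hij, hj⟩), hl.2, fun x h1 h2 h3 => hmin x ⟨h1, h3⟩ h2⟩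
  obtain ⟨l, h1, h2, h3, h4⟩ := hnext i j hij hj
  rcases h2.lt_or_eq with h2 | rfl
  · obtain ⟨l', h1', h2', h3', h4'⟩ := hnext l j h2 hj
    exact absurd (hA l l' h1' h3 h3' h4') (htri i l l' h1 h1' hi h3 h3' (hA i l h1 hi h3 h4))
  · exact hA i l h1 hi h3 h4

namespace GriddingMatrix

variable {M : GriddingMatrix} {k : ℕ} (e : SimpleGraph.pathGraph k ≃g M.cellGraph)

/-- Cells of the path on a common line are adjacent. -/
theorem le_succ_of_line {m : ℕ} {f : Fin m → Fin M.cols × Fin M.rows} (hf : Function.Injective f)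
    (hadj : ∀ (i j : Fin m) (p q : M.NonemptyCell), i < j → p.1 = f i → q.1 = f j →
      (∀ l, i < l → l < j → M.entry (f l).1 (f l).2 = .empty) → M.cellGraph.Adj p q)
    (hturn : ∀ (a b c : Fin k) (i j l : Fin m), (a : ℕ) + 1 = b → (b : ℕ) + 1 = c →
      (e a).1 = f i → (e b).1 = f j → (e c).1 ≠ f l)
    {a b : Fin k} {i j : Fin m} (ha : (e a).1 = f i) (hb : (e b).1 = f j) : (a : ℕ) ≤ b + 1 := by
  have key : ∀ i j : Fin m, i < j → ∀ a b, (e a).1 = f i → (e b).1 = f j →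
      (a : ℕ) + 1 = b ∨ (b : ℕ) + 1 = a := by
    intro i j hij a b ha hb
    refine rel_of_neighbours (P := fun i => ∃ a, (e a).1 = f i)
      (A := fun i j => ∀ a b, (e a).1 = f i → (e b).1 = f j → (a : ℕ) + 1 = b ∨ (b : ℕ) + 1 = a)
      ?_ ?_ hij ⟨a, ha⟩ ⟨b, hb⟩ a b ha hb
    · intro i j hij _ _ hl a b ha hb
      have := hadj i j (e a) (e b) hij ha hb fun l h1 h2 => by
        by_contra hne
        exact hl l h1 h2 ⟨e.symm ⟨f l, hne⟩, by simp⟩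
      rwa [e.map_adj_iff, SimpleGraph.pathGraph_adj] at this
    -- If `b` is next to both `a` and `c` on the path, then `a`, `b`, `c` are consecutive there in
    -- one of the two directions, and three consecutive cells on one line are forbidden.
    · rintro i j l hij hjl ⟨a, ha⟩ ⟨b, hb⟩ ⟨c, hc⟩ h h'
      have hac : a ≠ c := by
        rintro rfl
        exact (hij.trans hjl).ne (hf (ha.symm.trans hc))
      have hac' : (a : ℕ) ≠ c := fun h => hac (Fin.ext h)
      rcases h a b ha hb with h1 | h1 <;> rcases h' b c hb hc with h2 | h2
      · exact hturn a b c i j l h1 h2 ha hb hc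
      · omega
      · omega
      · exact hturn c b a l j i h2 h1 hc hb ha
  rcases lt_trichotomy i j with h | rfl | h
  · have := key i j h a b ha hb
    omega
  · have : a = b := e.injective (Subtype.ext (ha.trans hb.symm))
    subst this
    omega
  · have := key j i h b a hb ha
    omega

/-- The cells of a gridding matrix along a path. -/
def entryAt (t : ℕ) : CellEntry :=
  if h : t < k then M.cellEntry (e ⟨t, h⟩) else (0, 0, false)

/-- The cell graph only joins cells without non-empty cells between them. That arbitrary cells of a
line are close on the path follows because the turning condition leaves room for at most two cells
on a line (`le_succ_of_line`). -/
theorem isCellPath (hturn : ∀ a b c : Fin k, (a : ℕ) + 1 = b → (b : ℕ) + 1 = c →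
      ¬ ((e a).1.1 = (e b).1.1 ∧ (e b).1.1 = (e c).1.1) ∧
      ¬ ((e a).1.2 = (e b).1.2 ∧ (e b).1.2 = (e c).1.2)) :
    IsCellPath (cellEntries M.toLists) k (entryAt e) := by
  have hcoord : ∀ d t (ht : t < k) t' (ht' : t' < k),
      ((entryAt e t).coord d = (entryAt e t').coord d ↔
        if d then (e ⟨t, ht⟩).1.1 = (e ⟨t', ht'⟩).1.1 else (e ⟨t, ht⟩).1.2 = (e ⟨t', ht'⟩).1.2) := by
    intro d t ht t' ht'
    rw [entryAt, entryAt, dif_pos ht, dif_pos ht']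
    cases d <;> simp [CellEntry.coord, cellEntry, Fin.ext_iff]
  refine ⟨fun c => ?_, ?_, ?_, ?_, ?_⟩
  · rw [mem_cellEntries_toLists]
    constructor
    · rintro ⟨p, rfl⟩
      exact ⟨e.symm p, (e.symm p).2, by simp [entryAt]⟩
    · rintro ⟨t, ht, rfl⟩
      exact ⟨e ⟨t, ht⟩, by rw [entryAt, dif_pos ht]⟩
  · intro d t t' ht ht' h
    rw [hcoord d t ht t' ht'] at h
    cases d with
    | true =>
      refine le_succ_of_line e (f := fun j => ((e ⟨t, ht⟩).1.1, j)) (i := (e ⟨t, ht⟩).1.2)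
        (j := (e ⟨t', ht'⟩).1.2) (a := ⟨t, ht⟩) (b := ⟨t', ht'⟩) (fun i j h => (Prod.ext_iff.1 h).2)
        ?_ ?_ rfl (Prod.ext (by simpa using h.symm) rfl)
      · rintro i j ⟨p, hp⟩ ⟨q, hq⟩ hij rfl rfl hl
        refine ⟨fun h => hij.ne (Prod.ext_iff.1 (Subtype.ext_iff.1 h)).2, Or.inl ⟨rfl, ?_⟩⟩
        simpa [min_eq_left hij.le, max_eq_right hij.le] using hl
      · intro a b c i j l h1 h2 ha hb hc
        refine (hturn a b c h1 h2).1 ?_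
        rw [ha, hb, hc]
        exact ⟨rfl, rfl⟩
    | false =>
      refine le_succ_of_line e (f := fun j => (j, (e ⟨t, ht⟩).1.2)) (i := (e ⟨t, ht⟩).1.1)
        (j := (e ⟨t', ht'⟩).1.1) (a := ⟨t, ht⟩) (b := ⟨t', ht'⟩) (fun i j h => (Prod.ext_iff.1 h).1)
        ?_ ?_ rfl (Prod.ext rfl (by simpa using h.symm))
      · rintro i j ⟨p, hp⟩ ⟨q, hq⟩ hij rfl rfl hl
        refine ⟨fun h => hij.ne (Prod.ext_iff.1 (Subtype.ext_iff.1 h)).1, Or.inr ⟨rfl, ?_⟩⟩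
        simpa [min_eq_left hij.le, max_eq_right hij.le] using hl
      · intro a b c i j l h1 h2 ha hb hc
        refine (hturn a b c h1 h2).2 ?_
        rw [ha, hb, hc]
        exact ⟨rfl, rfl⟩
  · intro t ht
    have hadj : M.cellGraph.Adj (e ⟨t, by omega⟩) (e ⟨t + 1, ht⟩) := by
      rw [e.map_adj_iff, SimpleGraph.pathGraph_adj]
      exact Or.inl rfl
    rcases hadj.2 with h | h
    · exact ⟨true, (hcoord true t (by omega) (t + 1) ht).2 h.1⟩
    · exact ⟨false, (hcoord false t (by omega) (t + 1) ht).2 h.1⟩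
  · intro t t' ht ht' h
    have h1 := (hcoord true t ht t' ht').1 (h true)
    have h2 := (hcoord false t ht t' ht').1 (h false)
    have := e.injective (Subtype.ext (Prod.ext h1 h2))
    simpa using this
  · intro d t ht h h'
    rw [hcoord d t (by omega) (t + 1) (by omega)] at h
    rw [hcoord d (t + 1) (by omega) (t + 2) ht] at h'
    have := hturn ⟨t, by omega⟩ ⟨t + 1, by omega⟩ ⟨t + 2, ht⟩ rfl rfl
    cases d
    · exact this.2 ⟨h, h'⟩
    · exact this.1 ⟨h, h'⟩

/-- The walk along the cells of a gridding matrix is a layout. -/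
theorem IsTurningPath.isLayoutOf_walk (h : M.IsTurningPath k) (hk : 2 ≤ k) :
    IsLayoutOf M k (lineOf (walk k (cellEntries M.toLists)))
      (signOf (walk k (cellEntries M.toLists))) := by
  obtain ⟨e, hturn⟩ := h
  obtain ⟨R, hR, hlay, hent⟩ := (isCellPath e hturn).isPathLayout_walk hk
  refine ⟨hlay, fun t ht => ?_⟩
  obtain ⟨p, hp⟩ := mem_cellEntries_toLists.1 ((hR.mem_iff _).2 ⟨t, ht, rfl⟩)
  obtain ⟨h1, h2, h3⟩ := hent t ht
  rw [← hp] at h1 h2 h3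
  refine ⟨p.1.1, p.1.2, h1, h2, ?_⟩
  obtain ⟨p, hne⟩ := p
  simp only [cellEntry, decide_eq_decide] at h3
  simp only [h3]
  cases h : M.entry p.1 p.2 with
  | empty => exact absurd h hne
  | increasing => simp [CellType.code]
  | decreasing => simp [CellType.code]

end GriddingMatrix

/-! #### The walk takes polynomial time -/

section

variable {γ : Type} [Enc γ]

theorem polyTime_cellEntries : PolyTime cellEntries := by
  have hrow : PolyTime (fun x : List (List ℕ) × ℕ => x.1.getD x.2 []) := .getD .fst .snd (.const [])
  have hent : PolyTime (fun x : (List (List ℕ) × ℕ) × ℕ => (x.1.1.getD x.1.2 []).getD x.2 0) :=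
    .getD (hrow.comp .fst) .snd (.const 0)
  exact .flatMap (.map (f := fun (x : List (List ℕ) × ℕ) j =>
      (x.2, j, decide ((x.1.getD x.2 []).getD j 0 = 1)))
    (.pair (.comp .snd .fst) (.pair .snd (.natEq hent (.const 1))))
    (.filter (f := fun (x : List (List ℕ) × ℕ) j => !decide ((x.1.getD x.2 []).getD j 0 = 0))
      (.not (.natEq hent (.const 0))) hrow.length.range)) (PolyTime.length .id).range

theorem PolyTime.coord {d : γ → Bool} {c : γ → CellEntry} (hd : PolyTime d) (hc : PolyTime c) :
    PolyTime (fun x => (c x).coord (d x)) :=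
  .cond hd (.comp .fst hc) (.comp .fst (.comp .snd hc))

theorem PolyTime.linked {d : γ → Bool} {c c' : γ → CellEntry} (hd : PolyTime d)
    (hc : PolyTime c) (hc' : PolyTime c') : PolyTime (fun x => PermMSO.linked (d x) (c x) (c' x)) :=
  .and (.natEq (.coord hd hc) (.coord hd hc')) (.not (.natEq (.coord hd.not hc) (.coord hd.not hc')))

theorem PolyTime.linkedCells {L : γ → List CellEntry} {d : γ → Bool} {c : γ → CellEntry}
    (hL : PolyTime L) (hd : PolyTime d) (hc : PolyTime c) :
    PolyTime (fun x => PermMSO.linkedCells (L x) (d x) (c x)) :=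
  .filter (.linked (hd.comp .fst) (hc.comp .fst) .snd) hL

theorem polyTime_startCell : PolyTime startCell := by
  have hany : ∀ d, PolyTime (fun x : List CellEntry × CellEntry => x.1.any (linked d x.2)) :=
    fun d => .any (.linked (.const d) (.comp .snd .fst) .snd) .fst
  exact .headD (.filter (.not (.and (hany true) (hany false))) .id) (.const _)

theorem PolyTime.boolEq {f g : γ → Bool} (hf : PolyTime f) (hg : PolyTime g) :
    PolyTime (fun c => decide (f c = g c)) := by
  refine cast (congrArg _ (funext fun c => ?_)) (PolyTime.cond hf hg hg.not)
  cases f c <;> cases g c <;> rfl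

theorem PolyTime.nextRecord {d : γ → Bool} {c : γ → CellRecord} {c' : γ → CellEntry}
    (hd : PolyTime d) (hc : PolyTime c) (hc' : PolyTime c') :
    PolyTime (fun x => PermMSO.nextRecord (d x) (c x) (c' x)) := by
  have h1 : PolyTime fun x => (c x).2.2.1 := .comp .fst (.comp .snd (.comp .snd hc))
  have h2 : PolyTime fun x => (c x).2.2.2 := .comp .snd (.comp .snd (.comp .snd hc))
  have h3 : PolyTime fun x => (c' x).2.2 := .comp .snd (.comp .snd hc')
  exact .cond hd
    (.pair (.comp .fst hc') (.pair (.comp .fst (.comp .snd hc')) (.pair h1 (.boolEq h1 h3))))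
    (.pair (.comp .fst hc') (.pair (.comp .fst (.comp .snd hc')) (.pair (.boolEq h2 h3) h2)))

theorem esize_bool_le (b : Bool) : esize b ≤ 3 := by
  cases b <;> decide

/-- Only the directions are carried over from the old record, so sizes do not accumulate along the
walk. -/
theorem esize_nextRecord_le (d : Bool) (c : CellRecord) (c' : CellEntry) :
    esize (nextRecord d c c') ≤ esize c' + 10 := by
  obtain ⟨i, j, s, s'⟩ := c
  obtain ⟨i', j', b⟩ := c'
  rw [nextRecord]
  split
  · have h1 := esize_bool_le s
    have h2 := esize_bool_le (decide (s = b))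
    simp only [esize_pair]
    omega
  · have h1 := esize_bool_le s'
    have h2 := esize_bool_le (decide (s' = b))
    simp only [esize_pair]
    omega

/-- Each step adds one record, whose size is bounded by that of a cell of the given list or of the
default cell. -/
theorem polyTime_walk : PolyTime (fun x : ℕ × List CellEntry => walk x.1 x.2) := by
  have hhead : PolyTime (fun x : (ℕ × List CellEntry) × (List CellRecord × Bool) =>
      x.2.1.headD (0, 0, false, false)) := .headD (.comp .fst .snd) (.const _)
  have hstart : PolyTime (fun x : ℕ × List CellEntry => startCell x.2) :=
    polyTime_startCell.comp .snd
  have hd : PolyTime (fun x : (ℕ × List CellEntry) × (List CellRecord × Bool) => x.2.2) :=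
    .comp .snd .snd
  refine .reverse (.comp .fst (.iterate (f := fun (x : ℕ × List CellEntry) => walkStep x.2)
    (.pair (.cons (.nextRecord hd hhead (.headD (.linkedCells (.comp .snd .fst) hd
      (.pair (.comp .fst hhead) (.pair (.comp .fst (.comp .snd hhead)) (.const false))))
        (.const _))) (.comp .fst .snd)) hd.not) (.sub .fst (.const 1))
    (.pair (.cons (.pair (.comp .fst hstart) (.pair (.comp .fst (.comp .snd hstart))
      (.pair (.const true) (.comp .snd (.comp .snd hstart))))) (.const []))
      (.any (.linked (.const true) (hstart.comp .fst) .snd) .snd))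
    ⟨.X + 30, fun c st => ?_⟩))
  obtain ⟨l, d⟩ := st
  rw [walkStep]
  generalize (l.headD (0, 0, false, false)) = h
  have h1 := esize_nextRecord_le d h
    ((linkedCells c.2 d (h.1, h.2.1, false)).headD (0, 0, false))
  have h2 : esize ((linkedCells c.2 d (h.1, h.2.1, false)).headD (0, 0, false)) ≤
      esize c.2 + 5 := by
    cases hl : linkedCells c.2 d (h.1, h.2.1, false) with
    | nil => exact Nat.le_add_left 5 _
    | cons a l' =>
      have ha : a ∈ c.2 := (List.mem_filter.1 (hl ▸ List.mem_cons_self : a ∈ linkedCells ..)).1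
      exact (esize_le_of_mem ha).trans (Nat.le_add_right _ _)
  have h3 := esize_bool_le (!d)
  obtain ⟨i, L⟩ := c
  simp only [esize_pair, esize_list_cons, Polynomial.eval_add, Polynomial.eval_X,
    Polynomial.eval_ofNat] at *
  omega

theorem PolyTime.walk {k : γ → ℕ} {L : γ → List CellEntry} (hk : PolyTime k) (hL : PolyTime L) :
    PolyTime (fun c => PermMSO.walk (k c) (L c)) :=
  polyTime_walk.comp (.pair hk hL)

end

/-! ### The algorithm -/

theorem enc_ofFn {α : Type} [Enc α] {n : ℕ} (f : Fin n → α) :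
    enc (List.ofFn f) = Data.ofList (List.ofFn fun i => enc (f i)) := by
  change Data.ofList ((List.ofFn f).map enc) = _
  rw [List.map_ofFn]
  rfl

theorem GriddingMatrix.enc_toLists (M : GriddingMatrix) : enc M.toLists = M.encode := by
  rw [toLists, enc_ofFn, encode]
  congr 2
  funext i
  rw [enc_ofFn]
  congr 2
  funext j
  cases M.entry i j <;> rfl

/-- Positive numbers, represented by their predecessors. -/
structure SuccNat : Type where
  val : ℕ

instance : Enc SuccNat := ⟨fun k => Data.unary (k.val + 1)⟩

theorem PolyTime.succNat : PolyTime SuccNat.mk :=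
  .of_eq_enc ((PolyTime.of_enc_eq (f := fun n : ℕ => enc n) fun _ => rfl).comp (.succ .id))
    fun _ => rfl

/-- The gridding matrices of a class with the long path property, for positive numbers of cells. -/
theorem HasPolyTimeLPP.exists_matrices {C : Set Permutation} (hC : HasPolyTimeLPP C) :
    ∃ M : ℕ → GriddingMatrix, PolyTime (fun n => (M (n + 1)).toLists) ∧
      ∀ n, (M (n + 1)).Grid ⊆ C ∧ (M (n + 1)).IsTurningPath (n + 1) := by
  obtain ⟨c, p, h⟩ := hC
  have h' : ∀ n, ∃ M : GriddingMatrix, 0 < n → M.Grid ⊆ C ∧ M.IsTurningPath n ∧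
      c.Computes (.unary n) (p.eval n) M.encode := fun n => by
    rcases Nat.eq_zero_or_pos n with rfl | hn
    -- The long path property says nothing about `0`; the value chosen there is never used.
    · exact ⟨⟨0, 0, fun _ _ => .empty⟩, fun h => absurd h (lt_irrefl 0)⟩
    · obtain ⟨M, hM⟩ := h n hn
      exact ⟨M, fun _ => hM⟩
  choose M hM using h'
  refine ⟨M, ?_, fun n => ⟨(hM _ n.succ_pos).1, (hM _ n.succ_pos).2.1⟩⟩
  have : PolyTime (fun k : SuccNat => (M (k.val + 1)).toLists) :=
    .of_computes c p fun k => by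
      obtain ⟨t, ht, hex⟩ := (hM _ k.val.succ_pos).2.2
      rw [GriddingMatrix.enc_toLists]
      -- The given time bound is in terms of the number, which is at most the size of its unary
      -- code.
      refine ⟨t, ht.trans (eval_mono p ?_), hex⟩
      have : esize k = 2 * (k.val + 1) + 1 := esize_nat (k.val + 1)
      omega
  exact this.comp .succNat

open Classical in
/-- The adjacency matrix of a graph. -/
noncomputable def adjLists {n : ℕ} (G : SimpleGraph (Fin n)) : List (List Bool) :=
  List.ofFn fun u => List.ofFn fun w => decide (G.Adj u w)

theorem enc_adjLists {n : ℕ} (G : SimpleGraph (Fin n)) : enc (adjLists G) = encodeGraph G := by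
  rw [adjLists, enc_ofFn, encodeGraph]
  congr 2
  funext u
  rw [enc_ofFn]
  rfl

/-- Look-ups outside the matrix return `false`, so the encoding may use adjacency of arbitrary
natural numbers. -/
theorem adjOf_adjLists_iff {n : ℕ} (G : SimpleGraph (Fin n)) (u w : ℕ) :
    adjOf (adjLists G) u w = true ↔ ∃ (hu : u < n) (hw : w < n), G.Adj ⟨u, hu⟩ ⟨w, hw⟩ := by
  classical
  by_cases hu : u < n
  · have h : (adjLists G).getD u [] = List.ofFn fun w => decide (G.Adj ⟨u, hu⟩ w) := by
      rw [List.getD_eq_getElem _ _ (by simpa [adjLists] using hu)]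
      simp [adjLists]
    rw [adjOf, h]
    by_cases hw : w < n
    · rw [List.getD_eq_getElem _ _ (by simpa using hw)]
      simp [hu, hw]
    · rw [List.getD_eq_default _ _ (by simpa using hw)]
      simp [hw]
  · have h : (adjLists G).getD u [] = [] := List.getD_eq_default _ _ (by simpa [adjLists] using hu)
    rw [adjOf, h]
    simp [hu]

/-- The values of the permutation that encodes a graph in the grid class of a matrix. -/
def encodingValues (m : ℕ → List (List ℕ)) (g : List (List Bool)) : List ℕ :=
  permOfInput (g, (m (3 * g.length + 1)).length,
    walk (3 * g.length + 2) (cellEntries (m (3 * g.length + 1))))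

theorem PolyTime.encodingValues {m : ℕ → List (List ℕ)} (hm : PolyTime m) :
    PolyTime (PermMSO.encodingValues m) := by
  have hn : PolyTime (fun g : List (List Bool) => 3 * g.length + 1) :=
    .succ (.mul (.const 3) (.length .id))
  have hk : PolyTime (fun g : List (List Bool) => 3 * g.length + 2) := hn.succ
  have hmat : PolyTime (fun g : List (List Bool) => m (3 * g.length + 1)) := hm.comp hn
  have hwalk : PolyTime (fun g : List (List Bool) =>
      PermMSO.walk (3 * g.length + 2) (cellEntries (m (3 * g.length + 1)))) :=
    .walk hk (polyTime_cellEntries.comp hmat)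
  have hinput : PolyTime (fun g : List (List Bool) => ((g, (m (3 * g.length + 1)).length,
      PermMSO.walk (3 * g.length + 2) (cellEntries (m (3 * g.length + 1)))) : EncodingInput)) :=
    PolyTime.pair .id (PolyTime.pair hmat.length hwalk)
  exact polyTime_permOfInput.comp hinput

/-- The left side is `30n² + 35n + 10`, and `n ≤ n²`. -/
theorem pointBound_le (n : ℕ) : pointBound n (3 * n + 2) ≤ 75 * (n ^ 2 + 1) := by
  unfold pointBound
  nlinarith [sq_nonneg ((n : ℤ) - 1), Nat.zero_le n, (Nat.le_self_pow two_ne_zero n)]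

/-- The permutation that encodes a graph. -/
theorem exists_permutation {M : GriddingMatrix} {n : ℕ} (hM : M.IsTurningPath (3 * n + 2))
    (G : SimpleGraph (Fin n)) : ∃ π ∈ M.Grid, π.1 ≤ pointBound n (3 * n + 2) ∧
      Permutation.encode π = enc (permOfInput (adjLists G, M.toLists.length,
        walk (3 * n + 2) (cellEntries M.toLists))) ∧
      ∀ φ, GraphModels G φ ↔ PermModels π (translateSentence φ) := by
  have hlen : (adjLists G).length = n := by simp [adjLists]
  -- The cells `3w + 1` with `w < n` fit on a path of `3n + 2` cells, and there are always at least
  -- two cells, as the walk requires.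
  obtain ⟨π, p, hπ, hle, hval, E⟩ := exists_encoding (n := n) (adj := adjOf (adjLists G))
    (hM.isLayoutOf_walk (by omega)) le_rfl
  refine ⟨π, hπ, hle, ?_, fun φ => ?_⟩
  · have : M.toLists.length = M.cols := by simp [GriddingMatrix.toLists]
    simp only [permOfInput, hlen, this, ← hval, enc_ofFn]
    rfl
  · obtain ⟨ι, hι⟩ := E.exists_vertexPoint
    refine (holds_translateSentence ι (fun u w h => ?_) (E.not_blockGT_one_iff hι)
      (fun u w => (E.decodesEdge_iff hι (fun w => ?_) u w).trans ?_) φ).symm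
    · have h1 := (hι u).1
      have h2 := (hι w).1
      rw [h] at h1
      exact Fin.ext (by omega)
    · rw [← Bool.not_eq_true, adjOf_adjLists_iff]
      rintro ⟨h1, h2, h⟩
      exact G.loopless.irrefl _ h
    · rw [adjOf_adjLists_iff]
      exact ⟨fun ⟨_, _, h⟩ => h, fun h => ⟨u.2, w.2, h⟩⟩

end PermMSO

theorem mainTheorem3 :
    -- The translation `Ψ` of sentences and both constants are independent of the class.
    ∃ (Ψ : MSOSentence GraphSymbol → MSOSentence OrderSymbol) (a b : ℕ),
      (∀ φ, (Ψ φ).1.length ≤ a * φ.1.length) ∧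
      ∀ C : Set Permutation, IsPermClass C → HasPolyTimeLPP C →
        ∃ (alg : Program) (p : Polynomial ℕ),
          ∀ (n : ℕ) (G : SimpleGraph (Fin n)) (φ : MSOSentence GraphSymbol),
            ∃ π ∈ C,
              π.1 ≤ b * (n ^ 2 + 1) ∧
              (GraphModels G φ ↔ PermModels π (Ψ φ)) ∧
              alg.Computes
                (.cons (encodeGraph G) (φ.1.encode GraphSymbol.encode))
                (p.eval (Data.cons (encodeGraph G) (φ.1.encode GraphSymbol.encode)).size)
                (.cons (Permutation.encode π) ((Ψ φ).1.encode OrderSymbol.encode)) := by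
  -- The constant `a` comes from `length_translate_le`: it is 12 plus the lengths of the two fixed
  -- formulas.
  refine ⟨translateSentence, _, 75, fun φ => MSOFormula.length_translate_le _ _ φ.1,
    fun C _ hC => ?_⟩
  obtain ⟨M, hpoly, hM⟩ := hC.exists_matrices
  obtain ⟨alg, p, halg⟩ := PolyTime.computes (.pair (hpoly.encodingValues.comp .fst)
    ((PolyTime.translate .decodesVertex .decodesEdge).comp .snd))
  refine ⟨alg, p, fun n G φ => ?_⟩
  -- The matrices are indexed by the predecessor of the number of cells, so this is the one with `3n
  -- + 2` cells.
  obtain ⟨hgrid, hpath⟩ := hM (3 * n + 1)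
  obtain ⟨π, hπ, hle, henc, hmodels⟩ := exists_permutation hpath G
  refine ⟨π, hgrid hπ, hle.trans (pointBound_le n), hmodels φ, ?_⟩
  have hlen : (adjLists G).length = n := by simp [adjLists]
  have := halg (adjLists G, φ.1)
  simp only [encodingValues, hlen, esize, enc_pair, enc_adjLists, ← henc] at this
  exact this
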